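/- Let $\omega^g_n$ ($g\ge 0$, $n\ge 1$) be the Eynard–Orantin invariants of the rational curve $x=z+1/z$, $y=\ln z$ (where $y$ is a branch of the logarithm near each of the branch points $z=\pm1$ of $x$), defined with $\hat z=1/z$ by $\omega^0_1=-y\,dx$, $\omega^0_2=B(z_1,z_2)=\dfrac{dz_1dz_2}{(z_1-z_2)^2}$ and, for $2g-2+n+1>0$ and $S=\{1,\dots,n\}$, $$\omega^g_{n+1}(z_0,z_S)=\sum_{\alpha=\pm1}\operatorname*{Res}_{z=\alpha}K(z_0,z)\Big[\omega^{g-1}_{n+2}(z,\hat z,z_S)+\sum_{\substack{g_1+g_2=g\\ I\sqcup J=S}}\omega^{g_1}_{|I|+1}(z,z_I)\,\omega^{g_2}_{|J|+1}(\hat z,z_J)\Big],\qquad K(z_0,z)=\frac{-\int_{\hat z}^{z}B(z_0,z')}{2(y(z)-y(\hat z))\,dx(z)},$$ where the first term is absent for $g=0$ and the terms containing a factor $\omega^0_1$ are omitted from the inner sum. Put $w(b)=b\binom{b-1}{(b-1)/2}$ for odd $b$ and $w(b)=\frac b2\binom{b}{b/2}$ for even $b$. **Theorem.** (1) For $n\ge1$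 and $2g-2+n>0$, $\omega^g_n$ has a convergent expansion about the branch $z_i=\infty$ of $\{x_i=\infty\}$, $$\omega^g_n=\sum_{b_1,\dots,b_n\ge0}\frac{M^g_n(b_1,\dots,b_n)}{x_1^{b_1+1}\cdots x_n^{b_n+1}}\,dx_1\cdots dx_n ,$$ and $M^g_n$ has *polynomial form of genus $g$*: it is symmetric, and for each $0\le k\le n$ there is a polynomial $m^g_{n,k}$ of degree at most $3g-3+n$, symmetric in its first $k$ and in its last $n-k$ variables, with $M^g_n(b)=\prod_{i=1}^n w(b_i)\cdot m^g_{n,k}(b)$ whenever $b_1,\dots,b_k$ are odd and $b_{k+1},\dots,b_n$ are even. (2) For $n\ge1$ and $2g-2+n>0$ the divisor and string equations hold: $$M^g_{n+1}(b_1,\dots,b_n,1)=d\,M^g_n(b_1,\dots,b_n),\qquad 2d=2-2g-n+\sum_{i=1}^n b_i,$$ $$M^g_{n+1}(b_1,\dots,b_n,0)=\sum_{i=1}^n b_i\,M^g_n(b_1,\dots,b_i-1,\dots,b_n).$$ In the string equation summands with $b_i=0$ are zero, and the left-hand side is defined, when $b_1,\dots,b_k$ are odd and $b_{k+1},\dots,b_n$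 are even, as $\prod_{i=1}^n w(b_i)\cdot m^g_{n+1,k}(b_1,\dots,b_n,0)$ (other orderings follow by symmetry). (3) These equations determine the genus zero coefficients from the initial case $M^0_3$: if $(\widetilde M_n)_{n\ge3}$ is a family of functions of polynomial form of genus $0$ which satisfies the divisor and string equations with $g=0$ for all $n\ge3$, and $\widetilde M_3=M^0_3$, then $\widetilde M_n=M^0_n$ for all $n\ge3$. (4) Together with the top degree terms they determine the genus one coefficients from the initial case $M^1_1$: if $(\widetilde M_n)_{n\ge1}$ is a family of functions of polynomial form of genus $1$, with polynomials $\widetilde m_{n,k}$, which satisfies the divisor and string equations with $g=1$ for all $n\ge1$, if $\widetilde M_1=M^1_1$, and if for all $n\ge 1$ and $0\le k\le n$ the polynomials $\widetilde m_{n,k}$ and $m^1_{n,k}$ have the same coefficients in degree $n=3g-3+n$, then $\widetilde M_n=M^1_n$ for all $n\ge1$. -/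

import Mathlib

open scoped Topology

noncomputable section

namespace EynardOrantin

/-! ### Spectral curves `x = z + 1/z`, `y = y(z)` on the Riemann sphere

A multidifferential on the sphere is written `f(z₁,…,zₙ) dz₁ ⋯ dzₙ`; the definitions below deal with
its coefficient function `f : (Fin n → ℂ) → ℂ` in the global coordinate `z`. -/

/-- The function `x(z) = z + 1/z`. Its branch points are `z = 1` and `z = -1`. -/
def curveX (z : ℂ) : ℂ := z + z⁻¹

/-- The involution `z ↦ ẑ = 1/z`, which satisfies `x(ẑ) = x(z)`. -/
def hat (z : ℂ) : ℂ := z⁻¹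

/-- The residue `Res_{z = α} f(z) dz`, i.e. `(2πi)⁻¹` times the integral over a small circle about
`α`. -/
def residue (f : ℂ → ℂ) (α : ℂ) : ℂ :=
  Filter.limUnder (𝓝[>] (0 : ℝ)) fun r : ℝ => (2 * Real.pi * Complex.I)⁻¹ * ∮ z in C(α, r), f z

/-- The Bergmann kernel `B(z₁,z₂) = dz₁ dz₂ / (z₁ - z₂)²` of the sphere. -/
def bergmann (z₁ z₂ : ℂ) : ℂ := 1 / (z₁ - z₂) ^ 2

/-- The integral `∫_{ẑ}^{z} B(z₀, z')` in the variable `z'`: the function `z' ↦ 1 / (z₀ - z')` is a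
primitive of `z' ↦ 1 / (z₀ - z')²`. -/
def bergmannIntegral (z₀ z : ℂ) : ℂ := 1 / (z₀ - z) - 1 / (z₀ - hat z)

/-- The recursion kernel
`K(z₀,z) = - ∫_{ẑ}^{z} B(z₀,z') / (2 (y(z) - y(ẑ)) dx(z))` (coefficient of `dz₀ / dz`). -/
def kernel (y : ℂ → ℂ) (z₀ z : ℂ) : ℂ :=
  -bergmannIntegral z₀ z / (2 * (y z - y (hat z)) * deriv curveX z)

/-- The variables `z_I = (z_i)_{i ∈ I}`, listed in increasing order of `i`. -/
def restrictVars {n : ℕ} (z : Fin n → ℂ) (I : Finset (Fin n)) : Fin I.card → ℂ :=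
  fun j => z (I.orderEmbOfFin rfl j)

/-- The Eynard-Orantin invariants `ω^g_n` of the curve `x = z + 1/z`, `y = y(z)`, where `y` is
analytic near `±1`. The argument `n` counts all the variables and `omega y g n z` is the coefficient
of `dz₁ ⋯ dzₙ`. In the recursion the differentials in the variable `ẑ` contribute the factor
`dẑ/dz`, and the terms containing the unstable factor `ω^0_1` are left out of the sum.
(There is no invariant with `n = 0` here; the value is a dummy.) -/
def omega (y : ℂ → ℂ) : (g n : ℕ) → (Fin n → ℂ) → ℂ
  | _, 0 => fun _ => 0
  | 0, 1 => fun z => -y (z 0) * deriv curveX (z 0)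
  | 0, 2 => fun z => bergmann (z 0) (z 1)
  | g, n + 1 => fun z =>
    let integrand : ℂ → ℂ := fun w =>
      kernel y (z 0) w * deriv hat w *
        ((if _h : 1 ≤ g then
            omega y (g - 1) (n + 2) (Fin.cons w (Fin.cons (hat w) (Fin.tail z)))
          else 0) +
        ∑ g₁ : Fin (g + 1), ∑ I : Finset (Fin n),
          if _h : ¬((g₁ : ℕ) = 0 ∧ I = ∅) ∧ ¬(g - (g₁ : ℕ) = 0 ∧ Iᶜ = ∅) then
            omega y g₁ (I.card + 1) (Fin.cons w (restrictVars (Fin.tail z) I)) *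
            omega y (g - g₁) (Iᶜ.card + 1) (Fin.cons (hat w) (restrictVars (Fin.tail z) Iᶜ))
          else 0)
    residue integrand 1 + residue integrand (-1)
  termination_by g n => 2 * g + n
  decreasing_by
    · omega
    · have hc : I.card + Iᶜ.card = n := by
        have h := Finset.card_add_card_compl I
        rwa [Fintype.card_fin] at h
      have h2 := _h.2
      rw [← Finset.card_eq_zero] at h2
      have := g₁.isLt
      omega
    · have hc : I.card + Iᶜ.card = n := by
        have h := Finset.card_add_card_compl I
        rwa [Fintype.card_fin] at h
      have h1 := _h.1
      rw [← Finset.card_eq_zero] at h1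
      have := g₁.isLt
      omega

/-- The function `y = ln z` near the branch points `±1`: a branch of the logarithm on `Re z ≠ 0`.
It is analytic near `1` and near `-1`, where up to an additive constant (which does not affect
`y(z) - y(1/z)`) it is the sum of the series `∑_{k ≥ 1} (1 - z²)^k / (-2k)`. -/
def lnBranch (z : ℂ) : ℂ :=
  if 0 < z.re then Complex.log z else Complex.log (-z) + Real.pi * Complex.I

theorem exp_lnBranch {z : ℂ} (hz : z ≠ 0) : Complex.exp (lnBranch z) = z := by
  unfold lnBranch
  split_ifs
  · exact Complex.exp_log hz
  · rw [Complex.exp_add, Complex.exp_log (neg_ne_zero.mpr hz), Complex.exp_pi_mul_I]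
    ring

/-! ### Expansion about `x = ∞` -/

/-- `M` is the family of coefficients of the expansion
`f dz₁ ⋯ dzₙ = ∑_b M(b) / (x₁^{b₁+1} ⋯ xₙ^{bₙ+1}) dx₁ ⋯ dxₙ`
about the branch `z_i = ∞` of `{x_i = ∞}`. -/
def IsExpansionAtInfinity {n : ℕ} (f : (Fin n → ℂ) → ℂ) (M : (Fin n → ℕ) → ℂ) : Prop :=
  ∃ R : ℝ, ∀ z : Fin n → ℂ, (∀ i, R < ‖z i‖) →
    HasSum (fun b : Fin n → ℕ =>
      M b * ∏ i, (deriv curveX (z i) / curveX (z i) ^ (b i + 1))) (f z)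

open Classical in
/-- The coefficients of the expansion about `x = ∞` (zero if there is no such expansion). -/
def expansionCoeff {n : ℕ} (f : (Fin n → ℂ) → ℂ) : (Fin n → ℕ) → ℂ :=
  if h : ∃ M, IsExpansionAtInfinity f M then h.choose else 0

/-- The coefficients `M^g_n(b₁,…,bₙ)` for the curve `x = z + 1/z`, `y = ln z`. -/
def coeffM (g n : ℕ) : (Fin n → ℕ) → ℂ := expansionCoeff (omega lnBranch g n)

/-! ### Polynomial parts -/

/-- The factor `b * binom(b-1, (b-1)/2)` for odd `b` and `(b/2) * binom(b, b/2)` for even `b`. -/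
def weight (b : ℕ) : ℂ :=
  if Odd b then (b : ℂ) * ((b - 1).choose ((b - 1) / 2) : ℂ)
  else (b : ℂ) / 2 * (b.choose (b / 2) : ℂ)

/-- Exactly the first `k` entries of `b` are odd. -/
def FirstOdd {n : ℕ} (k : ℕ) (b : Fin n → ℕ) : Prop := ∀ i, Odd (b i) ↔ (i : ℕ) < k

/-- `p` is a polynomial part of `M` when the first `k` variables are odd and the others even:
`M(b) = ∏ weight(b_i) · p(b₁,…,bₙ)` for all such `b`. -/
def IsPolynomialPart {n : ℕ} (M : (Fin n → ℕ) → ℂ) (k : ℕ) (p : MvPolynomial (Fin n) ℂ) : Prop :=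
  ∀ b : Fin n → ℕ, FirstOdd k b →
    M b = (∏ i, weight (b i)) * MvPolynomial.eval (fun i => (b i : ℂ)) p

open Classical in
/-- The polynomial part of `M` when the first `k` variables are odd (zero if there is none). For
`M = M^g_n` this is the polynomial `m^g_{n,k}`. -/
def polynomialPart {n : ℕ} (M : (Fin n → ℕ) → ℂ) (k : ℕ) : MvPolynomial (Fin n) ℂ :=
  if h : ∃ p, IsPolynomialPart M k p then h.choose else 0

/-- `M` is a symmetric function which, for each number `k` of odd arguments, is the product of the
weights and a polynomial of degree at most `3g - 3 + n`, symmetric in variables of the same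
parity. -/
def HasPolynomialForm (g : ℕ) {n : ℕ} (M : (Fin n → ℕ) → ℂ) : Prop :=
  (∀ (σ : Equiv.Perm (Fin n)) (b : Fin n → ℕ), M (b ∘ σ) = M b) ∧
  ∀ k ≤ n, ∃ p : MvPolynomial (Fin n) ℂ, IsPolynomialPart M k p ∧
    p.totalDegree ≤ 3 * g + n - 3 ∧
    ∀ σ : Equiv.Perm (Fin n), (∀ i, (σ i : ℕ) < k ↔ (i : ℕ) < k) → MvPolynomial.rename σ p = p

/-! ### Divisor and string equations -/

/-- The divisor equation `M_{n+1}(b₁,…,bₙ,1) = d M_n(b₁,…,bₙ)` with `2d = 2 - 2g - n + ∑ b_i`. -/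
def DivisorEquation (g : ℕ) {n : ℕ} (M : (Fin n → ℕ) → ℂ) (M' : (Fin (n + 1) → ℕ) → ℂ) : Prop :=
  ∀ (b : Fin n → ℕ) (d : ℂ), 2 * d = 2 - 2 * (g : ℂ) - (n : ℂ) + ∑ i, (b i : ℂ) →
    M' (Fin.snoc b 1) = d * M b

/-- The value of `M_{n+1}` at `(b₁,…,bₙ,0)` in the string equation, where the first `k` of the `b_i`
are odd and the others even: the product of the weights of `b₁,…,bₙ` (but not of the last argument)
and the value `m_{n+1,k}(b₁,…,bₙ,0)` of the polynomial part. -/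
def valueAtZero {n : ℕ} (M' : (Fin (n + 1) → ℕ) → ℂ) (k : ℕ) (b : Fin n → ℕ) : ℂ :=
  (∏ i, weight (b i)) *
    MvPolynomial.eval (Fin.snoc (fun i => (b i : ℂ)) 0 : Fin (n + 1) → ℂ) (polynomialPart M' k)

/-- The string equation `M_{n+1}(b₁,…,bₙ,0) = ∑ b_i M_n(b₁,…,b_i - 1,…,bₙ)` (a summand with
`b_i = 0` is zero). -/
def StringEquation {n : ℕ} (M : (Fin n → ℕ) → ℂ) (M' : (Fin (n + 1) → ℕ) → ℂ) : Prop :=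
  ∀ k ≤ n, ∀ b : Fin n → ℕ, FirstOdd k b →
    valueAtZero M' k b = ∑ i, (b i : ℂ) * M (Function.update b i (b i - 1))

end EynardOrantin

end

open scoped Topology

noncomputable section

namespace EynardOrantin

open MvPolynomial

/-! The invariants are the derivatives at the origin of a formal free energy. Near a branch point `α
= ±1` the coordinate `s` with `z = α exp s` makes the involution `s ↦ -s`, `y(z) - y(ẑ) = 2s` and `x
= 2α cosh s`. All stable invariants are polynomials in the differentials `basis (α, l)`, which have
a pole of order `2l + 2` at `α`. Hence `ω^g_n(z_1, …, z_n)` can be encoded as the `n`-fold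
derivative, along the covectors `ev (z_i)`, of a polynomial `F (2g - 2 + n)` in variables indexed by
the pairs `(α, l)`.

Expanding the kernel in even powers of `s` turns the recursion into equations `D_i Z_{m+1} = L_i
Z_m` for the exponential of the free energy, where `D_i` is a constant vector field and `L_i` is a
coefficient of the square of a Heisenberg current. The operators `L_i - D_i` close into Virasoro
relations (`virasoro_comm`, `dirDeriv_dualCoeff_virasoro_sub`), so the equations are integrable and
a Poincaré lemma solves them (`exists_partitionFunction`). The logarithm satisfies a quadratic
recursion, and comparing it with residues gives `omega_eq_corr`. Symmetry of the invariants is then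
automatic, and counting weights (`IsFreeEnergy.coeff_bound`) gives the degree bound `3g - 3 + n`.

The string and divisor equations are the combinations of the constraints whose coefficients come
from the function `x ^ J / x'` with `J = 0, 1`. Their second order parts are sums of residues of a
rational differential without other poles, so they vanish and a first order equation remains
(`IsFreeEnergy.string`). Its vector field acts on the basis by `f dz ↦ -d(x ^ J f / x')`, which on
coefficients of `x ^ (-b-1) dx` is a shift of `b`. For `J = 1` the dilaton equation
`IsFreeEnergy.dilaton` contributes the term `2 - 2g - n`.

At infinity the basis differentials are obtained from `1 / (z - 1/z) = (x² - 4)^(-1/2)`, whose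
coefficients are central binomials. Raising the level by one multiplies the coefficient, relative to
the weight, by a polynomial in `b` of one degree more for each parity of `b` (`xc_eq`,
`natDegree_modePoly_le`).

For the uniqueness statements, the divisor equation prescribes the polynomial on the hyperplanes
`b_j = 1` of the odd variables and the string equation on `b_j = 0` of the even ones. The difference
of two solutions is divisible by one linear form for each variable, so it vanishes if its degree is
less than the number of variables. In genus zero the degree bound suffices; in genus one the top
degree terms have to agree as well. -/

/-! ### Differential operators on the Fock space -/

/-- Index of a basis differential: a branch point (`true` for `1`, `false` for `-1`) and a level. -/
abbrev Mode := Bool × ℕ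

/-- The variable `X j` stands for the differential `basis j`: differentiating a polynomial along the
covectors of values of these differentials at points `z_i` produces a symmetric multidifferential.
-/
abbrev Fock := MvPolynomial Mode ℂ

/-- The constant vector field with components `l`. -/
def dirDeriv (l : Mode → ℂ) : Derivation ℂ Fock Fock := mkDerivation ℂ fun i => C (l i)

@[simp] theorem dirDeriv_X (l : Mode → ℂ) (i : Mode) : dirDeriv l (X i) = C (l i) :=
  mkDerivation_X ..

theorem derivation_sum_apply {κ : Type*} (s : Finset κ) (D : κ → Derivation ℂ Fock Fock) (f : Fock) :
    (∑ i ∈ s, D i) f = ∑ i ∈ s, D i f := by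
  classical
  induction s using Finset.induction_on with
  | empty => simp
  | insert a s ha ih => simp only [Finset.sum_insert ha, Derivation.add_apply, ih]

theorem mkDerivation_eq_sum (b : Mode → Fock) (f : Fock) {s : Finset Mode} (hs : f.vars ⊆ s) :
    mkDerivation ℂ b f = ∑ i ∈ s, b i * pderiv i f := by
  have h : mkDerivation ℂ b f = (∑ i ∈ s, b i • pderiv (R := ℂ) i : Derivation ℂ Fock Fock) f := by
    apply derivation_eq_of_forall_mem_vars
    intro j hj
    rw [mkDerivation_X, derivation_sum_apply, Finset.sum_eq_single j]
    · simp
    · intro i _ hij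
      simp [pderiv_X_of_ne hij.symm]
    · intro hj'
      exact absurd (hs hj) hj'
  rw [h, derivation_sum_apply]
  rfl

theorem dirDeriv_eq_sum (l : Mode → ℂ) (f : Fock) {s : Finset Mode} (hs : f.vars ⊆ s) :
    dirDeriv l f = ∑ i ∈ s, C (l i) * pderiv i f :=
  mkDerivation_eq_sum _ _ hs

theorem dirDeriv_congr {l l' : Mode → ℂ} {f : Fock} (h : ∀ i ∈ f.vars, l i = l' i) :
    dirDeriv l f = dirDeriv l' f :=
  derivation_eq_of_forall_mem_vars fun i hi => by rw [dirDeriv_X, dirDeriv_X, h i hi]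

theorem dirDeriv_add (l l' : Mode → ℂ) (f : Fock) :
    dirDeriv (fun i => l i + l' i) f = dirDeriv l f + dirDeriv l' f := by
  have : dirDeriv (fun i => l i + l' i) = dirDeriv l + dirDeriv l' :=
    derivation_ext fun i => by simp
  rw [this]; rfl

theorem dirDeriv_smul (c : ℂ) (l : Mode → ℂ) (f : Fock) :
    dirDeriv (fun i => c * l i) f = C c * dirDeriv l f := by
  have : dirDeriv (fun i => c * l i) = (C c : Fock) • dirDeriv l :=
    derivation_ext fun i => by simp
  rw [this]; rfl

theorem dirDeriv_zero (f : Fock) : dirDeriv (fun _ => 0) f = 0 := by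
  have : dirDeriv (fun _ => 0) = 0 := derivation_ext fun i => by simp
  rw [this]; rfl

theorem dirDeriv_sum {κ : Type*} (s : Finset κ) (l : κ → Mode → ℂ) (f : Fock) :
    dirDeriv (fun i => ∑ k ∈ s, l k i) f = ∑ k ∈ s, dirDeriv (l k) f := by
  classical
  induction s using Finset.induction_on with
  | empty => simpa using dirDeriv_zero f
  | insert a s ha ih => simp only [Finset.sum_insert ha, dirDeriv_add, ih]

theorem pderiv_eq_dirDeriv (i : Mode) (f : Fock) : pderiv i f = dirDeriv (Pi.single i 1) f := by
  have : (pderiv i : Derivation ℂ Fock Fock) = dirDeriv (Pi.single i 1) :=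
    derivation_ext fun j => by
      rw [dirDeriv_X, pderiv_X]
      by_cases h : j = i
      · subst h; simp
      · simp [h]
  rw [this]

/-- Commuting a constant vector field past a vector field. -/
theorem dirDeriv_mkDerivation (l : Mode → ℂ) (b : Mode → Fock) (f : Fock) :
    dirDeriv l (mkDerivation ℂ b f) =
      mkDerivation ℂ b (dirDeriv l f) + mkDerivation ℂ (fun i => dirDeriv l (b i)) f := by
  have h : ⁅dirDeriv l, mkDerivation ℂ b⁆ = mkDerivation ℂ (fun i => dirDeriv l (b i)) :=
    derivation_ext fun i => by simp [Derivation.commutator_apply, mkDerivation_X]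
  have := congrArg (fun D : Derivation ℂ Fock Fock => D f) h
  simp only [Derivation.commutator_apply] at this
  linear_combination this

theorem dirDeriv_comm (l l' : Mode → ℂ) (f : Fock) :
    dirDeriv l (dirDeriv l' f) = dirDeriv l' (dirDeriv l f) := by
  have h := dirDeriv_mkDerivation l (fun i => C (l' i)) f
  have h0 : mkDerivation ℂ (fun i => dirDeriv l (C (l' i))) f = 0 := by
    have : mkDerivation ℂ (fun i => dirDeriv l (C (l' i))) = (0 : Derivation ℂ Fock Fock) :=
      derivation_ext fun i => by rw [mkDerivation_X]; simp
    rw [this]; rfl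
  rw [h0, add_zero] at h
  exact h

/-! ### Second order operators with constant coefficients. -/

/-- The gradient of a polynomial. -/
def gradient : Derivation ℂ Fock (Mode →₀ Fock) := mkDerivation ℂ fun i => Finsupp.single i 1

theorem gradient_apply (f : Fock) (i : Mode) : gradient f i = pderiv i f := by
  classical
  have h : (Finsupp.lapply i : (Mode →₀ Fock) →ₗ[Fock] Fock).compDer gradient =
      (pderiv i : Derivation ℂ Fock Fock) := derivation_ext fun j => by
    simp [gradient, mkDerivation_X, Finsupp.single_apply, pderiv_X, Pi.single_apply, eq_comm]
  exact congrArg (fun D : Derivation ℂ Fock Fock => D f) h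

theorem gradient_support (f : Fock) : (gradient f).support ⊆ f.vars := by
  intro i hi
  rw [Finsupp.mem_support_iff, gradient_apply] at hi
  by_contra h
  exact hi (pderiv_eq_zero_of_notMem_vars h)

/-- The operator `∑ c i j ∂ᵢ ∂ⱼ`. -/
def laplacian (c : Mode → Mode → ℂ) : Fock →ₗ[ℂ] Fock :=
  (Finsupp.lsum ℂ fun i => (dirDeriv (c i)).toLinearMap) ∘ₗ gradient.toLinearMap

theorem laplacian_eq_sum (c : Mode → Mode → ℂ) (f : Fock) {s : Finset Mode} (hs : f.vars ⊆ s) :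
    laplacian c f = ∑ i ∈ s, dirDeriv (c i) (pderiv i f) := by
  have h : laplacian c f = (gradient f).sum fun i g => dirDeriv (c i) g := by
    simp [laplacian]
  rw [h, Finsupp.sum_of_support_subset _ ((gradient_support f).trans hs) _ (by simp)]
  simp_rw [gradient_apply]

theorem laplacian_eq_sum_sum (c : Mode → Mode → ℂ) (f : Fock) {s : Finset Mode}
    (hs : f.vars ⊆ s) :
    laplacian c f = ∑ i ∈ s, ∑ j ∈ s, C (c i j) * pderiv i (pderiv j f) := by
  rw [laplacian_eq_sum c f hs]
  refine Finset.sum_congr rfl fun i _ => ?_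
  rw [pderiv_eq_dirDeriv, dirDeriv_comm, dirDeriv_eq_sum _ _ hs, map_sum]
  refine Finset.sum_congr rfl fun j _ => ?_
  rw [Derivation.leibniz, pderiv_eq_dirDeriv i]
  simp

theorem laplacian_C (c : Mode → Mode → ℂ) (r : ℂ) : laplacian c (C r) = 0 := by
  rw [laplacian_eq_sum c (C r) subset_rfl]; simp

theorem laplacian_X_mul (c : Mode → Mode → ℂ) (hc : ∀ i j, c i j = c j i) (k : Mode) (f : Fock) :
    laplacian c (X k * f) = X k * laplacian c f + 2 * dirDeriv (c k) f := by
  classical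
  set s := insert k (f.vars ∪ (X k * f).vars)
  have hk : k ∈ s := Finset.mem_insert_self ..
  have hf : f.vars ⊆ s := fun i hi => by simp [s, hi]
  have hkf : (X k * f).vars ⊆ s := fun i hi => by simp only [s, Finset.mem_insert, Finset.mem_union]; tauto
  rw [laplacian_eq_sum c _ hkf, laplacian_eq_sum c f hf]
  have h : ∀ i ∈ s, dirDeriv (c i) (pderiv i (X k * f)) =
      X k * dirDeriv (c i) (pderiv i f) + C (c k i) * pderiv i f +
        if i = k then dirDeriv (c k) f else 0 := by
    intro i _
    rw [Derivation.leibniz, pderiv_X]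
    by_cases hik : i = k
    · subst hik
      simp [Derivation.leibniz]; ring
    · simp [hik, Derivation.leibniz, hc k i, Ne.symm hik]
      ring
  rw [Finset.sum_congr rfl h, Finset.sum_add_distrib, Finset.sum_add_distrib, ← Finset.mul_sum,
    ← dirDeriv_eq_sum (c k) f hf, Finset.sum_ite_eq' s k, if_pos hk]
  ring

theorem dirDeriv_laplacian (l : Mode → ℂ) (c : Mode → Mode → ℂ) (f : Fock) :
    dirDeriv l (laplacian c f) = laplacian c (dirDeriv l f) := by
  classical
  set s := f.vars ∪ (dirDeriv l f).vars
  rw [laplacian_eq_sum c f (s := s) Finset.subset_union_left,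
    laplacian_eq_sum c (dirDeriv l f) (s := s) Finset.subset_union_right, map_sum]
  refine Finset.sum_congr rfl fun i _ => ?_
  rw [dirDeriv_comm, pderiv_eq_dirDeriv, pderiv_eq_dirDeriv, dirDeriv_comm l]

/-- The bilinear form `∑ c i j ∂ᵢf ∂ⱼg`. -/
def gradForm (c : Mode → Mode → ℂ) (f g : Fock) : Fock :=
  ∑ i ∈ f.vars, pderiv i f * dirDeriv (c i) g

theorem gradForm_eq_sum (c : Mode → Mode → ℂ) (f g : Fock) {s : Finset Mode} (hs : f.vars ⊆ s) :
    gradForm c f g = ∑ i ∈ s, pderiv i f * dirDeriv (c i) g := by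
  refine Finset.sum_subset hs fun i _ hi => ?_
  rw [pderiv_eq_zero_of_notMem_vars hi, zero_mul]

theorem gradForm_eq_sum_sum (c : Mode → Mode → ℂ) (f g : Fock) {s : Finset Mode}
    (hf : f.vars ⊆ s) (hg : g.vars ⊆ s) :
    gradForm c f g = ∑ i ∈ s, ∑ j ∈ s, C (c i j) * (pderiv i f * pderiv j g) := by
  rw [gradForm_eq_sum c f g hf]
  refine Finset.sum_congr rfl fun i _ => ?_
  rw [dirDeriv_eq_sum _ _ hg, Finset.mul_sum]
  exact Finset.sum_congr rfl fun j _ => by ring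

/-- A linear map commuting with the coordinate derivatives commutes with all constant vector
fields. -/
theorem commute_dirDeriv_of_pderiv {T : Fock →ₗ[ℂ] Fock}
    (h : ∀ i f, T (pderiv i f) = pderiv i (T f)) (l : Mode → ℂ) (f : Fock) :
    T (dirDeriv l f) = dirDeriv l (T f) := by
  classical
  rw [dirDeriv_eq_sum l f (s := f.vars ∪ (T f).vars) Finset.subset_union_left,
    dirDeriv_eq_sum l (T f) (s := f.vars ∪ (T f).vars) Finset.subset_union_right, map_sum]
  refine Finset.sum_congr rfl fun i _ => ?_
  rw [← smul_eq_C_mul, ← smul_eq_C_mul, map_smul, h]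

theorem eq_C_of_pderiv_eq_zero {f : Fock} (h : ∀ i, pderiv i f = 0) : f = C (constantCoeff f) := by
  ext m
  rw [coeff_C]
  split_ifs with hm
  · rw [← hm]; rfl
  · obtain ⟨i, hi⟩ : ∃ i, m i ≠ 0 := by
      by_contra hcon
      push Not at hcon
      exact hm (Finsupp.ext fun i => by simp [hcon i])
    have h1 := congrArg (coeff (m - Finsupp.single i 1)) (h i)
    rw [coeff_pderiv, tsub_add_cancel_of_le (Finsupp.single_le_iff.mpr (Nat.one_le_iff_ne_zero.mpr hi)),
      coeff_zero] at h1
    rcases mul_eq_zero.mp h1 with h2 | h2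
    · exact h2
    · exact absurd h2 (Nat.cast_add_one_ne_zero _)

/-- A linear map commuting with multiplications and coordinate derivatives is a scalar. -/
theorem eq_zero_of_commute {T : Fock →ₗ[ℂ] Fock} (hd : ∀ i f, T (pderiv i f) = pderiv i (T f))
    (hX : ∀ i f, T (X i * f) = X i * T f) (h1 : constantCoeff (T 1) = 0) (f : Fock) : T f = 0 := by
  have h0 : T 1 = 0 := by
    have := eq_C_of_pderiv_eq_zero (f := T 1) fun i => by rw [← hd]; simp
    rw [this, h1, map_zero]
  induction f using MvPolynomial.induction_on with
  | C a => rw [← mul_one (C a), ← smul_eq_C_mul, map_smul, h0, smul_zero]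
  | add p q hp hq => rw [map_add, hp, hq, add_zero]
  | mul_X p i hp => rw [mul_comm, hX, hp, mul_zero]

/-! ### Heisenberg currents and Virasoro operators -/

/-- The coefficient of `s ^ (2 * n)` in the local expansion at the branch point `a` of the basis
differentials, whose polar part is `(2 * l + 1) * s ^ (-2 * l - 2)` at their own branch point and
whose regular part has the coefficients `reg`. -/
def localCoeff (reg : Mode → Mode → ℂ) (a : Bool) : ℤ → Mode → ℂ
  | Int.ofNat n => reg (a, n)
  | Int.negSucc m => fun j => if j = (a, m) then 2 * (m : ℂ) + 1 else 0

/-- Multiplication by a variable represents an insertion of the Bergmann kernel, which is regular at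
the branch point; so only modes of nonnegative index contain a variable. -/
def modeVar (a : Bool) : ℤ → Fock
  | Int.ofNat n => X (a, n)
  | Int.negSucc _ => 0

theorem localCoeff_negSucc (reg : Mode → Mode → ℂ) (a : Bool) (m : ℕ) (j : Mode) :
    localCoeff reg a (Int.negSucc m) j = if j = (a, m) then 2 * (m : ℂ) + 1 else 0 := rfl

theorem modeVar_ofNat (a : Bool) (n : ℕ) : modeVar a (Int.ofNat n) = X (a, n) := rfl

theorem modeVar_negSucc (a : Bool) (n : ℕ) : modeVar a (Int.negSucc n) = 0 := rfl

/-- The mode of index `n` of the Heisenberg current at the branch point `a`. -/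
def current (reg : Mode → Mode → ℂ) (a : Bool) (n : ℤ) (f : Fock) : Fock :=
  modeVar a n * f + dirDeriv (localCoeff reg a n) f

/-- `virConst`, `virField` and `virForm` are the parts of order zero, one and two of the coefficient
of `s ^ (-2p)` in the square of the current, with the variables to the left of the derivatives. Two
modes of nonnegative index meet only for `p = 0`. The constant `1 / 4` at `p = 1` is the polar part
of `B(w, ŵ)`, the two points having distance `2s`. -/
def virConst (reg : Mode → Mode → ℂ) (a : Bool) (p : ℕ) : Fock :=
  (if p = 0 then X (a, 0) ^ 2 + C (reg (a, 0) (a, 0)) else 0) + if p = 1 then C (1 / 4) else 0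

def virField (reg : Mode → Mode → ℂ) (a : Bool) (p : ℕ) (j : Mode) : Fock :=
  (if j.1 = a ∧ p ≤ j.2 + 1 then C (2 * (2 * (j.2 : ℂ) + 1)) * X (a, j.2 + 1 - p) else 0) +
    if p = 0 then C (2 * reg (a, 0) j) * X (a, 0) else 0

def virForm (reg : Mode → Mode → ℂ) (a : Bool) (p : ℕ) (i j : Mode) : ℂ :=
  (if i.1 = a ∧ p ≤ i.2 + 1 then (2 * (i.2 : ℂ) + 1) * reg (a, i.2 + 1 - p) j else 0) +
  (if j.1 = a ∧ p ≤ j.2 + 1 then (2 * (j.2 : ℂ) + 1) * reg (a, j.2 + 1 - p) i else 0) +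
  (if i.1 = a ∧ j.1 = a ∧ i.2 + j.2 + 2 = p then (2 * (i.2 : ℂ) + 1) * (2 * (j.2 : ℂ) + 1) else 0) +
  if p = 0 then reg (a, 0) i * reg (a, 0) j else 0

theorem virForm_symm (reg : Mode → Mode → ℂ) (a : Bool) (p : ℕ) (i j : Mode) :
    virForm reg a p i j = virForm reg a p j i := by
  unfold virForm
  have h : (i.1 = a ∧ j.1 = a ∧ i.2 + j.2 + 2 = p) ↔ (j.1 = a ∧ i.1 = a ∧ j.2 + i.2 + 2 = p) := by
    rw [add_comm i.2]; tauto
  simp only [h]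
  split_ifs <;> ring

/-- The mode of the Virasoro operator at the branch point `a` which belongs to the vector field
`s ^ (2 * p - 1) ∂ₛ`. -/
def virasoro (reg : Mode → Mode → ℂ) (a : Bool) (p : ℕ) : Fock →ₗ[ℂ] Fock :=
  LinearMap.mulLeft ℂ (virConst reg a p) + (mkDerivation ℂ (virField reg a p)).toLinearMap +
    laplacian (virForm reg a p)

theorem virasoro_apply (reg : Mode → Mode → ℂ) (a : Bool) (p : ℕ) (f : Fock) :
    virasoro reg a p f = virConst reg a p * f + mkDerivation ℂ (virField reg a p) f +
      laplacian (virForm reg a p) f := rfl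

theorem dirDeriv_virasoro (reg : Mode → Mode → ℂ) (a : Bool) (p : ℕ) (l : Mode → ℂ) (f : Fock) :
    dirDeriv l (virasoro reg a p f) = virasoro reg a p (dirDeriv l f) +
      dirDeriv l (virConst reg a p) * f +
        mkDerivation ℂ (fun j => dirDeriv l (virField reg a p j)) f := by
  simp only [virasoro_apply, map_add, dirDeriv_mkDerivation, dirDeriv_laplacian,
    Derivation.leibniz, smul_eq_mul]
  ring

theorem virasoro_X_mul (reg : Mode → Mode → ℂ) (a : Bool) (p : ℕ) (k : Mode) (f : Fock) :
    virasoro reg a p (X k * f) = X k * virasoro reg a p f + virField reg a p k * f +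
      2 * dirDeriv (virForm reg a p k) f := by
  simp only [virasoro_apply, laplacian_X_mul _ (virForm_symm reg a p), Derivation.leibniz,
    smul_eq_mul, mkDerivation_X]
  ring

theorem dirDeriv_virConst (reg : Mode → Mode → ℂ) (a : Bool) (p : ℕ) (l : Mode → ℂ) :
    dirDeriv l (virConst reg a p) = if p = 0 then C (2 * l (a, 0)) * X (a, 0) else 0 := by
  unfold virConst
  split_ifs <;> simp [Derivation.leibniz_pow, derivation_C, show (C 2 : Fock) = 2 from map_ofNat C 2]
  all_goals ring

theorem dirDeriv_virField (reg : Mode → Mode → ℂ) (a : Bool) (p : ℕ) (l : Mode → ℂ) (j : Mode) :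
    dirDeriv l (virField reg a p j) =
      C ((if j.1 = a ∧ p ≤ j.2 + 1 then 2 * (2 * (j.2 : ℂ) + 1) * l (a, j.2 + 1 - p) else 0) +
        if p = 0 then 2 * reg (a, 0) j * l (a, 0) else 0) := by
  unfold virField
  split_ifs <;> simp [Derivation.leibniz, derivation_C]

theorem mkDerivation_C_eq {b : Mode → Fock} {l : Mode → ℂ} (h : ∀ j, b j = C (l j)) (f : Fock) :
    mkDerivation ℂ b f = dirDeriv l f := by
  unfold dirDeriv
  congr 2
  funext j
  exact h j

theorem dirDeriv_localCoeff_negSucc (reg : Mode → Mode → ℂ) (a : Bool) (m : ℕ) (f : Fock) :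
    dirDeriv (localCoeff reg a (Int.negSucc m)) f = C (2 * (m : ℂ) + 1) * pderiv (a, m) f := by
  rw [pderiv_eq_dirDeriv, ← dirDeriv_smul]
  refine dirDeriv_congr fun j _ => ?_
  simp [localCoeff, Pi.single_apply]

/-- A mode `J_n` fails to commute only with `J_{-n-1}`, and that commutator is the scalar `2n + 1`;
two modes of nonnegative index commute by the symmetry of `reg`. In a sum of products `J_k J_l` with
`k + l = -p` the bracket with `J_n` therefore leaves twice this scalar times `J_{n+1-p}`. -/
theorem virasoro_current (reg : Mode → Mode → ℂ) (hreg : ∀ i j, reg i j = reg j i) (a : Bool)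
    (n : ℤ) (p : ℕ) (f : Fock) :
    virasoro reg a p (current reg a n f) = current reg a n (virasoro reg a p f) +
      C (2 * (2 * (n : ℂ) + 1)) * current reg a (n + 1 - p) f := by
  unfold current
  rcases n with l | k
  · rw [map_add, modeVar_ofNat, virasoro_X_mul, dirDeriv_virasoro]
    have key : ∀ j, 2 * virForm reg a p (a, l) j -
        ((if j.1 = a ∧ p ≤ j.2 + 1 then 2 * (2 * (j.2 : ℂ) + 1) * reg (a, l) (a, j.2 + 1 - p) else 0) +
        if p = 0 then 2 * reg (a, 0) j * reg (a, l) (a, 0) else 0) =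
        2 * (2 * (l : ℂ) + 1) * localCoeff reg a (Int.ofNat l + 1 - p) j := by
      intro j
      unfold virForm
      rw [hreg (a, l) (a, j.2 + 1 - p), hreg (a, l) (a, 0)]
      -- The resulting mode has nonnegative index exactly for `p ≤ l + 1`; otherwise it is polar and
      -- comes from the product of two polar modes in `virForm`.
      rcases le_or_gt p (l + 1) with hp | hp
      · obtain ⟨q, hq⟩ := Nat.exists_eq_add_of_le hp
        have h1 : (Int.ofNat l + 1 - p : ℤ) = Int.ofNat q := by simp; omega
        have h2 : l + 1 - p = q := by omega
        have h3 : ¬ (l + j.2 + 2 = p) := by omega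
        simp only [h1, localCoeff, h2, h3, hp, and_false, if_false, true_and, if_true]
        split_ifs <;> ring
      · obtain ⟨q, hq⟩ := Nat.exists_eq_add_of_le (show l + 2 ≤ p by omega)
        have h1 : (Int.ofNat l + 1 - p : ℤ) = Int.negSucc q := by simp; omega
        have h2 : (true ∧ j.1 = a ∧ l + j.2 + 2 = p) ↔ j = (a, q) := by
          rw [Prod.ext_iff]; simp; intro _; omega
        have h3 : ¬ p ≤ l + 1 := by omega
        have h4 : p ≠ 0 := by omega
        simp only [h1, localCoeff, h3, h4, and_false, if_false]
        by_cases hj : j = (a, q)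
        · subst hj
          have : l + q + 2 = p := by omega
          simp [this]
          split_ifs <;> ring
        · have : ¬ (j.1 = a ∧ l + j.2 + 2 = p) := by
            intro h; apply hj; rw [Prod.ext_iff]; exact ⟨h.1, by simp; omega⟩
          simp only [hj, this, and_false, if_false]
          split_ifs <;> ring
    have hd : 2 * dirDeriv (virForm reg a p (a, l)) f -
        mkDerivation ℂ (fun j => dirDeriv (localCoeff reg a (Int.ofNat l)) (virField reg a p j)) f =
        C (2 * (2 * (l : ℂ) + 1)) * dirDeriv (localCoeff reg a (Int.ofNat l + 1 - p)) f := by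
      rw [mkDerivation_C_eq (fun j => dirDeriv_virField reg a p _ j), ← dirDeriv_smul]
      simp_rw [← key]
      have := dirDeriv_add (fun j => 2 * virForm reg a p (a, l) j) (fun j => (-1) *
        ((if j.1 = a ∧ p ≤ j.2 + 1 then 2 * (2 * (j.2 : ℂ) + 1) * reg (a, l) (a, j.2 + 1 - p) else 0) +
        if p = 0 then 2 * reg (a, 0) j * reg (a, l) (a, 0) else 0)) f
      rw [dirDeriv_smul, dirDeriv_smul] at this
      rw [show (fun j => 2 * virForm reg a p (a, l) j -
        ((if j.1 = a ∧ p ≤ j.2 + 1 then 2 * (2 * (j.2 : ℂ) + 1) * reg (a, l) (a, j.2 + 1 - p) else 0) +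
        if p = 0 then 2 * reg (a, 0) j * reg (a, l) (a, 0) else 0)) = _ from
        funext fun j => (sub_eq_add_neg _ _).trans (by rw [neg_eq_neg_one_mul]), this]
      simp only [localCoeff, map_neg, map_one]
      rw [show (C (2 : ℂ) : Fock) = 2 from map_ofNat C 2]
      ring
    have hm : virField reg a p (a, l) - dirDeriv (localCoeff reg a (Int.ofNat l)) (virConst reg a p) =
        C (2 * (2 * (l : ℂ) + 1)) * modeVar a (Int.ofNat l + 1 - p) := by
      rw [dirDeriv_virConst]
      unfold virField
      simp only [localCoeff, hreg (a, 0) (a, l)]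
      rcases le_or_gt p (l + 1) with hp | hp
      · have h1 : (Int.ofNat l + 1 - p : ℤ) = Int.ofNat (l + 1 - p) := by simp; omega
        rw [h1, modeVar_ofNat]; simp [hp]
      · obtain ⟨q, hq⟩ := Nat.exists_eq_add_of_le (show l + 2 ≤ p by omega)
        have h1 : (Int.ofNat l + 1 - p : ℤ) = Int.negSucc q := by simp; omega
        have h3 : ¬ p ≤ l + 1 := by omega
        have h4 : p ≠ 0 := by omega
        rw [h1, modeVar_negSucc]; simp [h3, h4]
    simp only [Int.ofNat_eq_natCast, Int.cast_natCast] at hd hm ⊢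
    linear_combination hd + f * hm
  · simp only [modeVar_negSucc, zero_mul, zero_add, dirDeriv_virasoro, dirDeriv_virConst]
    have hd : mkDerivation ℂ (fun j => dirDeriv (localCoeff reg a (Int.negSucc k))
        (virField reg a p j)) f = C (2 * (2 * (k : ℂ) + 1)) *
        dirDeriv (localCoeff reg a (Int.negSucc k + 1 - p)) f := by
      rw [mkDerivation_C_eq (fun j => dirDeriv_virField reg a p _ j), ← dirDeriv_smul]
      refine dirDeriv_congr fun j _ => ?_
      by_cases h0 : p + k = 0
      · obtain ⟨rfl, rfl⟩ : p = 0 ∧ k = 0 := by omega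
        have h1 : (Int.negSucc 0 + 1 - ((0 : ℕ) : ℤ)) = Int.ofNat 0 := by simp
        rw [h1]
        simp [localCoeff]
      · obtain ⟨q, hq⟩ := Nat.exists_eq_add_of_le (show 1 ≤ p + k by omega)
        have h1 : (Int.negSucc k + 1 - p : ℤ) = Int.negSucc q := by omega
        have h2 : ¬ (p = 0 ∧ k = 0) := by omega
        rw [h1]
        simp only [localCoeff, Prod.mk.injEq, true_and]
        by_cases hj : j = (a, q)
        · subst hj
          by_cases hp : p = 0
          · subst hp
            have : q + 1 = k := by omega
            have h5 : ¬ (0 = k) := by omega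
            simp [this, h5]
            rw [← this]; push_cast; ring
          · have h6 : p ≤ q + 1 := by omega
            have h7 : q + 1 - p = k := by omega
            simp [hp, h6, h7]; ring
        · have h8 : ¬ ((j.1 = a ∧ p ≤ j.2 + 1) ∧ j.2 + 1 - p = k) := by
            intro h; apply hj; rw [Prod.ext_iff]; exact ⟨h.1.1, by simp; omega⟩
          rw [if_neg hj]
          by_cases hp : p = 0
          · have h5 : ¬ (0 = k) := by omega
            simp only [hp, h5, if_false]
            split_ifs <;> simp_all
          · simp only [hp, if_false]
            split_ifs <;> simp_all
    have hm : (if p = 0 then C (2 * localCoeff reg a (Int.negSucc k) (a, 0)) * X (a, 0) else 0 : Fock) =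
        C (2 * (2 * (k : ℂ) + 1)) * modeVar a (Int.negSucc k + 1 - p) := by
      by_cases h0 : p + k = 0
      · obtain ⟨rfl, rfl⟩ : p = 0 ∧ k = 0 := by omega
        have h1 : (Int.negSucc 0 + 1 - ((0 : ℕ) : ℤ)) = Int.ofNat 0 := by simp
        rw [h1, modeVar_ofNat, localCoeff_negSucc]
        simp
      · obtain ⟨q, hq⟩ := Nat.exists_eq_add_of_le (show 1 ≤ p + k by omega)
        have h1 : (Int.negSucc k + 1 - p : ℤ) = Int.negSucc q := by omega
        rw [h1, modeVar_negSucc]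
        split_ifs with hp
        · have h5 : ¬ (0 = k) := by omega
          simp [localCoeff_negSucc, h5]
        · simp
    have hn : ((Int.negSucc k : ℤ) : ℂ) = -(k : ℂ) - 1 := by push_cast; ring
    rw [hn, hd, hm, show (2 * (2 * (-(k : ℂ) - 1) + 1)) = -(2 * (2 * (k : ℂ) + 1)) by ring, map_neg]
    ring

/-- Currents at different branch points interact only through `reg`, and the two contributions
cancel by its symmetry. -/
theorem virasoro_current_of_ne (reg : Mode → Mode → ℂ) (hreg : ∀ i j, reg i j = reg j i) {a b : Bool}
    (hab : b ≠ a) (n : ℤ) (p : ℕ) (f : Fock) :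
    virasoro reg a p (current reg b n f) = current reg b n (virasoro reg a p f) := by
  unfold current
  rcases n with l | k
  · rw [map_add, modeVar_ofNat, virasoro_X_mul, dirDeriv_virasoro]
    have hd : 2 * dirDeriv (virForm reg a p (b, l)) f =
        mkDerivation ℂ (fun j => dirDeriv (localCoeff reg b (Int.ofNat l)) (virField reg a p j)) f := by
      rw [mkDerivation_C_eq (fun j => dirDeriv_virField reg a p _ j),
        show (2 : Fock) = C (2 : ℂ) from (map_ofNat C 2).symm, ← dirDeriv_smul]
      refine dirDeriv_congr fun j _ => ?_
      simp only [virForm, localCoeff, hab, false_and, if_false, hreg (b, l)]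
      split_ifs <;> ring
    have hm : virField reg a p (b, l) =
        dirDeriv (localCoeff reg b (Int.ofNat l)) (virConst reg a p) := by
      rw [dirDeriv_virConst]
      simp [virField, localCoeff, hab, hreg (b, l)]
    linear_combination hd + f * hm
  · simp only [modeVar_negSucc, zero_mul, zero_add, dirDeriv_virasoro, dirDeriv_virConst]
    have hd : mkDerivation ℂ (fun j => dirDeriv (localCoeff reg b (Int.negSucc k))
        (virField reg a p j)) f = 0 := by
      rw [mkDerivation_C_eq (fun j => dirDeriv_virField reg a p _ j), ← dirDeriv_zero f]
      refine dirDeriv_congr fun j _ => ?_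
      simp [localCoeff, hab.symm]
    rw [hd]
    simp [localCoeff, hab.symm]

/-! ### The Virasoro algebra -/

theorem current_sub (reg : Mode → Mode → ℂ) (a : Bool) (n : ℤ) (f g : Fock) :
    current reg a n (f - g) = current reg a n f - current reg a n g := by
  simp only [current, map_sub]; ring

theorem current_C_mul (reg : Mode → Mode → ℂ) (a : Bool) (n : ℤ) (c : ℂ) (f : Fock) :
    current reg a n (C c * f) = C c * current reg a n f := by
  simp only [current, Derivation.leibniz, derivation_C, smul_eq_mul]; ring

theorem map_C_mul (T : Fock →ₗ[ℂ] Fock) (c : ℂ) (f : Fock) : T (C c * f) = C c * T f := by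
  rw [← smul_eq_C_mul, ← smul_eq_C_mul, map_smul]

/-- The polar modes are nonzero multiples of the coordinate derivatives, and a mode of nonnegative
index is a variable plus a constant vector field. So the currents generate all multiplications and
derivatives, and an operator commuting with these is a scalar. -/
theorem eq_zero_of_commute_current {reg : Mode → Mode → ℂ} {T : Fock →ₗ[ℂ] Fock}
    (h : ∀ a n f, T (current reg a n f) = current reg a n (T f))
    (h1 : constantCoeff (T 1) = 0) (f : Fock) : T f = 0 := by
  have hd : ∀ i f, T (pderiv i f) = pderiv i (T f) := by
    rintro ⟨a, m⟩ f
    have := h a (Int.negSucc m) f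
    simp only [current, modeVar_negSucc, zero_mul, zero_add, dirDeriv_localCoeff_negSucc,
      map_C_mul] at this
    refine mul_left_cancel₀ ?_ this
    rw [Ne, C_eq_zero]
    exact_mod_cast (by omega : 2 * m + 1 ≠ 0)
  refine eq_zero_of_commute hd ?_ h1 f
  rintro ⟨a, l⟩ f
  have := h a (Int.ofNat l) f
  simp only [current, modeVar_ofNat, map_add] at this
  rw [commute_dirDeriv_of_pderiv hd] at this
  exact add_right_cancel this

theorem virasoro_one (reg : Mode → Mode → ℂ) (a : Bool) (p : ℕ) :
    virasoro reg a p 1 = virConst reg a p := by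
  have := laplacian_C (virForm reg a p) 1
  rw [map_one] at this
  simp [virasoro_apply, this]

theorem constantCoeff_virConst (reg : Mode → Mode → ℂ) (a : Bool) (p : ℕ) :
    constantCoeff (virConst reg a p) =
      (if p = 0 then reg (a, 0) (a, 0) else 0) + if p = 1 then 1 / 4 else 0 := by
  unfold virConst
  split_ifs <;> simp

theorem constantCoeff_virasoro_virConst (reg : Mode → Mode → ℂ) (a b : Bool) (p q : ℕ) :
    constantCoeff (virasoro reg a p (virConst reg b q)) =
      (if q = 0 then 2 * virForm reg a p (b, 0) (b, 0) +
        reg (b, 0) (b, 0) * constantCoeff (virConst reg a p) else 0) +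
      if q = 1 then 1 / 4 * constantCoeff (virConst reg a p) else 0 := by
  have hC : ∀ r : ℂ, virasoro reg a p (C r) = C r * virConst reg a p := by
    intro r
    rw [← virasoro_one, ← map_C_mul, mul_one]
  have hX : constantCoeff (virasoro reg a p (X (b, 0) ^ 2)) = 2 * virForm reg a p (b, 0) (b, 0) := by
    rw [pow_two, virasoro_X_mul]
    simp [show constantCoeff (2 : Fock) = 2 from map_ofNat constantCoeff 2]
  rcases q with _ | _ | q
  · have : virConst reg b 0 = X (b, 0) ^ 2 + C (reg (b, 0) (b, 0)) := by simp [virConst]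
    rw [this, map_add, map_add, hX, hC, map_mul, constantCoeff_C]
    simp
  · have : virConst reg b (0 + 1) = C (1 / 4) := by simp [virConst]
    rw [this, hC, map_mul, constantCoeff_C]
    simp
  · have : virConst reg b (q + 1 + 1) = 0 := by simp [virConst]
    rw [this]
    simp

/-- The commutation relations of the Virasoro operators. -/
theorem virasoro_comm (reg : Mode → Mode → ℂ) (hreg : ∀ i j, reg i j = reg j i) (a : Bool)
    (p q : ℕ) (f : Fock) :
    virasoro reg a p (virasoro reg a q f) - virasoro reg a q (virasoro reg a p f) =
      C (4 * ((p : ℂ) - q)) * virasoro reg a (p + q - 1) f := by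
  -- The diagonal case is trivial and contains `p = q = 0`, the only case where the subtraction in
  -- `p + q - 1` is truncated.
  rcases eq_or_ne p q with rfl | hpq
  · simp
  obtain ⟨r, hr⟩ : ∃ r, p + q = r + 1 := Nat.exists_eq_succ_of_ne_zero (by omega)
  rw [show p + q - 1 = r by omega]
  set T : Fock →ₗ[ℂ] Fock := virasoro reg a p ∘ₗ virasoro reg a q -
    virasoro reg a q ∘ₗ virasoro reg a p - (4 * ((p : ℂ) - q)) • virasoro reg a r with hT
  have hTf : ∀ f, T f = virasoro reg a p (virasoro reg a q f) -
      virasoro reg a q (virasoro reg a p f) - C (4 * ((p : ℂ) - q)) * virasoro reg a r f := by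
    intro f; rw [hT, ← smul_eq_C_mul]; rfl
  suffices h : T f = 0 by
    rw [hTf] at h
    linear_combination h
  -- By the Jacobi identity the two sides have the same brackets with all currents, so they differ
  -- by a scalar, which is found by applying them to `1`.
  refine eq_zero_of_commute_current (reg := reg) ?_ ?_ f
  · intro b n f
    simp only [hTf, current_sub, current_C_mul]
    by_cases hb : b = a
    · subst hb
      simp only [virasoro_current reg hreg, map_add, map_C_mul]
      have e1 : (n + 1 - q + 1 - p : ℤ) = n + 1 - r := by omega
      have e2 : (n + 1 - p + 1 - q : ℤ) = n + 1 - r := by omega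
      rw [e1, e2]
      have hc : (C (2 * (2 * (n : ℂ) + 1)) * C (2 * (2 * ((n + 1 - q : ℤ) : ℂ) + 1)) -
          C (2 * (2 * (n : ℂ) + 1)) * C (2 * (2 * ((n + 1 - p : ℤ) : ℂ) + 1)) -
          C (4 * ((p : ℂ) - q)) * C (2 * (2 * (n : ℂ) + 1)) : Fock) = 0 := by
        rw [← C_mul, ← C_mul, ← C_mul, ← C_sub, ← C_sub, C_eq_zero]
        push_cast
        ring
      linear_combination (current reg b (n + 1 - r) f) * hc
    · simp only [virasoro_current_of_ne reg hreg hb]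
  · simp only [hTf, map_sub, map_mul, virasoro_one, constantCoeff_virasoro_virConst,
      constantCoeff_virConst, constantCoeff_C, virForm, true_and]
    obtain rfl : r = p + q - 1 := by omega
    clear_value T
    -- Only indices up to `2` contribute constant terms. The pair `0, 2` forces the constant `1 / 4`
    -- in `virConst`.
    rcases p with _ | _ | _ | p <;> rcases q with _ | _ | _ | q <;>
      simp [add_assoc] <;> try norm_num
    all_goals first
      | ring1
      | (intro h; omega)
      | (right; rw [if_neg (by omega), if_neg (by omega), add_zero])

theorem virasoro_comm_of_ne (reg : Mode → Mode → ℂ) (hreg : ∀ i j, reg i j = reg j i) {a b : Bool}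
    (hab : a ≠ b) (p q : ℕ) (f : Fock) :
    virasoro reg a p (virasoro reg b q f) = virasoro reg b q (virasoro reg a p f) := by
  set T : Fock →ₗ[ℂ] Fock := virasoro reg a p ∘ₗ virasoro reg b q -
    virasoro reg b q ∘ₗ virasoro reg a p with hT
  have hTf : ∀ f, T f = virasoro reg a p (virasoro reg b q f) -
      virasoro reg b q (virasoro reg a p f) := fun f => rfl
  suffices h : T f = 0 from sub_eq_zero.mp h
  refine eq_zero_of_commute_current (reg := reg) ?_ ?_ f
  · intro c n f
    simp only [hTf, current_sub]
    by_cases hc : c = a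
    · subst hc
      simp only [virasoro_current reg hreg, virasoro_current_of_ne reg hreg hab, map_add, map_C_mul]
      ring
    · obtain rfl : c = b := by revert hc hab; cases a <;> cases b <;> cases c <;> simp
      simp only [virasoro_current reg hreg, virasoro_current_of_ne reg hreg hab.symm, map_add,
        map_C_mul]
      ring
  · simp only [hTf, map_sub, virasoro_one, constantCoeff_virasoro_virConst,
      constantCoeff_virConst, virForm, hab, hab.symm, false_and, if_false]
    rw [hreg (b, 0) (a, 0)]
    split_ifs <;> first | omega | ring

/-! ### The shifted derivatives -/

/-- The branch point. -/
def sg (a : Bool) : ℂ := if a then 1 else -1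

theorem sg_mul_self (a : Bool) : sg a * sg a = 1 := by cases a <;> simp [sg]

theorem sg_ne_zero (a : Bool) : sg a ≠ 0 := by cases a <;> simp [sg]

/-- The residue pairing of the basis differentials with the function `4 * α * s ^ (2 * k) * sinh s`
at the branch point `α`, where `i = (α, k)`. -/
def dualCoeff (i j : Mode) : ℂ :=
  if j.1 = i.1 ∧ i.2 ≤ j.2 then
    4 * sg i.1 * (2 * (j.2 : ℂ) + 1) / ((2 * (j.2 - i.2) + 1).factorial : ℂ) else 0

theorem dualCoeff_self_ne_zero (i : Mode) : dualCoeff i i ≠ 0 := by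
  have : (2 * (i.2 : ℂ) + 1) ≠ 0 := by exact_mod_cast (by omega : 2 * i.2 + 1 ≠ 0)
  simp [dualCoeff, sg_ne_zero, this]

theorem dirDeriv_dualCoeff_virasoro_of_ne (reg : Mode → Mode → ℂ) {a b : Bool} (hab : a ≠ b)
    (k p : ℕ) (f : Fock) :
    dirDeriv (dualCoeff (a, k)) (virasoro reg b p f) =
      virasoro reg b p (dirDeriv (dualCoeff (a, k)) f) := by
  rw [dirDeriv_virasoro, dirDeriv_virConst,
    mkDerivation_C_eq (fun j => dirDeriv_virField reg b p _ j)]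
  have h0 : ∀ n, dualCoeff (a, k) (b, n) = 0 := fun n => if_neg fun h => hab h.1.symm
  simp only [h0, mul_zero, map_zero, zero_mul, ite_self, add_zero, dirDeriv_zero]

/-- Together with `virasoro_comm` this says that the differences of `virasoro reg a k` and `dirDeriv
(dualCoeff (a, k))` satisfy the same commutation relations as the Virasoro operators themselves. -/
theorem dirDeriv_dualCoeff_virasoro_sub (reg : Mode → Mode → ℂ) (a : Bool) (k p : ℕ) (f : Fock) :
    (dirDeriv (dualCoeff (a, k)) (virasoro reg a p f) -
      virasoro reg a p (dirDeriv (dualCoeff (a, k)) f)) -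
    (dirDeriv (dualCoeff (a, p)) (virasoro reg a k f) -
      virasoro reg a k (dirDeriv (dualCoeff (a, p)) f)) =
      C (4 * ((k : ℂ) - p)) * dirDeriv (dualCoeff (a, k + p - 1)) f := by
  rcases eq_or_ne k p with rfl | hkp
  · simp
  rw [dirDeriv_virasoro, dirDeriv_virasoro, dirDeriv_virConst, dirDeriv_virConst,
    mkDerivation_C_eq (fun j => dirDeriv_virField reg a p _ j),
    mkDerivation_C_eq (fun j => dirDeriv_virField reg a k _ j)]
  have h0 : ∀ {k}, k ≠ 0 → dualCoeff (a, k) (a, 0) = 0 := fun hk => if_neg fun h => by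
    simp at h; omega
  have e1 : ∀ k p, k ≠ p → (if p = 0 then C (2 * dualCoeff (a, k) (a, 0)) * X (a, 0) else 0 : Fock) = 0 := by
    intro k p hkp
    split_ifs with hp
    · rw [h0 (by omega)]; simp
    · rfl
  have e2 : ∀ k p, k ≠ p → ∀ j : Mode,
      (if p = 0 then 2 * reg (a, 0) j * dualCoeff (a, k) (a, 0) else 0) = 0 := by
    intro k p hkp j
    split_ifs with hp
    · rw [h0 (by omega)]; simp
    · rfl
  simp only [e1 k p hkp, e1 p k hkp.symm, e2 k p hkp, e2 p k hkp.symm, add_zero, zero_mul]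
  have := dirDeriv_add (fun j : Mode => if j.1 = a ∧ p ≤ j.2 + 1 then
    2 * (2 * (j.2 : ℂ) + 1) * dualCoeff (a, k) (a, j.2 + 1 - p) else 0) (fun j : Mode => (-1) *
    if j.1 = a ∧ k ≤ j.2 + 1 then
    2 * (2 * (j.2 : ℂ) + 1) * dualCoeff (a, p) (a, j.2 + 1 - k) else 0) f
  rw [dirDeriv_smul (-1), map_neg, map_one] at this
  rw [← dirDeriv_smul, add_sub_cancel_left, add_sub_cancel_left, sub_eq_add_neg, neg_eq_neg_one_mul,
    ← this]
  refine dirDeriv_congr fun j _ => ?_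
  obtain ⟨b, l⟩ := j
  by_cases hb : b = a
  swap
  · simp [dualCoeff, hb]
  subst hb
  simp only [dualCoeff, true_and]
  -- Both terms then have the factorial of `2 * (l + 1 - k - p) + 1` in the denominator, and the
  -- numerators differ by the factor `2 * (l + 1 - p) + 1 - (2 * (l + 1 - k) + 1) = 2 * (k - p)`.
  by_cases hl : k + p ≤ l + 1
  · rw [if_pos (by omega), if_pos (by omega), if_pos (by omega), if_pos (by omega), if_pos (by omega)]
    rw [show 2 * (l + 1 - p - k) + 1 = 2 * (l - (k + p - 1)) + 1 by omega,
      show 2 * (l + 1 - k - p) + 1 = 2 * (l - (k + p - 1)) + 1 by omega,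
      Nat.cast_sub (by omega), Nat.cast_sub (by omega)]
    push_cast
    ring
  · rw [if_neg (c := k + p - 1 ≤ l) (by omega)]
    have h1 : ¬ (k ≤ l + 1 - p) ∨ ¬ (p ≤ l + 1) := by omega
    have h2 : ¬ (p ≤ l + 1 - k) ∨ ¬ (k ≤ l + 1) := by omega
    rcases h1 with h1 | h1 <;> rcases h2 with h2 | h2 <;> simp [h1, h2]

/-- Integrability of the system of equations `D_i Z' = T_i Z`. -/
theorem virasoro_integrable (reg : Mode → Mode → ℂ) (hreg : ∀ i j, reg i j = reg j i) {f g : Fock}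
    (h : ∀ i : Mode, dirDeriv (dualCoeff i) g = virasoro reg i.1 i.2 f) (i j : Mode) :
    dirDeriv (dualCoeff i) (virasoro reg j.1 j.2 g) =
      dirDeriv (dualCoeff j) (virasoro reg i.1 i.2 g) := by
  obtain ⟨a, k⟩ := i
  obtain ⟨b, p⟩ := j
  by_cases hab : a = b
  · subst hab
    -- After the derivatives are moved past the Virasoro operators, the hypothesis replaces
    -- derivatives of `g` by Virasoro operators applied to `f`; the two commutators cancel.
    have h1 := dirDeriv_dualCoeff_virasoro_sub reg a k p g
    have h2 := virasoro_comm reg hreg a k p f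
    rw [h, h, h] at h1
    simp only at h1 ⊢
    linear_combination h1 - h2
  · simp only
    rw [dirDeriv_dualCoeff_virasoro_of_ne reg hab, dirDeriv_dualCoeff_virasoro_of_ne reg (Ne.symm hab),
      h, h, virasoro_comm_of_ne reg hreg hab]

/-! ### Solving the Virasoro constraints -/

theorem exists_box (s : Finset Mode) :
    ∃ M : ℕ, s ⊆ (Finset.univ : Finset Bool) ×ˢ Finset.range M := by
  refine ⟨s.sup (fun i => i.2) + 1, fun i hi => ?_⟩
  simp only [Finset.mem_product, Finset.mem_univ, true_and, Finset.mem_range]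
  exact Nat.lt_succ_of_le (Finset.le_sup (f := fun i : Mode => i.2) hi)

/-- Dual coordinates to the vector fields with components `dualCoeff`. -/
def dualVar (a : Bool) (l : ℕ) : Fock :=
  C (dualCoeff (a, l) (a, l))⁻¹ *
    (X (a, l) - ∑ k : Fin l, C (dualCoeff (a, k) (a, l)) * dualVar a k)

theorem derivation_C_mul' (D : Derivation ℂ Fock Fock) (r : ℂ) (f : Fock) :
    D (C r * f) = C r * D f := by
  rw [Derivation.leibniz, derivation_C, smul_zero, add_zero, smul_eq_mul]

theorem X_eq_sum_dualVar (a : Bool) (l : ℕ) :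
    (X (a, l) : Fock) = ∑ k ∈ Finset.range (l + 1), C (dualCoeff (a, k) (a, l)) * dualVar a k := by
  rw [Finset.sum_range_succ]
  conv_rhs => rw [dualVar]
  rw [← mul_assoc, ← C_mul, mul_inv_cancel₀ (dualCoeff_self_ne_zero _), C_1, one_mul,
    Finset.sum_range fun k => C (dualCoeff (a, k) (a, l)) * dualVar a k]
  ring

theorem dirDeriv_dualVar (i : Mode) (a : Bool) (l : ℕ) :
    dirDeriv (dualCoeff i) (dualVar a l) = if i = (a, l) then 1 else 0 := by
  obtain ⟨b, j⟩ := i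
  induction l using Nat.strong_induction_on with
  | _ l ih =>
  rw [dualVar, derivation_C_mul', map_sub, map_sum, dirDeriv_X]
  have h1 : ∀ k : Fin l, dirDeriv (dualCoeff (b, j)) (C (dualCoeff (a, k) (a, l)) * dualVar a k) =
      if (b, j) = (a, (k : ℕ)) then C (dualCoeff (a, k) (a, l)) else 0 := by
    intro k
    rw [derivation_C_mul', ih k k.2]
    split_ifs <;> simp
  simp_rw [h1]
  rw [← Finset.sum_range fun k => if (b, j) = (a, k) then (C (dualCoeff (a, k) (a, l)) : Fock) else 0]
  by_cases hb : b = a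
  · subst hb
    simp only [Prod.mk.injEq, true_and, Finset.sum_ite_eq, Finset.mem_range]
    rcases lt_trichotomy j l with h | h | h
    · simp [h, h.ne]
    · subst h
      simp only [lt_irrefl, if_false, sub_zero, if_true]
      rw [← C_mul, inv_mul_cancel₀ (dualCoeff_self_ne_zero _), C_1]
    · have : dualCoeff (b, j) (b, l) = 0 := if_neg fun h' => by simp at h'; omega
      simp [h.not_gt, h.ne', this]
  · have : dualCoeff (b, j) (a, l) = 0 := if_neg fun h' => hb h'.1.symm
    simp [hb, this]

/-- The Euler vector field. -/
def euler : Derivation ℂ Fock Fock := mkDerivation ℂ X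

theorem euler_monomial (m : Mode →₀ ℕ) (r : ℂ) :
    euler (monomial m r) = C (m.degree : ℂ) * monomial m r := by
  rw [euler, mkDerivation_eq_sum X _ (Finset.Subset.refl _)]
  by_cases hr : r = 0
  · simp [hr]
  rw [vars_monomial hr]
  simp_rw [X_mul_pderiv_monomial, ← Finset.sum_smul, C_mul_monomial, smul_monomial]
  congr 1
  simp [Finsupp.degree_apply]

theorem coeff_euler (f : Fock) (m : Mode →₀ ℕ) : coeff m (euler f) = (m.degree : ℂ) * coeff m f := by
  induction f using MvPolynomial.induction_on' with
  | monomial u a =>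
    rw [euler_monomial, coeff_C_mul, coeff_monomial]
    split_ifs with h
    · rw [h]
    · simp
  | add p q hp hq => rw [map_add, coeff_add, hp, hq, coeff_add, mul_add]

/-- The components `dualCoeff` are triangular at each branch point with nonzero diagonal, so these
fields form a frame with coordinates `dualVar`. Thus the derivatives in the frame recover every
homogeneous part of positive degree. -/
theorem euler_eq_sum (f : Fock) {M : ℕ}
    (hM : f.vars ⊆ (Finset.univ : Finset Bool) ×ˢ Finset.range M) :
    euler f = ∑ i ∈ (Finset.univ : Finset Bool) ×ˢ Finset.range M,
      dualVar i.1 i.2 * dirDeriv (dualCoeff i) f := by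
  have h : euler f = (∑ i ∈ (Finset.univ : Finset Bool) ×ˢ Finset.range M,
      dualVar i.1 i.2 • dirDeriv (dualCoeff i) : Derivation ℂ Fock Fock) f := by
    apply derivation_eq_of_forall_mem_vars
    rintro ⟨a, l⟩ hj
    have hl : l < M := by simpa using hM hj
    rw [euler, mkDerivation_X, derivation_sum_apply, Finset.sum_product, Finset.sum_eq_single a]
    · rw [X_eq_sum_dualVar, ← Finset.sum_subset (Finset.range_subset_range.mpr (Nat.succ_le_of_lt hl))]
      · refine Finset.sum_congr rfl fun k _ => ?_
        rw [Derivation.smul_apply, ← X_eq_sum_dualVar, dirDeriv_X, smul_eq_mul, mul_comm]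
      · intro k _ hk
        have : dualCoeff (a, k) (a, l) = 0 := if_neg fun h' => hk (by simp at h' ⊢; omega)
        rw [Derivation.smul_apply, ← X_eq_sum_dualVar, dirDeriv_X, this, C_0, smul_zero]
    · intro b _ hb
      refine Finset.sum_eq_zero fun k _ => ?_
      have : dualCoeff (b, k) (a, l) = 0 := if_neg fun h' => hb h'.1.symm
      rw [Derivation.smul_apply, dirDeriv_X, this, C_0, smul_zero]
    · simp
  rw [h, derivation_sum_apply]
  rfl

/-! ### The homotopy operator and the Poincaré lemma. -/

/-- Division of the homogeneous part of degree `d` by `d + c`. -/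
def divDegree (c : ℕ) : Fock →ₗ[ℂ] Fock :=
  (basisMonomials Mode ℂ).constr ℂ fun m => monomial m (1 / ((m.degree : ℂ) + c))

theorem coeff_divDegree (c : ℕ) (f : Fock) (m : Mode →₀ ℕ) :
    coeff m (divDegree c f) = coeff m f / ((m.degree : ℂ) + c) := by
  induction f using MvPolynomial.induction_on' with
  | monomial u a =>
    have h : monomial u a = a • basisMonomials Mode ℂ u := by simp [smul_monomial]
    rw [h, map_smul, divDegree, Module.Basis.constr_basis, coeff_smul, ← h, coeff_monomial,
      coeff_monomial]
    split_ifs with hu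
    · rw [hu, smul_eq_mul]; ring
    · simp
  | add p q hp hq => rw [map_add, coeff_add, hp, hq, coeff_add, add_div]

theorem euler_divDegree (f : Fock) : divDegree 1 f + euler (divDegree 1 f) = f := by
  ext m
  rw [coeff_add, coeff_euler, coeff_divDegree]
  have : ((m.degree : ℂ) + (1 : ℕ)) ≠ 0 := by push_cast; exact Nat.cast_add_one_ne_zero _
  field_simp
  push_cast
  ring

theorem dirDeriv_divDegree (l : Mode → ℂ) (c : ℕ) (f : Fock) :
    dirDeriv l (divDegree c f) = divDegree (c + 1) (dirDeriv l f) := by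
  classical
  rw [dirDeriv_eq_sum l f (s := f.vars ∪ (divDegree c f).vars) Finset.subset_union_left,
    dirDeriv_eq_sum l (divDegree c f) (s := f.vars ∪ (divDegree c f).vars)
      Finset.subset_union_right, map_sum]
  refine Finset.sum_congr rfl fun i _ => ?_
  rw [map_C_mul]
  congr 1
  ext m
  simp only [coeff_pderiv, coeff_divDegree, map_add, Finsupp.degree_single]
  push_cast
  ring

/-- The Poincaré lemma for the vector fields with components `dualCoeff`. -/
theorem exists_potential {G : Mode → Fock}
    (hG : ∀ i j, dirDeriv (dualCoeff i) (G j) = dirDeriv (dualCoeff j) (G i))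
    {s : Finset Mode} (hs : ∀ i ∉ s, G i = 0) :
    ∃ Z : Fock, ∀ i, dirDeriv (dualCoeff i) Z = G i := by
  classical
  obtain ⟨M, hM⟩ := exists_box (s ∪ s.biUnion fun i => (divDegree 1 (G i)).vars)
  set t := (Finset.univ : Finset Bool) ×ˢ Finset.range M
  -- This is the radial integral of the closed form `G`: integrating `τ ^ d` over `[0, 1]` divides
  -- the part of degree `d` by `d + 1`.
  refine ⟨∑ i ∈ t, dualVar i.1 i.2 * divDegree 1 (G i), fun j => ?_⟩
  rw [map_sum]
  have h : ∀ i ∈ t, dirDeriv (dualCoeff j) (dualVar i.1 i.2 * divDegree 1 (G i)) =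
      dualVar i.1 i.2 * dirDeriv (dualCoeff i) (divDegree 1 (G j)) +
        if j = i then divDegree 1 (G i) else 0 := by
    intro i _
    rw [Derivation.leibniz, dirDeriv_dualVar, dirDeriv_divDegree, hG, ← dirDeriv_divDegree]
    simp
  rw [Finset.sum_congr rfl h, Finset.sum_add_distrib, Finset.sum_ite_eq]
  by_cases hj : j ∈ s
  · have hjt : j ∈ t := hM (Finset.mem_union_left _ hj)
    rw [← euler_eq_sum, if_pos hjt, add_comm, euler_divDegree]
    intro i hi
    exact hM (Finset.mem_union_right _ (Finset.mem_biUnion.mpr ⟨j, hj, hi⟩))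
  · simp [hs j hj]

theorem virForm_eq_zero (reg : Mode → Mode → ℂ) (a : Bool) {p : ℕ} {i j : Mode}
    (h : i.2 + j.2 + 2 < p) : virForm reg a p i j = 0 := by
  have h1 : ¬ p ≤ i.2 + 1 := by omega
  have h2 : ¬ p ≤ j.2 + 1 := by omega
  have h3 : ¬ i.2 + j.2 + 2 = p := by omega
  have h4 : p ≠ 0 := by omega
  simp [virForm, h1, h2, h3, h4]

theorem virField_eq_zero (reg : Mode → Mode → ℂ) (a : Bool) {p : ℕ} {j : Mode}
    (h : j.2 + 1 < p) : virField reg a p j = 0 := by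
  have h2 : ¬ p ≤ j.2 + 1 := by omega
  have h4 : p ≠ 0 := by omega
  simp [virField, h2, h4]

/-- A polynomial involves finitely many modes, and two polar modes of level below `M` reach at most
the power `s ^ (-4M)`. Hence only finitely many constraints are nonzero, as `exists_potential`
demands. -/
theorem virasoro_eq_zero (reg : Mode → Mode → ℂ) {a : Bool} {f : Fock} {M p : ℕ}
    (hM : f.vars ⊆ (Finset.univ : Finset Bool) ×ˢ Finset.range M) (hp : 2 * M + 2 ≤ p) :
    virasoro reg a p f = 0 := by
  have hv : ∀ j ∈ f.vars, j.2 < M := fun j hj => by simpa using hM hj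
  rw [virasoro_apply, laplacian_eq_sum_sum _ _ subset_rfl]
  have h1 : virConst reg a p = 0 := by
    have h0 : p ≠ 0 := by omega
    have h1 : p ≠ 1 := by omega
    simp [virConst, h0, h1]
  rw [h1, zero_mul, zero_add, derivation_eq_zero_of_forall_mem_vars, zero_add]
  · refine Finset.sum_eq_zero fun i hi => Finset.sum_eq_zero fun j hj => ?_
    rw [virForm_eq_zero _ _ (by have := hv i hi; have := hv j hj; omega), C_0, zero_mul]
  · intro j hj
    rw [mkDerivation_X, virField_eq_zero _ _ (by have := hv j hj; omega)]

theorem exists_virasoro_potential (reg : Mode → Mode → ℂ) (hreg : ∀ i j, reg i j = reg j i)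
    {f g : Fock} (h : ∀ i : Mode, dirDeriv (dualCoeff i) g = virasoro reg i.1 i.2 f) :
    ∃ Z : Fock, ∀ i : Mode, dirDeriv (dualCoeff i) Z = virasoro reg i.1 i.2 g := by
  obtain ⟨M, hM⟩ := exists_box g.vars
  refine exists_potential (G := fun i => virasoro reg i.1 i.2 g)
    (fun i j => virasoro_integrable reg hreg h i j)
    (s := (Finset.univ : Finset Bool) ×ˢ Finset.range (2 * M + 2)) fun i hi => ?_
  exact virasoro_eq_zero reg hM (by simpa using hi)

/-- A solution of the Virasoro constraints, degree by degree. -/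
theorem exists_partitionFunction (reg : Mode → Mode → ℂ) (hreg : ∀ i j, reg i j = reg j i) :
    ∃ Z : ℕ → Fock, Z 0 = 1 ∧
      ∀ n (i : Mode), dirDeriv (dualCoeff i) (Z (n + 1)) = virasoro reg i.1 i.2 (Z n) := by
  -- Integrability of the next equation uses the previous one, so the recursion runs on consecutive
  -- pairs of solutions, starting from the pair `0, 1`.
  let P := {p : Fock × Fock // ∀ i : Mode, dirDeriv (dualCoeff i) p.2 = virasoro reg i.1 i.2 p.1}
  let next : P → P := fun p =>
    ⟨(p.1.2, (exists_virasoro_potential reg hreg p.2).choose),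
      (exists_virasoro_potential reg hreg p.2).choose_spec⟩
  let start : P := ⟨(0, 1), fun i => by simp⟩
  refine ⟨fun n => (next^[n] start).1.2, rfl, fun n i => ?_⟩
  have h := (next^[n + 1] start).2 i
  have h2 : (next^[n + 1] start).1.1 = (next^[n] start).1.2 := by
    rw [Function.iterate_succ_apply']
  rw [h, h2]

/-! ### The logarithm of the partition function -/

/-- The coefficientwise action of a linear map on power series. -/
def coeffwise (T : Fock →ₗ[ℂ] Fock) (f : PowerSeries Fock) : PowerSeries Fock :=
  PowerSeries.mk fun n => T (PowerSeries.coeff n f)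

theorem coeff_coeffwise (T : Fock →ₗ[ℂ] Fock) (f : PowerSeries Fock) (n : ℕ) :
    PowerSeries.coeff n (coeffwise T f) = T (PowerSeries.coeff n f) := PowerSeries.coeff_mk ..

/-- The Euler operator `t d/dt` on power series. -/
def degOp (f : PowerSeries Fock) : PowerSeries Fock :=
  PowerSeries.mk fun n => (n : Fock) * PowerSeries.coeff n f

theorem coeff_degOp (f : PowerSeries Fock) (n : ℕ) :
    PowerSeries.coeff n (degOp f) = (n : Fock) * PowerSeries.coeff n f := PowerSeries.coeff_mk ..

theorem coeffwise_mul (D : Derivation ℂ Fock Fock) (f g : PowerSeries Fock) :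
    coeffwise D.toLinearMap (f * g) =
      f * coeffwise D.toLinearMap g + g * coeffwise D.toLinearMap f := by
  ext1 n
  rw [map_add, coeff_coeffwise, PowerSeries.coeff_mul, PowerSeries.coeff_mul, mul_comm g,
    PowerSeries.coeff_mul, map_sum, ← Finset.sum_add_distrib]
  refine Finset.sum_congr rfl fun p _ => ?_
  rw [coeff_coeffwise, coeff_coeffwise]
  simp [Derivation.leibniz, mul_comm]

theorem degOp_mul (f g : PowerSeries Fock) : degOp (f * g) = f * degOp g + g * degOp f := by
  ext1 n
  rw [map_add, coeff_degOp, PowerSeries.coeff_mul, PowerSeries.coeff_mul, mul_comm g,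
    PowerSeries.coeff_mul, Finset.mul_sum, ← Finset.sum_add_distrib]
  refine Finset.sum_congr rfl fun p hp => ?_
  rw [coeff_degOp, coeff_degOp, ← Finset.HasAntidiagonal.mem_antidiagonal.mp hp]
  push_cast
  ring

theorem degOp_coeffwise (T : Fock →ₗ[ℂ] Fock) (f : PowerSeries Fock) :
    degOp (coeffwise T f) = coeffwise T (degOp f) := by
  ext1 n
  rw [coeff_degOp, coeff_coeffwise, coeff_coeffwise, coeff_degOp, ← nsmul_eq_mul, ← nsmul_eq_mul,
    map_nsmul]

theorem eq_zero_of_degOp {f : PowerSeries Fock} (h : degOp f = 0)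
    (h0 : PowerSeries.coeff 0 f = 0) : f = 0 := by
  ext1 n
  rcases Nat.eq_zero_or_pos n with rfl | hn
  · exact h0
  · have := congrArg (PowerSeries.coeff n) h
    rw [coeff_degOp, map_zero] at this
    rcases mul_eq_zero.mp this with h1 | h1
    · exact absurd h1 (Nat.cast_ne_zero.mpr hn.ne')
    · rw [h1, map_zero]

/-- A power series with constant term `1` is an exponential: logarithmic derivatives are
derivatives of one series. -/
theorem exists_log {Z : PowerSeries Fock} (hZ : PowerSeries.coeff 0 Z = 1) :
    ∃ F : PowerSeries Fock, PowerSeries.coeff 0 F = 0 ∧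
      ∀ D : Derivation ℂ Fock Fock, coeffwise D.toLinearMap Z = Z * coeffwise D.toLinearMap F := by
  set U := PowerSeries.invOfUnit Z 1
  have hU : Z * U = 1 := PowerSeries.mul_invOfUnit Z 1 (by simpa using hZ)
  have h1 : degOp (1 : PowerSeries Fock) = 0 := by
    ext1 n
    rw [coeff_degOp, PowerSeries.coeff_one]
    split_ifs with h <;> simp [h]
  -- The equation `t dF/dt = Z⁻¹ t dZ/dt` is integrated coefficientwise. At `n = 0` the convention
  -- `1 / 0 = 0` makes the constant term vanish.
  set F : PowerSeries Fock :=
    PowerSeries.mk fun n => C (1 / (n : ℂ)) * PowerSeries.coeff n (degOp Z * U) with hF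
  have hEF : degOp F = degOp Z * U := by
    ext1 n
    rw [coeff_degOp, hF, PowerSeries.coeff_mk]
    rcases Nat.eq_zero_or_pos n with rfl | hn
    · rw [PowerSeries.coeff_mul]
      simp [coeff_degOp]
    · have hn' : (n : ℂ) ≠ 0 := Nat.cast_ne_zero.mpr hn.ne'
      rw [← mul_assoc, show (n : Fock) = C (n : ℂ) from (map_natCast C n).symm, ← C_mul,
        mul_one_div_cancel hn', C_1, one_mul]
  have hF0 : PowerSeries.coeff 0 F = 0 := by rw [hF, PowerSeries.coeff_mk]; simp
  refine ⟨F, hF0, fun D => ?_⟩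
  have hD1 : coeffwise D.toLinearMap 1 = 0 := by
    ext1 n
    rw [coeff_coeffwise, PowerSeries.coeff_one]
    split_ifs with h <;> simp
  have hDU := coeffwise_mul D Z U
  rw [hU, hD1] at hDU
  have hEU := degOp_mul Z U
  rw [hU, h1] at hEU
  -- The operator `t d/dt` commutes with `D`, so it annihilates this difference of logarithmic
  -- derivatives, which also has no constant term in `t`.
  have hW : U * coeffwise D.toLinearMap Z - coeffwise D.toLinearMap F = 0 := by
    apply eq_zero_of_degOp
    · have hsub : ∀ f g : PowerSeries Fock, degOp (f - g) = degOp f - degOp g := fun f g => by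
        ext1 n; simp [coeff_degOp, mul_sub]
      rw [hsub, degOp_mul, degOp_coeffwise D.toLinearMap F, hEF, coeffwise_mul, degOp_coeffwise]
      have e1 : degOp U = -(U * U * degOp Z) := by linear_combination (-U) * hEU - degOp U * hU
      have e2 : coeffwise D.toLinearMap U = -(U * U * coeffwise D.toLinearMap Z) := by
        linear_combination (-U) * hDU - coeffwise D.toLinearMap U * hU
      rw [e1, e2]
      ring
    · rw [map_sub, coeff_coeffwise, hF0, map_zero, sub_zero, PowerSeries.coeff_mul]
      simp [coeff_coeffwise, hZ]
  linear_combination Z * hW - coeffwise D.toLinearMap Z * hU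

/-- The Virasoro operator acts on an exponential through derivatives of the exponent. -/
theorem virasoro_coeff_exp (reg : Mode → Mode → ℂ) (a : Bool) (p : ℕ) {Z F : PowerSeries Fock}
    (hF : ∀ D : Derivation ℂ Fock Fock, coeffwise D.toLinearMap Z = Z * coeffwise D.toLinearMap F) :
    coeffwise (virasoro reg a p) Z = Z * (PowerSeries.C (virConst reg a p) +
      coeffwise (mkDerivation ℂ (virField reg a p)).toLinearMap F +
      coeffwise (laplacian (virForm reg a p)) F +
      PowerSeries.mk fun n => ∑ x ∈ Finset.HasAntidiagonal.antidiagonal n, gradForm (virForm reg a p)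
        (PowerSeries.coeff x.1 F) (PowerSeries.coeff x.2 F)) := by
  classical
  ext1 n
  set s : Finset Mode := (Finset.range (n + 1)).biUnion fun k =>
    (PowerSeries.coeff k F).vars ∪ (PowerSeries.coeff k Z).vars
  have hsF : ∀ k ≤ n, (PowerSeries.coeff k F).vars ⊆ s := fun k hk i hi =>
    Finset.mem_biUnion.mpr ⟨k, by simp; omega, Finset.mem_union_left _ hi⟩
  have hsZ : (PowerSeries.coeff n Z).vars ⊆ s := fun i hi =>
    Finset.mem_biUnion.mpr ⟨n, by simp, Finset.mem_union_right _ hi⟩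
  rw [coeff_coeffwise, virasoro_apply, mul_add, mul_add, mul_add, map_add, map_add, map_add,
    ← hF, coeff_coeffwise, mul_comm Z, PowerSeries.coeff_C_mul, add_assoc _ _ (PowerSeries.coeff n _)]
  congr 1
  -- The second derivatives of an exponential give the Laplacian of the exponent and the product of
  -- its gradients.
  have hpd : ∀ i j, coeffwise (pderiv (R := ℂ) (σ := Mode) i).toLinearMap
      (coeffwise (pderiv (R := ℂ) (σ := Mode) j).toLinearMap Z) =
      Z * (coeffwise (pderiv i).toLinearMap (coeffwise (pderiv j).toLinearMap F) +
        coeffwise (pderiv i).toLinearMap F * coeffwise (pderiv j).toLinearMap F) := by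
    intro i j
    rw [hF, coeffwise_mul, hF]
    ring
  have hpd' : ∀ i j, pderiv i (pderiv j (PowerSeries.coeff n Z)) =
      ∑ x ∈ Finset.HasAntidiagonal.antidiagonal n, PowerSeries.coeff x.1 Z *
        (pderiv i (pderiv j (PowerSeries.coeff x.2 F)) + ∑ y ∈ Finset.HasAntidiagonal.antidiagonal x.2,
          pderiv i (PowerSeries.coeff y.1 F) * pderiv j (PowerSeries.coeff y.2 F)) := by
    intro i j
    have := congrArg (PowerSeries.coeff n) (hpd i j)
    rw [coeff_coeffwise, coeff_coeffwise, PowerSeries.coeff_mul] at this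
    refine this.trans (Finset.sum_congr rfl fun x _ => ?_)
    rw [map_add, coeff_coeffwise, coeff_coeffwise, PowerSeries.coeff_mul]
    simp_rw [coeff_coeffwise]
    rfl
  rw [laplacian_eq_sum_sum _ _ hsZ, PowerSeries.coeff_mul, PowerSeries.coeff_mul,
    ← Finset.sum_add_distrib]
  simp_rw [hpd', Finset.mul_sum]
  rw [Finset.sum_congr rfl fun i _ => Finset.sum_comm, Finset.sum_comm]
  refine Finset.sum_congr rfl fun x hx => ?_
  have hx2 : x.2 ≤ n := by have := Finset.HasAntidiagonal.mem_antidiagonal.mp hx; omega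
  rw [coeff_coeffwise, PowerSeries.coeff_mk, ← mul_add, laplacian_eq_sum_sum _ _ (hsF _ hx2)]
  have hg : ∀ y ∈ Finset.HasAntidiagonal.antidiagonal x.2, gradForm (virForm reg a p) (PowerSeries.coeff y.1 F)
      (PowerSeries.coeff y.2 F) = ∑ i ∈ s, ∑ j ∈ s, C (virForm reg a p i j) *
        (pderiv i (PowerSeries.coeff y.1 F) * pderiv j (PowerSeries.coeff y.2 F)) := by
    intro y hy
    have := Finset.HasAntidiagonal.mem_antidiagonal.mp hy
    exact gradForm_eq_sum_sum _ _ _ (hsF _ (by omega)) (hsF _ (by omega))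
  have hcomm : ∀ t : Finset (ℕ × ℕ), ∀ φ : ℕ × ℕ → Mode → Mode → Fock,
      ∑ y ∈ t, ∑ i ∈ s, ∑ j ∈ s, φ y i j = ∑ i ∈ s, ∑ j ∈ s, ∑ y ∈ t, φ y i j := fun t φ => by
    rw [Finset.sum_comm]
    exact Finset.sum_congr rfl fun i _ => Finset.sum_comm
  rw [Finset.sum_congr rfl hg, hcomm, ← Finset.sum_add_distrib, Finset.mul_sum]
  refine Finset.sum_congr rfl fun i _ => ?_
  rw [← Finset.sum_add_distrib, Finset.mul_sum]
  refine Finset.sum_congr rfl fun j _ => ?_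
  rw [← Finset.mul_sum, ← mul_add]
  ring

/-- `F` is the family of free energies: `F n` collects the terms with `2 * g - 2 + n` equal to the
index. -/
structure IsFreeEnergy (reg : Mode → Mode → ℂ) (F : ℕ → Fock) : Prop where
  zero : F 0 = 0
  succ : ∀ n (i : Mode), dirDeriv (dualCoeff i) (F (n + 1)) =
    (if n = 0 then virConst reg i.1 i.2 else 0) + mkDerivation ℂ (virField reg i.1 i.2) (F n) +
      laplacian (virForm reg i.1 i.2) (F n) +
      ∑ x ∈ Finset.HasAntidiagonal.antidiagonal n, gradForm (virForm reg i.1 i.2) (F x.1) (F x.2)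

theorem exists_isFreeEnergy (reg : Mode → Mode → ℂ) (hreg : ∀ i j, reg i j = reg j i) :
    ∃ F, IsFreeEnergy reg F := by
  obtain ⟨Z, hZ0, hZ⟩ := exists_partitionFunction reg hreg
  have hZ1 : PowerSeries.coeff 0 (PowerSeries.mk Z) = 1 := by rw [PowerSeries.coeff_mk, hZ0]
  obtain ⟨F, hF0, hF⟩ := exists_log hZ1
  refine ⟨fun n => PowerSeries.coeff n F, hF0, fun n i => ?_⟩
  have h1 := virasoro_coeff_exp reg i.1 i.2 hF
  have h2 : coeffwise (dirDeriv (dualCoeff i)).toLinearMap (PowerSeries.mk Z) =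
      PowerSeries.X * coeffwise (virasoro reg i.1 i.2) (PowerSeries.mk Z) := by
    ext1 n
    rcases n with _ | n
    · rw [coeff_coeffwise, hZ1]; simp
    · rw [PowerSeries.coeff_succ_X_mul, coeff_coeffwise, coeff_coeffwise, PowerSeries.coeff_mk,
        PowerSeries.coeff_mk]
      exact hZ n i
  rw [hF, h1, ← mul_assoc, mul_comm PowerSeries.X, mul_assoc] at h2
  have hne : PowerSeries.mk Z ≠ 0 := fun h => by
    rw [h, map_zero] at hZ1; exact zero_ne_one hZ1
  have h3 := congrArg (PowerSeries.coeff (n + 1)) (mul_left_cancel₀ hne h2)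
  rw [coeff_coeffwise, PowerSeries.coeff_succ_X_mul, map_add, map_add, map_add, coeff_coeffwise,
    coeff_coeffwise, PowerSeries.coeff_mk, PowerSeries.coeff_C] at h3
  exact h3

/-! ### Degrees of the free energies -/

/-- One less than the order of the pole of the basis differential. For `n` modes of levels `l_i`,
total weight at most `3 * (2g - 2 + n)` means `∑ l_i ≤ 3g - 3 + n`. -/
def modeWeight (i : Mode) : ℕ := 2 * i.2 + 1

/-- Polynomials whose monomials have degree `D, D - 2, …` and weight at most `w`. -/
def filtration (D w : ℤ) : Submodule ℂ Fock where
  carrier := {f | ∀ d, coeff d f ≠ 0 →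
    (∃ j : ℕ, (d.degree : ℤ) + 2 * j = D) ∧ (Finsupp.weight modeWeight d : ℤ) ≤ w}
  add_mem' {f g} hf hg d hd := by
    by_cases h : coeff d f = 0
    · refine hg d fun h' => hd ?_
      rw [coeff_add, h, h', add_zero]
    · exact hf d h
  zero_mem' d hd := absurd (coeff_zero d) hd
  smul_mem' c f hf d hd := hf d fun h => hd (by rw [coeff_smul, h, smul_zero])

theorem filtration_mono {D w w' : ℤ} (h : w ≤ w') {f : Fock} (hf : f ∈ filtration D w) :
    f ∈ filtration D w' := fun d hd => ⟨(hf d hd).1, (hf d hd).2.trans h⟩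

theorem filtration_add_two {D w : ℤ} {f : Fock} (hf : f ∈ filtration D w) :
    f ∈ filtration (D + 2) w := fun d hd => by
  obtain ⟨⟨j, hj⟩, h⟩ := hf d hd
  exact ⟨⟨j + 1, by push_cast; linarith⟩, h⟩

theorem mul_mem_filtration {D D' w w' : ℤ} {f g : Fock} (hf : f ∈ filtration D w)
    (hg : g ∈ filtration D' w') : f * g ∈ filtration (D + D') (w + w') := by
  classical
  intro d hd
  rw [coeff_mul] at hd
  obtain ⟨x, hx, hne⟩ := Finset.exists_ne_zero_of_sum_ne_zero hd
  obtain ⟨⟨j, hj⟩, h⟩ := hf x.1 (left_ne_zero_of_mul hne)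
  obtain ⟨⟨j', hj'⟩, h'⟩ := hg x.2 (right_ne_zero_of_mul hne)
  rw [← Finset.HasAntidiagonal.mem_antidiagonal.mp hx]
  refine ⟨⟨j + j', ?_⟩, ?_⟩
  · rw [map_add]; push_cast; linarith
  · rw [map_add]; push_cast; linarith

theorem C_mul_mem_filtration {D w : ℤ} (c : ℂ) {f : Fock} (hf : f ∈ filtration D w) :
    C c * f ∈ filtration D w := by
  rw [← smul_eq_C_mul]; exact Submodule.smul_mem _ c hf

theorem X_mem_filtration (i : Mode) : (X i : Fock) ∈ filtration 1 (2 * (i.2 : ℤ) + 1) := by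
  intro d hd
  rw [coeff_X] at hd
  obtain rfl : Finsupp.single i 1 = d := by by_contra h; simp [h] at hd
  refine ⟨⟨0, by simp⟩, ?_⟩
  simp [Finsupp.weight_apply, modeWeight]

theorem C_mem_filtration (c : ℂ) (j : ℕ) {w : ℤ} (hw : 0 ≤ w) :
    (C c : Fock) ∈ filtration (2 * j) w := by
  intro d hd
  rw [coeff_C] at hd
  obtain rfl : 0 = d := by by_contra h; simp [h] at hd
  exact ⟨⟨j, by simp⟩, by simpa using hw⟩

theorem pderiv_mem_filtration {D w : ℤ} {f : Fock} (hf : f ∈ filtration D w) (i : Mode) :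
    pderiv i f ∈ filtration (D - 1) (w - (2 * (i.2 : ℤ) + 1)) := by
  intro d hd
  rw [coeff_pderiv] at hd
  obtain ⟨⟨j, hj⟩, h⟩ := hf _ (left_ne_zero_of_mul hd)
  rw [map_add, Finsupp.degree_single] at hj
  rw [map_add, Finsupp.weight_single] at h
  refine ⟨⟨j, ?_⟩, ?_⟩
  · push_cast at hj; linarith
  · simp [modeWeight] at h; linarith

/-- Each of the three parts of the Virasoro operator of index `p` raises the weight by at most `2 -
2p`. -/
theorem virConst_mem_filtration (reg : Mode → Mode → ℂ) (a : Bool) (p : ℕ) :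
    virConst reg a p ∈ filtration 2 (2 - 2 * p) := by
  unfold virConst
  refine Submodule.add_mem _ ?_ ?_
  · split_ifs with h
    · subst h
      refine Submodule.add_mem _ ?_ ?_
      · rw [pow_two]
        exact filtration_mono (by simp) (mul_mem_filtration (X_mem_filtration _) (X_mem_filtration _))
      · exact C_mem_filtration _ 1 (by simp)
    · exact Submodule.zero_mem _
  · split_ifs with h
    · subst h; exact C_mem_filtration _ 1 (by simp)
    · exact Submodule.zero_mem _

theorem virField_mem_filtration (reg : Mode → Mode → ℂ) (a : Bool) (p : ℕ) (j : Mode) :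
    virField reg a p j ∈ filtration 1 (2 * (j.2 : ℤ) + 1 + (2 - 2 * p)) := by
  unfold virField
  refine Submodule.add_mem _ ?_ ?_
  · split_ifs with h
    · refine C_mul_mem_filtration _ (filtration_mono ?_ (X_mem_filtration _))
      simp only
      have := h.2
      omega
    · exact Submodule.zero_mem _
  · split_ifs with h
    · subst h
      refine C_mul_mem_filtration _ (filtration_mono ?_ (X_mem_filtration _))
      simp; omega
    · exact Submodule.zero_mem _

theorem virForm_bound {reg : Mode → Mode → ℂ} {a : Bool} {p : ℕ} {i j : Mode}
    (h : virForm reg a p i j ≠ 0) : 2 * p ≤ 2 * i.2 + 2 * j.2 + 4 := by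
  by_contra hcon
  exact h (virForm_eq_zero _ _ (by omega))

theorem dualVar_mem_filtration (a : Bool) (l : ℕ) : dualVar a l ∈ filtration 1 (2 * (l : ℤ) + 1) := by
  induction l using Nat.strong_induction_on with
  | _ l ih =>
  rw [dualVar]
  refine C_mul_mem_filtration _ (Submodule.sub_mem _ (X_mem_filtration _) ?_)
  refine Submodule.sum_mem _ fun k _ => C_mul_mem_filtration _ ?_
  exact filtration_mono (by have := k.2; omega) (ih k k.2)

section FreeEnergy

variable {reg : Mode → Mode → ℂ} {F : ℕ → Fock}

/-- The derivative of index `i` of `F (m + 1)` gains weight at most `2 - 2 * i.2` over `F m`.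
Recovering `F (m + 1)` through the Euler field multiplies by `dualVar`, of weight at most `2 * i.2 +
1`, so each step costs `3`. The monomial `1` is excluded because the equations fix free energies
only up to constants. -/
theorem IsFreeEnergy.coeff_bound (hF : IsFreeEnergy reg F) (m : ℕ) :
    ∀ d : Mode →₀ ℕ, d ≠ 0 → coeff d (F m) ≠ 0 →
      (∃ j : ℕ, (d.degree : ℤ) + 2 * j = m + 2) ∧ (Finsupp.weight modeWeight d : ℤ) ≤ 3 * m := by
  induction m using Nat.strong_induction_on with
  | _ m ih =>
  rcases m with _ | m
  · intro d _ h
    rw [hF.zero, coeff_zero] at h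
    exact absurd rfl h
  have hpd : ∀ k ≤ m, ∀ i, pderiv i (F k) ∈ filtration (k + 1) (3 * k - (2 * (i.2 : ℤ) + 1)) := by
    intro k hk i d hd
    rw [coeff_pderiv] at hd
    have hne : d + Finsupp.single i 1 ≠ 0 := fun h => by
      have := congrArg (fun e => e i) h
      simp at this
    obtain ⟨⟨j, hj⟩, h⟩ := ih k (by omega) _ hne (left_ne_zero_of_mul hd)
    rw [map_add, Finsupp.degree_single] at hj
    rw [map_add, Finsupp.weight_single] at h
    refine ⟨⟨j, ?_⟩, ?_⟩
    · push_cast at hj; linarith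
    · simp [modeWeight] at h; linarith
  have hrhs : ∀ i : Mode, dirDeriv (dualCoeff i) (F (m + 1)) ∈
      filtration (m + 2) (3 * m + (2 - 2 * i.2)) := by
    intro i
    rw [hF.succ]
    refine Submodule.add_mem _ (Submodule.add_mem _ (Submodule.add_mem _ ?_ ?_) ?_) ?_
    · split_ifs with h
      · subst h
        simpa using virConst_mem_filtration reg i.1 i.2
      · exact Submodule.zero_mem _
    · rw [mkDerivation_eq_sum _ _ subset_rfl]
      refine Submodule.sum_mem _ fun j _ => ?_
      have := mul_mem_filtration (virField_mem_filtration reg i.1 i.2 j) (hpd m le_rfl j)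
      rw [show (1 + ((m : ℤ) + 1)) = m + 2 by ring] at this
      exact filtration_mono (by linarith) this
    · rw [laplacian_eq_sum_sum _ _ subset_rfl]
      refine Submodule.sum_mem _ fun j _ => Submodule.sum_mem _ fun k _ => ?_
      by_cases hc : virForm reg i.1 i.2 j k = 0
      · rw [hc, C_0, zero_mul]; exact Submodule.zero_mem _
      have hb := virForm_bound hc
      have := filtration_add_two (pderiv_mem_filtration (hpd m le_rfl k) j)
      rw [show (m : ℤ) + 1 - 1 + 2 = m + 2 by ring] at this
      refine C_mul_mem_filtration _ (filtration_mono ?_ this)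
      zify at hb
      linarith
    · refine Submodule.sum_mem _ fun x hx => ?_
      have hx := Finset.HasAntidiagonal.mem_antidiagonal.mp hx
      classical
      rw [gradForm_eq_sum_sum _ _ _ (s := (F x.1).vars ∪ (F x.2).vars) Finset.subset_union_left
        Finset.subset_union_right]
      refine Submodule.sum_mem _ fun j _ => Submodule.sum_mem _ fun k _ => ?_
      by_cases hc : virForm reg i.1 i.2 j k = 0
      · rw [hc, C_0, zero_mul]; exact Submodule.zero_mem _
      have hb := virForm_bound hc
      have := mul_mem_filtration (hpd x.1 (by omega) j) (hpd x.2 (by omega) k)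
      rw [show ((x.1 : ℤ) + 1 + (x.2 + 1)) = m + 2 by rw [← hx]; push_cast; ring] at this
      refine C_mul_mem_filtration _ (filtration_mono ?_ this)
      zify at hb hx
      linarith
  obtain ⟨M, hM⟩ := exists_box (F (m + 1)).vars
  have he : euler (F (m + 1)) ∈ filtration (m + 3) (3 * m + 3) := by
    rw [euler_eq_sum _ hM]
    refine Submodule.sum_mem _ fun i _ => ?_
    have := mul_mem_filtration (dualVar_mem_filtration i.1 i.2) (hrhs i)
    rw [show (1 + ((m : ℤ) + 2)) = m + 3 by ring] at this
    exact filtration_mono (by linarith) this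
  intro d hd hne
  obtain ⟨h1, h2⟩ := he d (by
    rw [coeff_euler]
    refine mul_ne_zero ?_ hne
    rw [Nat.cast_ne_zero, Ne, Finsupp.degree_eq_zero_iff]
    exact hd)
  refine ⟨?_, ?_⟩
  · obtain ⟨j, hj⟩ := h1
    exact ⟨j, by push_cast; linarith⟩
  · push_cast; linarith

/-! ### The dilaton equation -/

theorem gradForm_add_left (c : Mode → Mode → ℂ) (f f' g : Fock) :
    gradForm c (f + f') g = gradForm c f g + gradForm c f' g := by
  classical
  set s := f.vars ∪ f'.vars ∪ (f + f').vars
  rw [gradForm_eq_sum c (f + f') g (s := s) Finset.subset_union_right,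
    gradForm_eq_sum c f g (s := s) (fun i hi => by simp [s, hi]),
    gradForm_eq_sum c f' g (s := s) (fun i hi => by simp [s, hi]), ← Finset.sum_add_distrib]
  exact Finset.sum_congr rfl fun i _ => by rw [map_add]; ring

theorem gradForm_C_left (c : Mode → Mode → ℂ) (r : ℂ) (g : Fock) : gradForm c (C r) g = 0 := by
  rw [gradForm]; simp

theorem gradForm_C_mul_left (c : Mode → Mode → ℂ) (r : ℂ) (f g : Fock) :
    gradForm c (C r * f) g = C r * gradForm c f g := by
  classical
  set s := f.vars ∪ (C r * f).vars
  rw [gradForm_eq_sum c (C r * f) g (s := s) Finset.subset_union_right,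
    gradForm_eq_sum c f g (s := s) Finset.subset_union_left, Finset.mul_sum]
  exact Finset.sum_congr rfl fun i _ => by rw [derivation_C_mul']; ring

theorem gradForm_comm {c : Mode → Mode → ℂ} (hc : ∀ i j, c i j = c j i) (f g : Fock) :
    gradForm c f g = gradForm c g f := by
  classical
  rw [gradForm_eq_sum_sum c f g (s := f.vars ∪ g.vars) Finset.subset_union_left
    Finset.subset_union_right, gradForm_eq_sum_sum c g f (s := f.vars ∪ g.vars)
    Finset.subset_union_right Finset.subset_union_left, Finset.sum_comm]
  refine Finset.sum_congr rfl fun i _ => Finset.sum_congr rfl fun j _ => ?_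
  rw [hc j i]; ring

theorem dirDeriv_gradForm (l : Mode → ℂ) (c : Mode → Mode → ℂ) (f g : Fock) :
    dirDeriv l (gradForm c f g) = gradForm c (dirDeriv l f) g + gradForm c f (dirDeriv l g) := by
  classical
  set s := f.vars ∪ (dirDeriv l f).vars
  rw [gradForm_eq_sum c f g (s := s) Finset.subset_union_left,
    gradForm_eq_sum c (dirDeriv l f) g (s := s) Finset.subset_union_right,
    gradForm_eq_sum c f (dirDeriv l g) (s := s) Finset.subset_union_left, map_sum,
    ← Finset.sum_add_distrib]
  refine Finset.sum_congr rfl fun i _ => ?_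
  rw [Derivation.leibniz, dirDeriv_comm l (c i), pderiv_eq_dirDeriv, pderiv_eq_dirDeriv,
    dirDeriv_comm l]
  simp only [smul_eq_mul]
  ring

/-- Taylor coefficients of the derivative of the primitive of `y dx`. -/
def dilatonCoeff (j : Mode) : ℂ :=
  if j.2 = 0 then 0 else 2 * sg j.1 / ((2 * j.2 - 1).factorial : ℂ)

/-- The derivatives on the left of the constraints are the cross terms which appear in the square of
the current when it is shifted by the dilaton vector. -/
theorem dirDeriv_dilaton_field (reg : Mode → Mode → ℂ) (i : Mode) (f : Fock) :
    mkDerivation ℂ (fun j => dirDeriv dilatonCoeff (virField reg i.1 i.2 j)) f =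
      dirDeriv (dualCoeff i) f := by
  rw [mkDerivation_C_eq fun j => dirDeriv_virField reg i.1 i.2 _ j]
  refine dirDeriv_congr fun j _ => ?_
  have h0 : ∀ a, dilatonCoeff (a, 0) = 0 := fun a => if_pos rfl
  simp only [h0, mul_zero, ite_self, add_zero, dualCoeff]
  by_cases h : j.1 = i.1 ∧ i.2 ≤ j.2
  · rw [if_pos h, if_pos ⟨h.1, by omega⟩, dilatonCoeff, if_neg (by simp; omega)]
    simp only
    rw [show 2 * (j.2 + 1 - i.2) - 1 = 2 * (j.2 - i.2) + 1 by omega]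
    ring
  · rw [if_neg h]
    split_ifs with h'
    · rw [show j.2 + 1 - i.2 = 0 by have := h'.2; have : ¬ i.2 ≤ j.2 := fun h2 => h ⟨h'.1, h2⟩; omega,
        h0, mul_zero]
    · rfl

theorem dirDeriv_dilaton_virConst (reg : Mode → Mode → ℂ) (i : Mode) :
    dirDeriv dilatonCoeff (virConst reg i.1 i.2) = 0 := by
  rw [dirDeriv_virConst]
  simp [dilatonCoeff]

theorem eq_C_of_dualDeriv_eq_zero {f : Fock} (h : ∀ i, dirDeriv (dualCoeff i) f = 0) :
    ∃ c, f = C c := by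
  obtain ⟨M, hM⟩ := exists_box f.vars
  have he : euler f = 0 := by rw [euler_eq_sum f hM]; simp [h]
  refine ⟨constantCoeff f, ?_⟩
  ext m
  rw [coeff_C]
  split_ifs with hm
  · rw [← hm]; rfl
  · have := congrArg (coeff m) he
    rw [coeff_euler, coeff_zero] at this
    rcases mul_eq_zero.mp this with h1 | h1
    · rw [Nat.cast_eq_zero, Finsupp.degree_eq_zero_iff] at h1
      exact absurd h1.symm hm
    · exact h1

/-- The dilaton equation. -/
theorem IsFreeEnergy.dilaton (hF : IsFreeEnergy reg F) (m : ℕ) :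
    ∃ c, dirDeriv dilatonCoeff (F (m + 1)) = C (m : ℂ) * F m + C c := by
  induction m using Nat.strong_induction_on with
  | _ m ih =>
  -- Polynomials are determined up to constants by their derivatives in the frame, and these are
  -- given by the recursion.
  suffices h : ∀ i, dirDeriv (dualCoeff i) (dirDeriv dilatonCoeff (F (m + 1)) - C (m : ℂ) * F m) = 0 by
    obtain ⟨c, hc⟩ := eq_C_of_dualDeriv_eq_zero h
    exact ⟨c, by rw [← hc]; ring⟩
  intro i
  rw [map_sub, dirDeriv_comm, hF.succ, map_add, map_add, map_add, dirDeriv_mkDerivation,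
    dirDeriv_dilaton_field, dirDeriv_laplacian, map_sum, derivation_C_mul']
  have hA : dirDeriv dilatonCoeff (if m = 0 then virConst reg i.1 i.2 else 0) = 0 := by
    split_ifs
    · exact dirDeriv_dilaton_virConst reg i
    · exact map_zero _
  rw [hA]
  rcases m with _ | m
  · simp [hF.zero, gradForm]
  obtain ⟨c, hc⟩ := ih m (by omega)
  have hmc : mkDerivation ℂ (virField reg i.1 i.2) (C c) = 0 := derivation_C _ c
  rw [hc, map_add, map_add, laplacian_C, hmc, derivation_C_mul', map_C_mul]
  have hg : ∀ f g, gradForm (virForm reg i.1 i.2) f g = gradForm (virForm reg i.1 i.2) g f :=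
    gradForm_comm (virForm_symm reg i.1 i.2)
  have hstep : ∀ x ∈ Finset.HasAntidiagonal.antidiagonal m, ∀ g,
      gradForm (virForm reg i.1 i.2) (dirDeriv dilatonCoeff (F (x.1 + 1))) g =
        C (x.1 : ℂ) * gradForm (virForm reg i.1 i.2) (F x.1) g := by
    intro x hx g
    have := Finset.HasAntidiagonal.mem_antidiagonal.mp hx
    obtain ⟨c', hc'⟩ := ih x.1 (by omega)
    rw [hc', gradForm_add_left, gradForm_C_left, gradForm_C_mul_left, add_zero]
  have hstep' : ∀ x ∈ Finset.HasAntidiagonal.antidiagonal m, ∀ g,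
      gradForm (virForm reg i.1 i.2) (dirDeriv dilatonCoeff (F (x.2 + 1))) g =
        C (x.2 : ℂ) * gradForm (virForm reg i.1 i.2) (F x.2) g := by
    intro x hx g
    refine hstep x.swap ?_ g
    rw [Finset.HasAntidiagonal.mem_antidiagonal] at hx ⊢
    rw [← hx, Prod.fst_swap, Prod.snd_swap, add_comm]
  -- By induction, differentiating either factor lowers its index by one and multiplies by the new
  -- index. The boundary terms vanish since `F 0 = 0`, and the two new indices add up to `m`.
  have hsum : ∑ x ∈ Finset.HasAntidiagonal.antidiagonal (m + 1),
      dirDeriv dilatonCoeff (gradForm (virForm reg i.1 i.2) (F x.1) (F x.2)) =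
      C (m : ℂ) * ∑ x ∈ Finset.HasAntidiagonal.antidiagonal m,
        gradForm (virForm reg i.1 i.2) (F x.1) (F x.2) := by
    simp_rw [dirDeriv_gradForm]
    rw [Finset.sum_add_distrib, Finset.Nat.antidiagonal_succ, Finset.sum_cons, Finset.sum_map,
      ← Finset.Nat.antidiagonal_succ, Finset.Nat.antidiagonal_succ', Finset.sum_cons, Finset.sum_map]
    simp only [hF.zero, map_zero, Function.Embedding.prodMap, Function.Embedding.coeFn_mk, Prod.map,
      Function.Embedding.refl_apply, Nat.succ_eq_add_one]
    have z1 : ∀ g, gradForm (virForm reg i.1 i.2) 0 g = 0 := fun g => by simp [gradForm]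
    have z2 : ∀ g, gradForm (virForm reg i.1 i.2) g 0 = 0 := fun g => by simp [gradForm]
    rw [z1, z2, zero_add, zero_add, Finset.mul_sum, ← Finset.sum_add_distrib]
    refine Finset.sum_congr rfl fun x hx => ?_
    rw [hstep x hx, hg (F x.1) (dirDeriv dilatonCoeff (F (x.2 + 1))),
      hstep' x hx, hg (F x.2), ← Finset.HasAntidiagonal.mem_antidiagonal.mp hx]
    push_cast
    rw [map_add]
    ring
  rw [hsum, hF.succ]
  push_cast
  rw [map_add, C_1]
  by_cases hm : m = 0
  · subst hm
    simp [hF.zero]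
  · simp only [hm, if_false]
    ring

/-! ### String equations -/

/-- The vector field `∑ v k L k`. -/
def stringField (reg : Mode → Mode → ℂ) (v : Mode → ℂ) (j : Mode) : Fock :=
  ∑ k ∈ (Finset.univ : Finset Bool) ×ˢ Finset.range (j.2 + 2), C (v k) * virField reg k.1 k.2 j

def stringCoeff (v : Mode → ℂ) (j : Mode) : ℂ :=
  ∑ k ∈ (Finset.univ : Finset Bool) ×ˢ Finset.range (j.2 + 1), v k * dualCoeff k j

theorem box_subset {m n : ℕ} (h : m ≤ n) :
    (Finset.univ : Finset Bool) ×ˢ Finset.range m ⊆ (Finset.univ : Finset Bool) ×ˢ Finset.range n :=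
  Finset.product_subset_product_right (Finset.range_subset_range.mpr h)

/-- If the combination `∑ v k C k` of the quadratic forms vanishes, then the corresponding
combination of the constraints is a first order equation. -/
theorem IsFreeEnergy.string (hF : IsFreeEnergy reg F) {v : Mode → ℂ}
    (hv : ∀ i j : Mode, ∀ M, i.2 + j.2 + 3 ≤ M →
      ∑ k ∈ (Finset.univ : Finset Bool) ×ˢ Finset.range M, v k * virForm reg k.1 k.2 i j = 0)
    {m : ℕ} (hm : m ≠ 0) :
    dirDeriv (stringCoeff v) (F (m + 1)) = mkDerivation ℂ (stringField reg v) (F m) := by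
  classical
  obtain ⟨M, hM⟩ := exists_box (((Finset.range (m + 2)).biUnion fun k => (F k).vars))
  set s := (Finset.univ : Finset Bool) ×ˢ Finset.range M
  have hs : ∀ k ≤ m + 1, (F k).vars ⊆ s := fun k hk i hi =>
    hM (Finset.mem_biUnion.mpr ⟨k, by simp; omega, hi⟩)
  have hsl : ∀ j ∈ s, j.2 < M := fun j hj => by simpa [s] using hj
  -- On the modes which occur in these free energies all coefficients of the operators with index
  -- outside this box vanish, so the infinite combination becomes a finite sum.
  set t := (Finset.univ : Finset Bool) ×ˢ Finset.range (2 * M + 3)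
  have h1 : dirDeriv (stringCoeff v) (F (m + 1)) =
      ∑ k ∈ t, C (v k) * dirDeriv (dualCoeff k) (F (m + 1)) := by
    simp_rw [← dirDeriv_smul]
    rw [← dirDeriv_sum]
    refine dirDeriv_congr fun j hj => ?_
    have := hsl j (hs _ le_rfl hj)
    refine Finset.sum_subset (box_subset (by omega)) fun k _ hk => ?_
    have : dualCoeff k j = 0 := if_neg fun h => hk (by simp; omega)
    rw [this, mul_zero]
  have h2 : mkDerivation ℂ (stringField reg v) (F m) =
      ∑ k ∈ t, C (v k) * mkDerivation ℂ (virField reg k.1 k.2) (F m) := by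
    have : ∀ k, C (v k) * mkDerivation ℂ (virField reg k.1 k.2) (F m) =
        ((C (v k) : Fock) • mkDerivation ℂ (virField reg k.1 k.2)) (F m) := fun k => rfl
    simp_rw [this]
    rw [← derivation_sum_apply]
    refine derivation_eq_of_forall_mem_vars fun j hj => ?_
    have := hsl j (hs _ (by omega) hj)
    rw [mkDerivation_X, derivation_sum_apply]
    simp only [Derivation.smul_apply, mkDerivation_X, smul_eq_mul]
    refine Finset.sum_subset (box_subset (by omega)) fun k _ hk => ?_
    rw [virField_eq_zero, mul_zero]
    simp at hk; omega
  have h3 : ∀ φ : Mode → Mode → Fock, ∑ k ∈ t, C (v k) *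
      ∑ i ∈ s, ∑ j ∈ s, C (virForm reg k.1 k.2 i j) * φ i j = 0 := by
    intro φ
    simp_rw [Finset.mul_sum]
    rw [Finset.sum_comm]
    refine Finset.sum_eq_zero fun i hi => ?_
    rw [Finset.sum_comm]
    refine Finset.sum_eq_zero fun j hj => ?_
    simp_rw [← mul_assoc, ← C_mul]
    rw [← Finset.sum_mul, ← map_sum, hv i j _ (by have := hsl i hi; have := hsl j hj; omega), C_0,
      zero_mul]
  rw [h1, h2]
  simp_rw [hF.succ, if_neg hm, zero_add, mul_add]
  rw [Finset.sum_add_distrib, Finset.sum_add_distrib]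
  have h4 : ∑ k ∈ t, C (v k) * laplacian (virForm reg k.1 k.2) (F m) = 0 := by
    simp_rw [laplacian_eq_sum_sum _ _ (hs m (by omega))]
    exact h3 _
  have h5 : ∑ k ∈ t, C (v k) * ∑ x ∈ Finset.HasAntidiagonal.antidiagonal m,
      gradForm (virForm reg k.1 k.2) (F x.1) (F x.2) = 0 := by
    simp_rw [Finset.mul_sum]
    rw [Finset.sum_comm]
    refine Finset.sum_eq_zero fun x hx => ?_
    have := Finset.HasAntidiagonal.mem_antidiagonal.mp hx
    simp_rw [gradForm_eq_sum_sum _ _ _ (hs x.1 (by omega)) (hs x.2 (by omega))]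
    exact h3 _
  rw [h4, h5, add_zero, add_zero]

end FreeEnergy

/-! ### Polarization -/

/-- Constant vector fields commute, so iterated derivatives depend only on the multiset of
directions. This is the source of the symmetry of the invariants. -/
instance : LeftCommutative fun (l : Mode → ℂ) (T : Fock →ₗ[ℂ] Fock) =>
    (dirDeriv l).toLinearMap ∘ₗ T :=
  ⟨fun l l' T => LinearMap.ext fun f => dirDeriv_comm l l' (T f)⟩

/-- Iterated derivatives along constant vector fields. -/
def iterDeriv (s : Multiset (Mode → ℂ)) : Fock →ₗ[ℂ] Fock :=
  s.foldr (fun l T => (dirDeriv l).toLinearMap ∘ₗ T) LinearMap.id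

theorem iterDeriv_zero (f : Fock) : iterDeriv 0 f = f := rfl

theorem iterDeriv_cons (l : Mode → ℂ) (s : Multiset (Mode → ℂ)) (f : Fock) :
    iterDeriv (l ::ₘ s) f = dirDeriv l (iterDeriv s f) := by
  unfold iterDeriv
  rw [Multiset.foldr_cons]
  rfl

theorem iterDeriv_cons' (l : Mode → ℂ) (s : Multiset (Mode → ℂ)) (f : Fock) :
    iterDeriv (l ::ₘ s) f = iterDeriv s (dirDeriv l f) := by
  induction s using Multiset.induction_on with
  | empty => rfl
  | cons a s ih => rw [Multiset.cons_swap, iterDeriv_cons, ih, ← iterDeriv_cons]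

/-- Iterated derivatives at the origin. -/
def corr (s : Multiset (Mode → ℂ)) (f : Fock) : ℂ := constantCoeff (iterDeriv s f)

theorem corr_cons (l : Mode → ℂ) (s : Multiset (Mode → ℂ)) (f : Fock) :
    corr (l ::ₘ s) f = corr s (dirDeriv l f) := by rw [corr, iterDeriv_cons', corr]

theorem corr_add (s : Multiset (Mode → ℂ)) (f g : Fock) : corr s (f + g) = corr s f + corr s g := by
  simp [corr]

theorem corr_C_mul (s : Multiset (Mode → ℂ)) (c : ℂ) (f : Fock) : corr s (C c * f) = c * corr s f := by
  simp [corr, map_C_mul]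

theorem corr_sum {κ : Type*} (s : Multiset (Mode → ℂ)) (t : Finset κ) (f : κ → Fock) :
    corr s (∑ k ∈ t, f k) = ∑ k ∈ t, corr s (f k) := by simp [corr]

theorem corr_zero_right (s : Multiset (Mode → ℂ)) : corr s 0 = 0 := by simp [corr]

theorem corr_C (l : Mode → ℂ) (s : Multiset (Mode → ℂ)) (c : ℂ) : corr (l ::ₘ s) (C c) = 0 := by
  rw [corr_cons, derivation_C, corr_zero_right]

theorem coeff_dirDeriv (l : Mode → ℂ) (f : Fock) (d : Mode →₀ ℕ) :
    coeff d (dirDeriv l f) =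
      ∑ i ∈ f.vars, l i * (coeff (d + Finsupp.single i 1) f * ((d i : ℂ) + 1)) := by
  rw [dirDeriv_eq_sum l f subset_rfl, coeff_sum]
  refine Finset.sum_congr rfl fun i _ => ?_
  rw [coeff_C_mul, coeff_pderiv]

theorem corr_eq_zero_of_degree {s : Multiset (Mode → ℂ)} {f : Fock}
    (h : ∀ d, d.degree = s.card → coeff d f = 0) : corr s f = 0 := by
  induction s using Multiset.induction_on generalizing f with
  | empty => exact h 0 (by simp)
  | cons l s ih =>
    rw [corr_cons]
    refine ih fun d hd => ?_
    rw [coeff_dirDeriv]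
    refine Finset.sum_eq_zero fun i _ => ?_
    rw [h (d + Finsupp.single i 1) (by rw [map_add, Finsupp.degree_single, hd, Multiset.card_cons]),
      zero_mul, mul_zero]

theorem vars_pderiv_subset (i : Mode) (f : Fock) : (pderiv i f).vars ⊆ f.vars := by
  classical
  intro j hj
  obtain ⟨d, hd, hjd⟩ := (mem_vars_iff_mem_support _).mp hj
  refine (mem_vars_iff_mem_support _).mpr ⟨d + Finsupp.single i 1, ?_, ?_⟩
  · rw [mem_support_iff, coeff_pderiv] at hd
    exact mem_support_iff.mpr (left_ne_zero_of_mul hd)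
  · rw [Finsupp.mem_support_iff] at hjd ⊢
    simp only [Finsupp.add_apply]
    omega

/-- The coefficients of the symmetric multilinear form belonging to `f`. -/
def polar {n : ℕ} (f : Fock) (t : Fin n → Mode) : ℂ :=
  corr (Finset.univ.val.map fun j => Pi.single (t j) 1) f

theorem univ_val_map_succ {n : ℕ} {κ : Type*} (l : Fin (n + 1) → κ) :
    (Finset.univ : Finset (Fin (n + 1))).val.map l =
      l 0 ::ₘ (Finset.univ : Finset (Fin n)).val.map (Fin.tail l) := by
  rw [Fin.univ_val_map, Fin.univ_val_map, List.ofFn_succ]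
  rfl

/-- Multilinearity: the coefficients `polar f t` do not depend on the directions, so each direction
can later be replaced by a series or a polynomial in a variable of its own. -/
theorem corr_eq_sum_polar {n : ℕ} (l : Fin n → Mode → ℂ) (f : Fock) {s : Finset Mode}
    (hs : f.vars ⊆ s) :
    corr (Finset.univ.val.map l) f =
      ∑ t ∈ Fintype.piFinset fun _ : Fin n => s, (∏ j, l j (t j)) * polar f t := by
  induction n generalizing f with
  | zero =>
    simp [polar]
  | succ n ih =>
    rw [univ_val_map_succ, corr_cons, dirDeriv_eq_sum _ _ hs, corr_sum]
    simp_rw [corr_C_mul]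
    have h : ∀ i ∈ s, corr (Finset.univ.val.map (Fin.tail l)) (pderiv i f) =
        ∑ t ∈ Fintype.piFinset fun _ : Fin n => s, (∏ j, Fin.tail l j (t j)) *
          polar f (Fin.cons i t : Fin (n + 1) → Mode) := by
      intro i _
      rw [ih _ _ ((vars_pderiv_subset i f).trans hs)]
      refine Finset.sum_congr rfl fun t _ => ?_
      unfold polar
      rw [univ_val_map_succ, corr_cons, pderiv_eq_dirDeriv]
      rfl
    rw [Finset.sum_congr rfl fun i hi => by rw [h i hi]]
    simp_rw [Finset.mul_sum]
    rw [← Finset.sum_product']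
    refine Finset.sum_bij' (fun x _ => (Fin.cons x.1 x.2 : Fin (n + 1) → Mode))
      (fun t _ => (t 0, Fin.tail t)) ?_ ?_ ?_ ?_ ?_
    · intro x hx
      rw [Finset.mem_product, Fintype.mem_piFinset] at hx
      rw [Fintype.mem_piFinset]
      exact Fin.cases hx.1 hx.2
    · intro t ht
      rw [Fintype.mem_piFinset] at ht
      rw [Finset.mem_product, Fintype.mem_piFinset]
      exact ⟨ht 0, fun j => ht j.succ⟩
    · intro x _; simp
    · intro t _; simp
    · intro x _
      rw [Fin.prod_univ_succ]
      simp only [Fin.cons_zero, Fin.cons_succ, Fin.tail, mul_assoc]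

theorem coeff_ne_zero_of_polar_ne_zero {n : ℕ} {f : Fock} {t : Fin n → Mode} (h : polar f t ≠ 0) :
    coeff (∑ j, Finsupp.single (t j) 1) f ≠ 0 := by
  induction n generalizing f with
  | zero => simpa [polar, corr, constantCoeff_eq, iterDeriv_zero] using h
  | succ n ih =>
    unfold polar at h
    rw [univ_val_map_succ, corr_cons, ← pderiv_eq_dirDeriv] at h
    have := ih (f := pderiv (t 0) f) (t := Fin.tail t) h
    rw [coeff_pderiv] at this
    rw [Fin.sum_univ_succ, add_comm]
    exact left_ne_zero_of_mul this

/-! ### Iterated derivatives of products, vector fields and quadratic operators. -/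

/-- The Leibniz rule for iterated derivatives. -/
theorem corr_mul {κ : Type*} [DecidableEq κ] (l : κ → Mode → ℂ) (S : Finset κ) (f g : Fock) :
    corr (S.val.map l) (f * g) =
      ∑ I ∈ S.powerset, corr (I.val.map l) f * corr ((S \ I).val.map l) g := by
  induction S using Finset.induction_on generalizing f g with
  | empty => simp [corr, iterDeriv_zero]
  | insert a S ha ih =>
    rw [Finset.insert_val_of_notMem ha, Multiset.map_cons, corr_cons, Derivation.leibniz, corr_add,
      smul_eq_mul, smul_eq_mul, ih, mul_comm g, ih, Finset.sum_powerset_insert ha]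
    congr 1
    · refine Finset.sum_congr rfl fun I hI => ?_
      have haI : a ∉ I := fun h => ha (Finset.mem_powerset.mp hI h)
      rw [Finset.insert_sdiff_of_notMem _ haI, Finset.insert_val_of_notMem (by simp [ha]),
        Multiset.map_cons, corr_cons]
    · refine Finset.sum_congr rfl fun I hI => ?_
      have haI : a ∉ I := fun h => ha (Finset.mem_powerset.mp hI h)
      have hd : insert a S \ insert a I = S \ I := by
        ext x; simp only [Finset.mem_sdiff, Finset.mem_insert]
        by_cases hx : x = a
        · subst hx; simp [ha]
        · simp [hx]
      rw [hd, Finset.insert_val_of_notMem haI, Multiset.map_cons, corr_cons]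

/-- The components of the field have constant first derivatives in the given directions, so at most
one direction can hit them; it is then replaced by the direction `μ r`. -/
theorem iterDeriv_mkDerivation {κ : Type*} [DecidableEq κ] (l : κ → Mode → ℂ) (S : Finset κ)
    (b : Mode → Fock) (μ : κ → Mode → ℂ) (hb : ∀ r j, dirDeriv (l r) (b j) = C (μ r j)) (f : Fock) :
    iterDeriv (S.val.map l) (mkDerivation ℂ b f) =
      mkDerivation ℂ b (iterDeriv (S.val.map l) f) +
        ∑ r ∈ S, iterDeriv ((S.erase r).val.map l) (dirDeriv (μ r) f) := by
  induction S using Finset.induction_on with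
  | empty => simp [iterDeriv_zero]
  | insert a S ha ih =>
    rw [Finset.insert_val_of_notMem ha, Multiset.map_cons, iterDeriv_cons, ih, map_add,
      dirDeriv_mkDerivation, mkDerivation_C_eq (hb a), ← iterDeriv_cons, ← iterDeriv_cons,
      Finset.sum_insert ha, Finset.erase_insert ha, map_sum, add_assoc]
    rw [iterDeriv_cons' (μ a)]
    congr 2
    refine Finset.sum_congr rfl fun r hr => ?_
    have har : a ≠ r := fun h => ha (h ▸ hr)
    rw [Finset.erase_insert_of_ne har, Finset.insert_val_of_notMem (by simp [ha]), Multiset.map_cons,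
      iterDeriv_cons]

theorem corr_mkDerivation {κ : Type*} [DecidableEq κ] (l : κ → Mode → ℂ) (S : Finset κ)
    (b : Mode → Fock) (μ : κ → Mode → ℂ) (hb : ∀ r j, dirDeriv (l r) (b j) = C (μ r j))
    (hb0 : ∀ j, constantCoeff (b j) = 0) (f : Fock) :
    corr (S.val.map l) (mkDerivation ℂ b f) =
      ∑ r ∈ S, corr ((S.erase r).val.map l) (dirDeriv (μ r) f) := by
  have h0 (g : Fock) : constantCoeff (mkDerivation ℂ b g) = 0 := by
    rw [mkDerivation_eq_sum _ _ subset_rfl, map_sum]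
    refine Finset.sum_eq_zero fun i _ => ?_
    rw [map_mul, hb0, zero_mul]
  rw [corr, iterDeriv_mkDerivation l S b μ hb, map_add, h0, zero_add, map_sum]
  rfl

theorem corr_gradForm {κ : Type*} [DecidableEq κ] (l : κ → Mode → ℂ) (S : Finset κ)
    (c : Mode → Mode → ℂ) {f g : Fock} {s : Finset Mode} (hf : f.vars ⊆ s) (hg : g.vars ⊆ s) :
    corr (S.val.map l) (gradForm c f g) = ∑ I ∈ S.powerset, ∑ i ∈ s, ∑ j ∈ s,
      c i j * (corr (I.val.map l) (pderiv i f) * corr ((S \ I).val.map l) (pderiv j g)) := by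
  rw [gradForm_eq_sum_sum c f g hf hg]
  simp_rw [corr_sum, corr_C_mul, corr_mul, Finset.mul_sum]
  rw [Finset.sum_comm]
  rw [Finset.sum_congr rfl fun j _ => Finset.sum_comm]
  rw [Finset.sum_comm]
  exact Finset.sum_congr rfl fun I _ => Finset.sum_comm

theorem corr_laplacian (S : Multiset (Mode → ℂ)) (c : Mode → Mode → ℂ) {f : Fock}
    {s : Finset Mode} (hf : f.vars ⊆ s) :
    corr S (laplacian c f) = ∑ i ∈ s, ∑ j ∈ s, c i j * corr S (pderiv i (pderiv j f)) := by
  rw [laplacian_eq_sum_sum c f hf]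
  simp_rw [corr_sum, corr_C_mul]

/-- Only `n`-fold derivatives with `n + 2g = m + 2` for some genus `g` can be nonzero, so the index
of the free energy and the number of points determine the genus. -/
theorem IsFreeEnergy.corr_eq_zero {reg : Mode → Mode → ℂ} {F : ℕ → Fock} (hF : IsFreeEnergy reg F)
    {m : ℕ} {s : Multiset (Mode → ℂ)} (hs : s ≠ 0) (h : ∀ j, s.card + 2 * j ≠ m + 2) :
    corr s (F m) = 0 := by
  refine corr_eq_zero_of_degree fun d hd => ?_
  by_contra hne
  have hd0 : d ≠ 0 := by
    rintro rfl
    rw [map_zero] at hd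
    exact hs (Multiset.card_eq_zero.mp hd.symm)
  obtain ⟨⟨j, hj⟩, -⟩ := hF.coeff_bound m d hd0 hne
  exact h j (by rw [← hd]; exact_mod_cast hj)

theorem IsFreeEnergy.weight_le {reg : Mode → Mode → ℂ} {F : ℕ → Fock} (hF : IsFreeEnergy reg F)
    {m n : ℕ} (hn : n ≠ 0) {t : Fin n → Mode} (h : polar (F m) t ≠ 0) :
    ∑ j, (2 * (t j).2 + 1) ≤ 3 * m := by
  have h1 := coeff_ne_zero_of_polar_ne_zero h
  have hdeg : (∑ j, Finsupp.single (t j) 1 : Mode →₀ ℕ).degree = n := by simp [map_sum]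
  obtain ⟨-, h2⟩ := hF.coeff_bound m _ (fun h0 => hn (by rw [← hdeg, h0, map_zero])) h1
  rw [map_sum] at h2
  have h3 : ∑ j, Finsupp.weight modeWeight (Finsupp.single (t j) 1) = ∑ j, (2 * (t j).2 + 1) :=
    Finset.sum_congr rfl fun j _ => by simp [Finsupp.weight_single, modeWeight]
  rw [h3] at h2
  exact_mod_cast h2

/-! ### Residues -/

/-- On all small circles about `α` the function `f` is integrable, with integral `2πi c`. -/
def HasRes (f : ℂ → ℂ) (α c : ℂ) : Prop :=
  ∀ᶠ r : ℝ in 𝓝[>] 0, CircleIntegrable f α r ∧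
    (2 * Real.pi * Complex.I)⁻¹ * (∮ z in C(α, r), f z) = c

theorem HasRes.residue_eq {f : ℂ → ℂ} {α c : ℂ} (h : HasRes f α c) : residue f α = c :=
  Filter.Tendsto.limUnder_eq (tendsto_const_nhds.congr' (h.mono fun _ hr => hr.2.symm))

theorem eventually_forall_sphere {P : ℂ → Prop} {α : ℂ} (h : ∀ᶠ w in 𝓝[≠] α, P w) :
    ∀ᶠ r : ℝ in 𝓝[>] 0, ∀ w ∈ Metric.sphere α r, P w := by
  obtain ⟨ε, hε, hP⟩ := Metric.mem_nhdsWithin_iff.mp h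
  filter_upwards [Ioo_mem_nhdsGT hε] with r hr w hw
  refine hP ⟨?_, ?_⟩
  · rw [Metric.mem_ball, Metric.mem_sphere.mp hw]; exact hr.2
  · rintro rfl
    rw [Metric.mem_sphere, dist_self] at hw
    exact hr.1.ne hw

theorem HasRes.congr {f g : ℂ → ℂ} {α c : ℂ} (h : HasRes f α c) (hfg : ∀ᶠ w in 𝓝[≠] α, f w = g w) :
    HasRes g α c := by
  filter_upwards [h, eventually_forall_sphere hfg, self_mem_nhdsWithin] with r hr hs hr0
  have hr0' : (0 : ℝ) ≤ r := le_of_lt hr0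
  refine ⟨(circleIntegrable_congr ?_).mp hr.1, ?_⟩
  · rw [abs_of_nonneg hr0']; exact hs
  · rw [← hr.2, circleIntegral.integral_congr hr0' hs]

theorem HasRes.add {f g : ℂ → ℂ} {α c d : ℂ} (hf : HasRes f α c) (hg : HasRes g α d) :
    HasRes (fun w => f w + g w) α (c + d) := by
  filter_upwards [hf, hg] with r h1 h2
  exact ⟨h1.1.add h2.1, by rw [circleIntegral.integral_add h1.1 h2.1, mul_add, h1.2, h2.2]⟩

theorem HasRes.const_mul {f : ℂ → ℂ} {α c : ℂ} (hf : HasRes f α c) (a : ℂ) :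
    HasRes (fun w => a * f w) α (a * c) := by
  filter_upwards [hf] with r h1
  refine ⟨h1.1.const_fun_smul (a := a), ?_⟩
  rw [circleIntegral.integral_const_mul, ← h1.2]
  ring

theorem hasRes_zero (α : ℂ) : HasRes (fun _ => 0) α 0 := by
  refine Filter.Eventually.of_forall fun r => ⟨circleIntegrable_const 0 α r, ?_⟩
  simp [circleIntegral]

theorem HasRes.sum {κ : Type*} {t : Finset κ} {f : κ → ℂ → ℂ} {α : ℂ} {c : κ → ℂ}
    (h : ∀ k ∈ t, HasRes (f k) α (c k)) :
    HasRes (fun w => ∑ k ∈ t, f k w) α (∑ k ∈ t, c k) := by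
  classical
  induction t using Finset.induction_on with
  | empty => simpa using hasRes_zero α
  | insert a t ha ih =>
    simp only [Finset.sum_insert ha]
    exact (h a (Finset.mem_insert_self _ _)).add
      (ih fun k hk => h k (Finset.mem_insert_of_mem hk))

theorem hasRes_of_analyticAt {f : ℂ → ℂ} {α : ℂ} (hf : AnalyticAt ℂ f α) : HasRes f α 0 := by
  obtain ⟨ε, hε, hP⟩ := Metric.mem_nhds_iff.mp hf.eventually_analyticAt
  filter_upwards [Ioo_mem_nhdsGT hε] with r hr
  have hd : DifferentiableOn ℂ f (Metric.closedBall α r) := fun w hw =>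
    (hP (Metric.closedBall_subset_ball hr.2 hw)).differentiableAt.differentiableWithinAt
  refine ⟨(hd.continuousOn.mono Metric.sphere_subset_closedBall).circleIntegrable hr.1.le, ?_⟩
  have h0 := (hd.diffContOnCl_ball subset_rfl).circleIntegral_eq_zero hr.1.le
  rw [h0, mul_zero]

theorem hasRes_of_hasDerivAt {F f : ℂ → ℂ} {α : ℂ} (hf : ∀ᶠ w in 𝓝[≠] α, ContinuousAt f w)
    (hF : ∀ᶠ w in 𝓝[≠] α, HasDerivAt F (f w) w) : HasRes f α 0 := by
  filter_upwards [eventually_forall_sphere hf, eventually_forall_sphere hF,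
    self_mem_nhdsWithin] with r h1 h2 hr0
  have hr0' : (0 : ℝ) ≤ r := le_of_lt hr0
  refine ⟨ContinuousOn.circleIntegrable hr0' fun w hw => (h1 w hw).continuousWithinAt, ?_⟩
  rw [circleIntegral.integral_eq_zero_of_hasDerivWithinAt hr0' fun w hw =>
    (h2 w hw).hasDerivWithinAt, mul_zero]

theorem hasRes_sub_inv (α : ℂ) : HasRes (fun w => (w - α)⁻¹) α 1 := by
  filter_upwards [self_mem_nhdsWithin] with r hr0
  have hr : r ≠ 0 := ne_of_gt hr0
  refine ⟨circleIntegrable_sub_inv_iff.mpr (Or.inr ?_), ?_⟩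
  · rw [Metric.mem_sphere, dist_self]
    exact (abs_pos.mpr hr).ne
  · rw [circleIntegral.integral_sub_center_inv α hr]
    exact inv_mul_cancel₀ Complex.two_pi_I_ne_zero

/-! ### Taylor coefficients at the origin -/

/-- The `n`-th Taylor coefficient of `f` at `0`. -/
def taylorCoeff (f : ℂ → ℂ) (n : ℕ) : ℂ := iteratedDeriv n f 0 / n.factorial

theorem analyticAt_dslope {f : ℂ → ℂ} {a : ℂ} (hf : AnalyticAt ℂ f a) : AnalyticAt ℂ (dslope f a) a :=
  let ⟨_, hp⟩ := hf
  hp.has_fpower_series_dslope_fslope.analyticAt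

theorem HasFPowerSeriesAt.taylorCoeff_eq {f : ℂ → ℂ} {p : FormalMultilinearSeries ℂ ℂ ℂ}
    (hp : HasFPowerSeriesAt f p 0) (n : ℕ) : taylorCoeff f n = p.coeff n := by
  have h := hp.analyticAt.hasFPowerSeriesAt
  rw [hp.eq_formalMultilinearSeries h, FormalMultilinearSeries.coeff_ofScalars]
  rfl

theorem taylorCoeff_dslope {f : ℂ → ℂ} (hf : AnalyticAt ℂ f 0) (n : ℕ) :
    taylorCoeff (dslope f 0) n = taylorCoeff f (n + 1) := by
  obtain ⟨p, hp⟩ := hf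
  rw [HasFPowerSeriesAt.taylorCoeff_eq hp.has_fpower_series_dslope_fslope,
    HasFPowerSeriesAt.taylorCoeff_eq hp, FormalMultilinearSeries.coeff_fslope]

theorem taylorCoeff_zero (f : ℂ → ℂ) : taylorCoeff f 0 = f 0 := by simp [taylorCoeff]

theorem taylorCoeff_congr {f g : ℂ → ℂ} (h : f =ᶠ[𝓝 0] g) (n : ℕ) :
    taylorCoeff f n = taylorCoeff g n := by
  rw [taylorCoeff, h.iteratedDeriv_eq, taylorCoeff]

theorem taylorCoeff_add {f g : ℂ → ℂ} (hf : AnalyticAt ℂ f 0) (hg : AnalyticAt ℂ g 0) (n : ℕ) :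
    taylorCoeff (fun s => f s + g s) n = taylorCoeff f n + taylorCoeff g n := by
  rw [taylorCoeff, taylorCoeff, taylorCoeff, ← add_div]
  congr 1
  exact iteratedDeriv_fun_add hf.contDiffAt hg.contDiffAt

theorem taylorCoeff_const_mul (c : ℂ) {f : ℂ → ℂ} (hf : AnalyticAt ℂ f 0) (n : ℕ) :
    taylorCoeff (fun s => c * f s) n = c * taylorCoeff f n := by
  rw [taylorCoeff, taylorCoeff, mul_div_assoc']
  congr 1
  exact iteratedDeriv_const_mul c hf.contDiffAt

theorem taylorCoeff_mul {f g : ℂ → ℂ} (hf : AnalyticAt ℂ f 0) (hg : AnalyticAt ℂ g 0) (n : ℕ) :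
    taylorCoeff (fun s => f s * g s) n =
      ∑ k ∈ Finset.range (n + 1), taylorCoeff f k * taylorCoeff g (n - k) := by
  have h := iteratedDeriv_fun_mul (n := n) (x := (0 : ℂ)) hf.contDiffAt hg.contDiffAt
  rw [taylorCoeff, h, Finset.sum_div]
  refine Finset.sum_congr rfl fun k hk => ?_
  have hk' : k ≤ n := Nat.lt_succ_iff.mp (Finset.mem_range.mp hk)
  rw [taylorCoeff, taylorCoeff, Nat.cast_choose ℂ hk']
  have h1 : (n.factorial : ℂ) ≠ 0 := Nat.cast_ne_zero.mpr n.factorial_ne_zero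
  field_simp

theorem taylorCoeff_eq_zero_of_even {f : ℂ → ℂ} (hf : ∀ᶠ s in 𝓝 0, f (-s) = f s) {n : ℕ}
    (hn : Odd n) : taylorCoeff f n = 0 := by
  have h1 : iteratedDeriv n (fun s => f (-s)) 0 = iteratedDeriv n f 0 :=
    Filter.EventuallyEq.iteratedDeriv_eq n hf
  rw [iteratedDeriv_comp_neg, hn.neg_one_pow, neg_zero, neg_smul, one_smul] at h1
  have h2 : iteratedDeriv n f 0 = 0 := by linear_combination (-1 / 2 : ℂ) * h1
  rw [taylorCoeff, h2, zero_div]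

theorem taylorCoeff_even_mul {f g : ℂ → ℂ} (hf : AnalyticAt ℂ f 0) (hg : AnalyticAt ℂ g 0)
    (he : ∀ᶠ s in 𝓝 0, f (-s) = f s) (n : ℕ) :
    taylorCoeff (fun s => f s * g s) n =
      ∑ k ∈ Finset.range (n / 2 + 1), taylorCoeff f (2 * k) * taylorCoeff g (n - 2 * k) := by
  rw [taylorCoeff_mul hf hg]
  refine (Finset.sum_subset_zero_on_sdiff (s₁ := (Finset.range (n / 2 + 1)).image (2 * ·)) ?_ ?_
    (fun _ _ => rfl)).symm.trans ?_
  · intro k hk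
    obtain ⟨m, hm, rfl⟩ := Finset.mem_image.mp hk
    rw [Finset.mem_range] at hm ⊢
    omega
  · intro k hk
    rw [Finset.mem_sdiff, Finset.mem_range, Finset.mem_image] at hk
    rw [taylorCoeff_eq_zero_of_even he, zero_mul]
    rcases Nat.even_or_odd' k with ⟨m, rfl | rfl⟩
    · exact absurd ⟨m, Finset.mem_range.mpr (by omega), rfl⟩ hk.2
    · exact ⟨m, rfl⟩
  · rw [Finset.sum_image fun a _ b _ h => by simpa using h]

theorem taylorCoeff_mul_even {f g : ℂ → ℂ} (hf : AnalyticAt ℂ f 0) (hg : AnalyticAt ℂ g 0)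
    (he : ∀ᶠ s in 𝓝 0, f (-s) = f s) (n : ℕ) :
    taylorCoeff (fun s => f s * g s) (2 * n) =
      ∑ k ∈ Finset.range (n + 1), taylorCoeff f (2 * k) * taylorCoeff g (2 * (n - k)) := by
  rw [taylorCoeff_even_mul hf hg he, Nat.mul_div_cancel_left n two_pos]
  exact Finset.sum_congr rfl fun k _ => by rw [Nat.mul_sub]

/-! ### Residues in a local coordinate -/

theorem hasRes_logDeriv {s : ℂ → ℂ} {α : ℂ} (hs : AnalyticAt ℂ s α) (h0 : s α = 0)
    (h1 : deriv s α ≠ 0) : HasRes (fun w => (s w)⁻¹ * deriv s w) α 1 := by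
  set h := dslope s α with hh
  have ha : AnalyticAt ℂ h α := analyticAt_dslope hs
  have hα : h α ≠ 0 := by rwa [hh, dslope_same]
  have hs' : s = fun w => (w - α) * h w := by
    funext w
    have := sub_smul_dslope s α w
    rw [h0, sub_zero, smul_eq_mul] at this
    exact this.symm
  have hne : ∀ᶠ w in 𝓝 α, h w ≠ 0 := ha.continuousAt.eventually_ne hα
  have hsum := (hasRes_sub_inv α).add (hasRes_of_analyticAt (ha.deriv.div ha hα))
  rw [add_zero] at hsum
  refine hsum.congr ?_
  filter_upwards [self_mem_nhdsWithin, nhdsWithin_le_nhds hne,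
    nhdsWithin_le_nhds ha.eventually_analyticAt] with w hw hw1 hw2
  have hw' : w - α ≠ 0 := sub_ne_zero.mpr hw
  have hd : deriv s w = h w + (w - α) * deriv h w := by
    rw [hs']
    have := ((hasDerivAt_id w).sub_const α).mul hw2.differentiableAt.hasDerivAt
    rw [one_mul] at this
    exact this.deriv
  rw [hd, hs', Pi.div_apply]
  field_simp

/-- Induction on `n` with `Θ = Θ 0 + s * dslope Θ 0`. The differential `s ^ (-n-2) ds` is exact, so
only the logarithmic differential `ds / s` contributes in the end. -/
theorem hasRes_local {s : ℂ → ℂ} {α : ℂ} (hs : AnalyticAt ℂ s α) (h0 : s α = 0)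
    (h1 : deriv s α ≠ 0) {Θ : ℂ → ℂ} (hΘ : AnalyticAt ℂ Θ 0) (n : ℕ) :
    HasRes (fun w => (s w ^ (n + 1))⁻¹ * Θ (s w) * deriv s w) α (taylorCoeff Θ n) := by
  have hne : ∀ᶠ w in 𝓝[≠] α, s w ≠ 0 := by
    rcases hs.eventually_eq_zero_or_eventually_ne_zero with h | h
    · exact absurd (by rw [Filter.EventuallyEq.deriv_eq h, deriv_const]) h1
    · exact h
  have hsa := nhdsWithin_le_nhds (s := {α}ᶜ) hs.eventually_analyticAt
  induction n generalizing Θ with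
  | zero =>
    have hd := analyticAt_dslope hΘ
    have hd' : AnalyticAt ℂ (dslope Θ 0 ∘ s) α := AnalyticAt.comp (by rwa [h0]) hs
    have hsum := ((hasRes_logDeriv hs h0 h1).const_mul (Θ 0)).add
      (hasRes_of_analyticAt (hd'.mul hs.deriv))
    rw [mul_one, add_zero] at hsum
    rw [taylorCoeff_zero]
    refine hsum.congr ?_
    filter_upwards [hne] with w hw
    have h2 := sub_smul_dslope Θ 0 (s w)
    rw [sub_zero, smul_eq_mul] at h2
    have h3 : Θ (s w) = Θ 0 + s w * dslope Θ 0 (s w) := by rw [h2]; ring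
    rw [h3, Pi.mul_apply, Function.comp_apply, zero_add, pow_one]
    field_simp
  | succ n ih =>
    have hF : HasRes (fun w => (s w ^ (n + 2))⁻¹ * deriv s w) α 0 := by
      refine hasRes_of_hasDerivAt (F := fun w => -(s w ^ (n + 1))⁻¹ / (n + 1)) ?_ ?_
      · filter_upwards [hne, hsa] with w hw hw2
        exact ((hw2.continuousAt.pow _).inv₀ (pow_ne_zero _ hw)).mul hw2.deriv.continuousAt
      · filter_upwards [hne, hsa] with w hw hw2
        have := (((hw2.differentiableAt.hasDerivAt.pow (n + 1)).inv (pow_ne_zero _ hw)).neg).div_const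
          ((n : ℂ) + 1)
        refine this.congr_deriv ?_
        have hn : (n : ℂ) + 1 ≠ 0 := Nat.cast_add_one_ne_zero n
        push_cast
        simp only [Pi.pow_apply]
        field_simp
        ring
    have hsum := (hF.const_mul (Θ 0)).add (ih (analyticAt_dslope hΘ))
    rw [mul_zero, zero_add, taylorCoeff_dslope hΘ] at hsum
    refine hsum.congr ?_
    filter_upwards [hne] with w hw
    have h2 := sub_smul_dslope Θ 0 (s w)
    rw [sub_zero, smul_eq_mul] at h2
    have h3 : Θ (s w) = Θ 0 + s w * dslope Θ 0 (s w) := by rw [h2]; ring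
    rw [h3]
    field_simp
    ring

/-! ### The basis of differentials with poles at the branch points -/

/-- The polynomials in `u = 1 / (t - 1)` obtained from `u ^ 2` by iterating `f ↦ (t f)'`. -/
def phiPoly : ℕ → Polynomial ℂ
  | 0 => Polynomial.X ^ 2
  | n + 1 => phiPoly n - (Polynomial.X ^ 2 + Polynomial.X) * Polynomial.derivative (phiPoly n)

/-- At `t = exp s` the function `t * phi n t` is the `n`-th derivative in `s` of `exp s / (exp s -
1) ^ 2`. -/
def phi (n : ℕ) (t : ℂ) : ℂ := (phiPoly n).eval (t - 1)⁻¹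

theorem phi_zero (t : ℂ) : phi 0 t = ((t - 1) ^ 2)⁻¹ := by simp [phi, phiPoly]

theorem differentiableAt_phi (n : ℕ) {t : ℂ} (ht : t ≠ 1) : DifferentiableAt ℂ (phi n) t := by
  have : t - 1 ≠ 0 := sub_ne_zero.mpr ht
  exact ((phiPoly n).differentiableAt).comp t ((differentiableAt_id.sub_const 1).inv this)

theorem hasDerivAt_mul_phi (n : ℕ) {t : ℂ} (ht : t ≠ 1) :
    HasDerivAt (fun t => t * phi n t) (phi (n + 1) t) t := by
  have h : t - 1 ≠ 0 := sub_ne_zero.mpr ht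
  have h0 : HasDerivAt (fun t : ℂ => (t - 1)⁻¹) (-1 / (t - 1) ^ 2) t :=
    ((hasDerivAt_id t).sub_const 1).inv h
  have h1 : HasDerivAt (phi n)
      ((Polynomial.derivative (phiPoly n)).eval (t - 1)⁻¹ * (-1 / (t - 1) ^ 2)) t :=
    HasDerivAt.comp (h₂ := fun u => (phiPoly n).eval u) t ((phiPoly n).hasDerivAt (t - 1)⁻¹) h0
  refine ((hasDerivAt_id t).mul h1).congr_deriv ?_
  simp only [phi, phiPoly, Polynomial.eval_sub, Polynomial.eval_mul, Polynomial.eval_add,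
    Polynomial.eval_pow, Polynomial.eval_X, id]
  field_simp
  ring

/-- The basis differentials; `basis (a, l)` has its only pole, of order `2 * l + 2`, at the branch
point `sg a`. -/
def basis (j : Mode) (z : ℂ) : ℂ := sg j.1 * phi (2 * j.2) (sg j.1 * z) / (2 * j.2).factorial

/-- The covector of the values of the basis differentials at `z`. -/
def ev (z : ℂ) : Mode → ℂ := fun j => basis j z

/-- `z * phi n z` for `z = sg a * sg b * exp s`. -/
def expPhi (a b : Bool) (n : ℕ) (s : ℂ) : ℂ :=
  sg a * sg b * Complex.exp s * phi n (sg a * sg b * Complex.exp s)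

theorem hasDerivAt_expPhi (a b : Bool) (n : ℕ) {s : ℂ} (hs : sg a * sg b * Complex.exp s ≠ 1) :
    HasDerivAt (expPhi a b n) (expPhi a b (n + 1) s) s := by
  have h1 : HasDerivAt (fun s => sg a * sg b * Complex.exp s) (sg a * sg b * Complex.exp s) s :=
    (Complex.hasDerivAt_exp s).const_mul _
  refine (HasDerivAt.comp s (hasDerivAt_mul_phi n hs) h1).congr_deriv ?_
  rw [expPhi]; ring

theorem eventually_sg_mul_exp_ne_one (a b : Bool) :
    ∀ᶠ s in 𝓝[≠] (0 : ℂ), sg a * sg b * Complex.exp s ≠ 1 := by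
  have hd : HasDerivAt (fun s => sg a * sg b * Complex.exp s) (sg a * sg b * Complex.exp 0) 0 :=
    (Complex.hasDerivAt_exp 0).const_mul _
  exact hd.eventually_ne (mul_ne_zero (mul_ne_zero (sg_ne_zero a) (sg_ne_zero b))
    (Complex.exp_ne_zero 0))

/-- The function is `1 / (4 sinh² (s/2))` for equal branch points and `-1 / (4 cosh² (s/2))` for
different ones. -/
theorem expPhi_zero_neg (a b : Bool) (s : ℂ) : expPhi a b 0 (-s) = expPhi a b 0 s := by
  have h : (sg a * sg b) ^ 2 = 1 := by
    rw [mul_pow, sq, sq, sg_mul_self, sg_mul_self, one_mul]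
  simp only [expPhi, phi_zero, Complex.exp_neg]
  generalize sg a * sg b = c at h ⊢
  have he := Complex.exp_ne_zero s
  have h3 : c * (Complex.exp s)⁻¹ - 1 = -(c * Complex.exp s - 1) * c * (Complex.exp s)⁻¹ := by
    field_simp
    linear_combination Complex.exp s * h
  by_cases h1 : c * Complex.exp s - 1 = 0
  · rw [h3, h1]; simp
  · have hc : c ≠ 0 := by intro hc; simp [hc] at h
    rw [h3]
    have h4 : (-(c * Complex.exp s - 1) * c * (Complex.exp s)⁻¹) ^ 2 =
      (c * Complex.exp s - 1) ^ 2 * (Complex.exp s)⁻¹ ^ 2 := by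
      linear_combination (c * Complex.exp s - 1) ^ 2 * (Complex.exp s)⁻¹ ^ 2 * h
    rw [h4]
    field_simp

/-- The regular part of `expPhi a b 0`. -/
def regularPart (a b : Bool) : ℂ → ℂ :=
  -- The inner function is `s² exp s / (exp s - 1)²`, even with value `1` at the origin; two
  -- difference quotients remove the pole `1 / s²`.
  if a = b then dslope (dslope (fun s => Complex.exp s / dslope Complex.exp 0 s ^ 2) 0) 0
  else fun s => -Complex.exp s / (Complex.exp s + 1) ^ 2

theorem regularPart_comm (a b : Bool) : regularPart a b = regularPart b a := by
  unfold regularPart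
  by_cases h : a = b
  · rw [if_pos h, if_pos h.symm]
  · rw [if_neg h, if_neg (Ne.symm h)]

theorem analyticAt_exp_div : AnalyticAt ℂ (fun s => Complex.exp s / dslope Complex.exp 0 s ^ 2) 0 := by
  have h : AnalyticAt ℂ Complex.exp 0 := analyticAt_cexp
  refine h.div ((analyticAt_dslope h).pow 2) (pow_ne_zero _ ?_)
  rw [dslope_same, Complex.deriv_exp]
  exact Complex.exp_ne_zero 0

theorem analyticAt_regularPart (a b : Bool) : AnalyticAt ℂ (regularPart a b) 0 := by
  have h : AnalyticAt ℂ Complex.exp 0 := analyticAt_cexp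
  unfold regularPart
  split_ifs
  · exact analyticAt_dslope (analyticAt_dslope analyticAt_exp_div)
  · refine h.neg.div ((h.add analyticAt_const).pow 2) (pow_ne_zero _ ?_)
    norm_num

theorem sg_mul_of_ne {a b : Bool} (h : a ≠ b) : sg a * sg b = -1 := by
  cases a <;> cases b <;> simp_all [sg]

theorem expPhi_zero_eventually (a b : Bool) : ∀ᶠ s in 𝓝[≠] (0 : ℂ),
    expPhi a b 0 s = (if a = b then (s ^ 2)⁻¹ else 0) + regularPart a b s := by
  by_cases hab : a = b
  · subst hab
    set k : ℂ → ℂ := fun s => Complex.exp s / dslope Complex.exp 0 s ^ 2 with hk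
    have hexp (s : ℂ) : s * dslope Complex.exp 0 s = Complex.exp s - 1 := by
      have := sub_smul_dslope Complex.exp 0 s
      rwa [sub_zero, smul_eq_mul, Complex.exp_zero] at this
    have h1 (s : ℂ) (hs : s ≠ 0) : expPhi a a 0 s = (s ^ 2)⁻¹ * k s := by
      simp only [expPhi, sg_mul_self, one_mul, phi_zero, ← hexp, hk, mul_pow, mul_inv]
      ring
    have hk0 : k 0 = 1 := by simp [hk, dslope_same, Complex.deriv_exp]
    have heven : ∀ᶠ s in 𝓝 (0 : ℂ), k (-s) = k s := by
      refine Filter.Eventually.of_forall fun s => ?_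
      by_cases hs : s = 0
      · simp [hs]
      · have e := expPhi_zero_neg a a s
        rw [h1 _ hs, h1 _ (neg_ne_zero.mpr hs), neg_sq] at e
        exact mul_left_cancel₀ (inv_ne_zero (pow_ne_zero 2 hs)) e
    have hka : AnalyticAt ℂ k 0 := analyticAt_exp_div
    -- Evenness excludes a term `1 / s`.
    have hk1 : dslope k 0 0 = 0 := by
      have h2 := taylorCoeff_eq_zero_of_even heven odd_one
      rwa [show 1 = 0 + 1 from rfl, ← taylorCoeff_dslope hka, taylorCoeff_zero] at h2
    filter_upwards [self_mem_nhdsWithin] with s hs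
    have hs' : s ≠ 0 := hs
    have e1 := sub_smul_dslope k 0 s
    have e2 := sub_smul_dslope (dslope k 0) 0 s
    rw [sub_zero, smul_eq_mul, hk0] at e1
    rw [sub_zero, smul_eq_mul, hk1, sub_zero] at e2
    rw [h1 s hs', if_pos rfl, regularPart, if_pos rfl]
    rw [← e2] at e1
    have e3 : k s = 1 + s ^ 2 * dslope (dslope k 0) 0 s := by linear_combination -e1
    rw [e3, ← hk]
    field_simp
  · refine Filter.Eventually.of_forall fun s => ?_
    rw [if_neg hab, zero_add, regularPart, if_neg hab, expPhi, sg_mul_of_ne hab, phi_zero,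
      div_eq_mul_inv]
    congr 2
    · ring
    · ring

theorem eventually_punctured_nhds {P : ℂ → Prop} {a : ℂ} (h : ∀ᶠ x in 𝓝[≠] a, P x) :
    ∀ᶠ y in 𝓝[≠] a, ∀ᶠ x in 𝓝 y, P x := by
  filter_upwards [eventually_eventually_nhdsWithin.mpr h, self_mem_nhdsWithin] with y hy hya
  rwa [IsOpen.nhdsWithin_eq isOpen_compl_singleton hya] at hy

theorem eventually_iteratedDeriv_analyticAt {f : ℂ → ℂ} {a : ℂ} (hf : AnalyticAt ℂ f a) (n : ℕ) :
    AnalyticAt ℂ (iteratedDeriv n f) a := by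
  rw [iteratedDeriv_eq_iterate]
  exact hf.iterated_deriv n

theorem expPhi_eventually (a b : Bool) (n : ℕ) : ∀ᶠ s in 𝓝[≠] (0 : ℂ),
    expPhi a b n s = (if a = b then (-1) ^ n * (n + 1).factorial * (s ^ (n + 2))⁻¹ else 0) +
      iteratedDeriv n (regularPart a b) s := by
  induction n with
  | zero => simpa using expPhi_zero_eventually a b
  | succ n ih =>
    have hr := eventually_iteratedDeriv_analyticAt (analyticAt_regularPart a b) n
    filter_upwards [eventually_punctured_nhds ih, eventually_sg_mul_exp_ne_one a b,
      self_mem_nhdsWithin, nhdsWithin_le_nhds hr.eventually_analyticAt] with s h1 h2 h3 h4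
    have h3' : s ≠ 0 := h3
    have d1 := hasDerivAt_expPhi a b n h2
    have d2 : HasDerivAt (fun s : ℂ => (if a = b then (-1) ^ n * ((n + 1).factorial : ℂ) *
        (s ^ (n + 2))⁻¹ else 0) + iteratedDeriv n (regularPart a b) s)
        ((if a = b then (-1) ^ (n + 1) * ((n + 1 + 1).factorial : ℂ) * (s ^ (n + 1 + 2))⁻¹ else 0) +
          iteratedDeriv (n + 1) (regularPart a b) s) s := by
      refine HasDerivAt.add ?_ ?_
      · split_ifs
        · have := ((hasDerivAt_id s).pow (n + 2)).inv (pow_ne_zero _ h3')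
          refine (this.const_mul ((-1) ^ n * ((n + 1).factorial : ℂ))).congr_deriv ?_
          rw [Nat.factorial_succ (n + 1)]
          simp only [id, Pi.pow_apply]
          push_cast
          field_simp
          ring
        · exact hasDerivAt_const _ _
      · rw [iteratedDeriv_succ]
        exact h4.differentiableAt.hasDerivAt
    exact d1.unique (d2.congr_of_eventuallyEq h1)

theorem tendsto_neg_punctured : Filter.Tendsto (fun s : ℂ => -s) (𝓝[≠] 0) (𝓝[≠] 0) := by
  refine tendsto_nhdsWithin_iff.mpr ⟨?_, ?_⟩
  · have : Filter.Tendsto (fun s : ℂ => -s) (𝓝 0) (𝓝 (-0)) := continuous_neg.tendsto 0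
    rw [neg_zero] at this
    exact this.mono_left nhdsWithin_le_nhds
  · filter_upwards [self_mem_nhdsWithin] with s hs
    exact neg_ne_zero.mpr hs

theorem regularPart_even (a b : Bool) : ∀ᶠ s in 𝓝 (0 : ℂ), regularPart a b (-s) = regularPart a b s := by
  have h := expPhi_zero_eventually a b
  have h2 : ∀ᶠ s in 𝓝[≠] (0 : ℂ), regularPart a b (-s) = regularPart a b s := by
    filter_upwards [h, tendsto_neg_punctured.eventually h] with s h1 h2
    rw [expPhi_zero_neg, neg_sq, h1] at h2
    exact (add_left_cancel h2).symm
  rw [eventually_nhdsWithin_iff] at h2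
  filter_upwards [h2] with s hs
  by_cases h0 : s = 0
  · simp [h0]
  · exact hs h0

/-- The regular part of `basis j` in the coordinate `s` at the branch point `sg a`. -/
def regBasis (a : Bool) (j : Mode) (s : ℂ) : ℂ :=
  iteratedDeriv (2 * j.2) (regularPart a j.1) s / (2 * j.2).factorial

theorem analyticAt_regBasis (a : Bool) (j : Mode) : AnalyticAt ℂ (regBasis a j) 0 :=
  (eventually_iteratedDeriv_analyticAt (analyticAt_regularPart a j.1) _).div_const

theorem regBasis_even (a : Bool) (j : Mode) : ∀ᶠ s in 𝓝 (0 : ℂ), regBasis a j (-s) = regBasis a j s := by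
  filter_upwards [(regularPart_even a j.1).eventually_nhds] with s hs
  have h := Filter.EventuallyEq.iteratedDeriv_eq (2 * j.2) hs
  rw [iteratedDeriv_comp_neg, (even_two_mul j.2).neg_one_pow, one_smul] at h
  rw [regBasis, h, regBasis]

/-- The Taylor coefficients of the regular parts of the basis differentials. -/
def regCoeff (i j : Mode) : ℂ := taylorCoeff (regBasis i.1 j) (2 * i.2)

/-- Up to factorials this is the derivative of total order `2 * i.2 + 2 * j.2` at the origin of one
function, `regularPart`, which is symmetric in the branch points. It reflects the symmetry of the
Bergmann kernel. -/
theorem regCoeff_symm (i j : Mode) : regCoeff i j = regCoeff j i := by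
  have h (i j : Mode) : regCoeff i j = iteratedDeriv (2 * i.2 + 2 * j.2) (regularPart i.1 j.1) 0 /
      ((2 * i.2).factorial * (2 * j.2).factorial) := by
    have e : regBasis i.1 j = fun s => ((2 * j.2).factorial : ℂ)⁻¹ *
        iteratedDeriv (2 * j.2) (regularPart i.1 j.1) s := by
      funext s; rw [regBasis, div_eq_inv_mul]
    rw [regCoeff, e, taylorCoeff_const_mul _
      (eventually_iteratedDeriv_analyticAt (analyticAt_regularPart _ _) _), taylorCoeff]
    rw [iteratedDeriv_eq_iterate, iteratedDeriv_eq_iterate, iteratedDeriv_eq_iterate,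
      ← Function.iterate_add_apply]
    field_simp
  rw [h, h, regularPart_comm, add_comm, mul_comm ((2 * i.2).factorial : ℂ)]

/-- The coefficient of the polar part of `basis j` at the branch point `sg a`. -/
def polarCoeff (a : Bool) (j : Mode) : ℂ := if j.1 = a then 2 * (j.2 : ℂ) + 1 else 0

theorem sg_exp_mul_basis (a : Bool) (j : Mode) : ∀ᶠ s in 𝓝[≠] (0 : ℂ),
    sg a * Complex.exp s * basis j (sg a * Complex.exp s) =
      polarCoeff a j * (s ^ (2 * (j.2 + 1)))⁻¹ + regBasis a j s := by
  filter_upwards [expPhi_eventually a j.1 (2 * j.2)] with s hs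
  have e : sg a * Complex.exp s * basis j (sg a * Complex.exp s) =
      expPhi a j.1 (2 * j.2) s / (2 * j.2).factorial := by
    rw [basis, expPhi, show sg j.1 * (sg a * Complex.exp s) = sg a * sg j.1 * Complex.exp s by ring]
    ring
  have hf : ((2 * j.2).factorial : ℂ) ≠ 0 := Nat.cast_ne_zero.mpr (Nat.factorial_ne_zero _)
  rw [e, hs, regBasis, add_div, polarCoeff, (even_two_mul j.2).neg_one_pow]
  congr 1
  by_cases h : a = j.1
  · rw [if_pos h, if_pos h.symm, Nat.factorial_succ, show 2 * j.2 + 2 = 2 * (j.2 + 1) by ring]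
    push_cast
    field_simp
  · rw [if_neg h, if_neg (Ne.symm h)]
    simp

/-! ### The local coordinate -/

/-- The local coordinate `s` at the branch point `sg a`, with `w = sg a * exp s`. -/
def localCoord (a : Bool) (w : ℂ) : ℂ := Complex.log (sg a * w)

theorem localCoord_sg (a : Bool) : localCoord a (sg a) = 0 := by
  rw [localCoord, sg_mul_self, Complex.log_one]

theorem hasDerivAt_localCoord (a : Bool) {w : ℂ} (hw : sg a * w ∈ Complex.slitPlane) :
    HasDerivAt (localCoord a) w⁻¹ w := by
  have hw0 : w ≠ 0 := fun h => Complex.slitPlane_ne_zero hw (by rw [h, mul_zero])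
  refine (((hasDerivAt_id w).const_mul (sg a)).clog hw).congr_deriv ?_
  have := sg_ne_zero a
  simp only [id]
  field_simp

theorem eventually_slitPlane (a : Bool) : ∀ᶠ w in 𝓝 (sg a), sg a * w ∈ Complex.slitPlane := by
  have hc : ContinuousAt (fun w => sg a * w) (sg a) := by fun_prop
  refine hc.eventually (Complex.isOpen_slitPlane.mem_nhds ?_)
  change sg a * sg a ∈ _
  rw [sg_mul_self]
  exact Complex.one_mem_slitPlane

theorem analyticAt_localCoord (a : Bool) : AnalyticAt ℂ (localCoord a) (sg a) := by
  refine AnalyticAt.clog (analyticAt_const.mul analyticAt_id) ?_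
  rw [sg_mul_self]
  exact Complex.one_mem_slitPlane

theorem deriv_localCoord_ne_zero (a : Bool) : deriv (localCoord a) (sg a) ≠ 0 := by
  rw [(hasDerivAt_localCoord a (eventually_slitPlane a).self_of_nhds).deriv]
  exact inv_ne_zero (sg_ne_zero a)

theorem sg_mul_exp_localCoord (a : Bool) {w : ℂ} (hw : w ≠ 0) :
    sg a * Complex.exp (localCoord a w) = w := by
  rw [localCoord, Complex.exp_log (mul_ne_zero (sg_ne_zero a) hw), ← mul_assoc, sg_mul_self, one_mul]

theorem sg_mul_exp_neg_localCoord (a : Bool) {w : ℂ} (hw : w ≠ 0) :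
    sg a * Complex.exp (-localCoord a w) = w⁻¹ := by
  rw [localCoord, Complex.exp_neg, Complex.exp_log (mul_ne_zero (sg_ne_zero a) hw), mul_inv,
    ← mul_assoc, mul_inv_cancel₀ (sg_ne_zero a), one_mul]

theorem tendsto_localCoord (a : Bool) :
    Filter.Tendsto (localCoord a) (𝓝[≠] (sg a)) (𝓝[≠] 0) := by
  refine tendsto_nhdsWithin_iff.mpr ⟨?_, ?_⟩
  · have := (analyticAt_localCoord a).continuousAt.tendsto
    rw [localCoord_sg] at this
    exact this.mono_left nhdsWithin_le_nhds
  · have hne : ∀ᶠ w in 𝓝[≠] (sg a), w ≠ 0 :=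
      nhdsWithin_le_nhds (continuousAt_id.eventually_ne (sg_ne_zero a))
    filter_upwards [self_mem_nhdsWithin, hne] with w hw h0 h1
    refine hw ?_
    have := sg_mul_exp_localCoord a h0
    rw [Set.mem_singleton_iff.mp h1, Complex.exp_zero, mul_one] at this
    exact this.symm

theorem eventually_ne_zero (a : Bool) : ∀ᶠ w in 𝓝[≠] (sg a), w ≠ 0 :=
  nhdsWithin_le_nhds (continuousAt_id.eventually_ne (sg_ne_zero a))

/-- The local expansion of `basis j` at the branch point `sg a`. -/
def localBasis (a : Bool) (j : Mode) (s : ℂ) : ℂ :=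
  polarCoeff a j * (s ^ (2 * (j.2 + 1)))⁻¹ + regBasis a j s

theorem mul_basis_eventually (a : Bool) (j : Mode) : ∀ᶠ w in 𝓝[≠] (sg a),
    w * basis j w = localBasis a j (localCoord a w) ∧
      w⁻¹ * basis j w⁻¹ = localBasis a j (localCoord a w) := by
  have h1 := sg_exp_mul_basis a j
  have h2 := tendsto_neg_punctured.eventually h1
  have h3 := nhdsWithin_le_nhds (s := {(0 : ℂ)}ᶜ) (regBasis_even a j)
  filter_upwards [(tendsto_localCoord a).eventually h1, (tendsto_localCoord a).eventually h2,
    (tendsto_localCoord a).eventually h3, eventually_ne_zero a] with w h1 h2 h3 h0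
  rw [sg_mul_exp_localCoord a h0] at h1
  rw [sg_mul_exp_neg_localCoord a h0, h3, (even_two_mul _).neg_pow] at h2
  exact ⟨h1, h2⟩

/-! ### Local expansion of the recursion kernel -/

/-- The recursion kernel with the factor of the pullback by `hat`. -/
def kernelForm (z₀ w : ℂ) : ℂ := kernel lnBranch z₀ w * deriv hat w

/-- The integral of the Bergmann kernel contributes the factor `w - 1/w`, which cancels against `w
x'(w)`, and `2 (y(w) - y(ŵ)) = 4 s`. What remains besides `ds / s` is this function, invariant under
the involution. -/
def kernelPsi (a : Bool) (z₀ s : ℂ) : ℂ :=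
  (4 * ((z₀ - sg a * Complex.exp s) * (z₀ - sg a * Complex.exp (-s))))⁻¹

theorem kernelPsi_even (a : Bool) (z₀ s : ℂ) : kernelPsi a z₀ (-s) = kernelPsi a z₀ s := by
  rw [kernelPsi, kernelPsi, neg_neg, mul_comm (z₀ - _)]

theorem analyticAt_exp_neg : AnalyticAt ℂ (fun s : ℂ => Complex.exp (-s)) 0 := by
  exact analyticAt_id.neg.cexp

theorem analyticAt_kernelPsi {a : Bool} {z₀ : ℂ} (hz : z₀ ≠ sg a) : AnalyticAt ℂ (kernelPsi a z₀) 0 := by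
  refine AnalyticAt.inv (analyticAt_const.mul
    ((analyticAt_const.sub (analyticAt_const.mul analyticAt_cexp)).mul
      (analyticAt_const.sub (analyticAt_const.mul analyticAt_exp_neg)))) ?_
  simp only [Complex.exp_zero, neg_zero, mul_one]
  exact mul_ne_zero (by norm_num) (mul_ne_zero (sub_ne_zero.mpr hz) (sub_ne_zero.mpr hz))

/-- Near a branch point `w` and `1/w` lie in the same half plane, so the additive constant of the
branch cancels. -/
theorem lnBranch_eventually (a : Bool) : ∀ᶠ w in 𝓝 (sg a),
    lnBranch w - lnBranch (hat w) = 2 * localCoord a w := by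
  have hre : ∀ᶠ w in 𝓝 (sg a), 0 < (sg a * w).re := by
    have hc : ContinuousAt (fun w => (sg a * w).re) (sg a) := by fun_prop
    exact hc.eventually (lt_mem_nhds (by simp [sg_mul_self]))
  filter_upwards [hre] with w hw
  have harg : (sg a * w).arg ≠ Real.pi := fun h => by
    have := Complex.mem_slitPlane_iff_arg.mp (Or.inl hw : sg a * w ∈ Complex.slitPlane)
    exact this.1 h
  have hw0 : w ≠ 0 := by rintro rfl; simp at hw
  have hlog := Complex.log_inv _ harg
  have hinv : 0 < ((sg a * w)⁻¹).re := by
    rw [Complex.inv_re]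
    exact div_pos hw (Complex.normSq_pos.mpr (mul_ne_zero (sg_ne_zero a) hw0))
  unfold localCoord hat lnBranch
  cases a
  · simp only [sg, neg_mul, one_mul, Bool.false_eq_true, if_false, Complex.neg_re] at hw hlog hinv ⊢
    rw [inv_neg] at hlog hinv
    rw [Complex.neg_re] at hinv
    rw [if_neg (by linarith), if_neg (by linarith), hlog]
    ring
  · simp only [sg, one_mul, if_true] at hw hlog hinv ⊢
    rw [if_pos hw, if_pos hinv, hlog]
    ring

theorem kernelForm_eventually {a : Bool} {z₀ : ℂ} (hz : z₀ ≠ sg a) : ∀ᶠ w in 𝓝[≠] (sg a),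
    kernelForm z₀ w = (localCoord a w)⁻¹ * kernelPsi a z₀ (localCoord a w) *
      deriv (localCoord a) w := by
  have hne : ∀ᶠ w in 𝓝[≠] (sg a), localCoord a w ≠ 0 :=
    (tendsto_localCoord a).eventually self_mem_nhdsWithin
  have hz1 : ∀ᶠ w in 𝓝 (sg a), w ≠ z₀ := continuousAt_id.eventually_ne hz.symm
  have hz2 : ∀ᶠ w in 𝓝 (sg a), w⁻¹ ≠ z₀ := by
    refine (continuousAt_inv₀ (sg_ne_zero a)).eventually_ne ?_
    rw [inv_eq_of_mul_eq_one_left (sg_mul_self a)]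
    exact hz.symm
  have hsq : ∀ᶠ w in 𝓝[≠] (sg a), w ^ 2 ≠ 1 := by
    have h1 : ∀ᶠ w in 𝓝 (sg a), w ≠ -sg a := by
      refine continuousAt_id.eventually_ne ?_
      cases a <;> simp [sg] <;> norm_num
    filter_upwards [self_mem_nhdsWithin, nhdsWithin_le_nhds h1] with w h2 h3 h4
    have : (w - sg a) * (w + sg a) = 0 := by linear_combination h4 - sg_mul_self a
    rcases mul_eq_zero.mp this with h | h
    · exact h2 (sub_eq_zero.mp h)
    · exact h3 (eq_neg_of_add_eq_zero_left h)
  filter_upwards [hne, hsq, eventually_ne_zero a, nhdsWithin_le_nhds hz1, nhdsWithin_le_nhds hz2,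
    nhdsWithin_le_nhds (lnBranch_eventually a), nhdsWithin_le_nhds (eventually_slitPlane a)]
    with w h1 h2 h3 h4 h5 h6 h7
  have hx : deriv curveX w = 1 - (w ^ 2)⁻¹ := by
    have : HasDerivAt curveX (1 + -(w ^ 2)⁻¹) w := (hasDerivAt_id w).add (hasDerivAt_inv h3)
    rw [this.deriv]; ring
  have hh : deriv hat w = -(w ^ 2)⁻¹ := (hasDerivAt_inv h3).deriv
  rw [kernelForm, kernel, h6, hx, hh, (hasDerivAt_localCoord a h7).deriv, kernelPsi,
    sg_mul_exp_localCoord a h3, sg_mul_exp_neg_localCoord a h3, bergmannIntegral, hat]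
  have h4' : z₀ - w ≠ 0 := sub_ne_zero.mpr h4.symm
  have h5' : z₀ - w⁻¹ ≠ 0 := sub_ne_zero.mpr h5.symm
  have h2' : w ^ 2 - 1 ≠ 0 := sub_ne_zero.mpr h2
  have h5'' : z₀ * w - 1 ≠ 0 := by
    intro h; apply h5'; rw [show z₀ - w⁻¹ = (z₀ * w - 1) * w⁻¹ by field_simp, h, zero_mul]
  field_simp
  ring

/-- Near the branch point `sg a` the function `κ` is `Ψ (s) / s * ds / dw`, with `Ψ` even. -/
structure IsLocalKernel (a : Bool) (κ Ψ : ℂ → ℂ) : Prop where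
  analyticAt : AnalyticAt ℂ Ψ 0
  even : ∀ᶠ s in 𝓝 0, Ψ (-s) = Ψ s
  eventually : ∀ᶠ w in 𝓝[≠] (sg a), κ w = (localCoord a w)⁻¹ * Ψ (localCoord a w) *
    deriv (localCoord a) w

theorem isLocalKernel_kernelForm {a : Bool} {z₀ : ℂ} (hz : z₀ ≠ sg a) :
    IsLocalKernel a (kernelForm z₀) (kernelPsi a z₀) :=
  ⟨analyticAt_kernelPsi hz, Filter.Eventually.of_forall (kernelPsi_even a z₀),
    kernelForm_eventually hz⟩

/-- The Taylor coefficients of an even function. -/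
def evenCoeff (Ψ : ℂ → ℂ) (k : ℕ) : ℂ := taylorCoeff Ψ (2 * k)

/-- The even Taylor coefficients of the recursion kernel. -/
def eta (z₀ : ℂ) (i : Mode) : ℂ := evenCoeff (kernelPsi i.1 z₀) i.2

/-- An even kernel pairs only with even coefficients. The kernel is kept general because the same
residues are needed for `kernelForm` in the recursion and for `stringKernel` in the string and
divisor equations. -/
theorem hasRes_kernel {a : Bool} {κ Ψ : ℂ → ℂ} (hκ : IsLocalKernel a κ Ψ) {Θ : ℂ → ℂ}
    (hΘ : AnalyticAt ℂ Θ 0) (n : ℕ) :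
    HasRes (fun w => κ w * ((localCoord a w ^ (2 * n))⁻¹ * Θ (localCoord a w)))
      (sg a) (∑ k ∈ Finset.range (n + 1), evenCoeff Ψ k * taylorCoeff Θ (2 * (n - k))) := by
  have h := hasRes_local (analyticAt_localCoord a) (localCoord_sg a) (deriv_localCoord_ne_zero a)
    (hκ.analyticAt.mul hΘ) (2 * n)
  have e := taylorCoeff_mul_even hκ.analyticAt hΘ hκ.even n
  change taylorCoeff (Ψ * Θ) (2 * n) = _ at e
  rw [e] at h
  refine h.congr ?_
  filter_upwards [hκ.eventually] with w hw
  rw [hw, Pi.mul_apply]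
  ring

/-! ### The Bergmann kernel -/

def bergLocal (a : Bool) (z s : ℂ) : ℂ := sg a * Complex.exp s / (sg a * Complex.exp s - z) ^ 2

def bergEven (a : Bool) (z s : ℂ) : ℂ := bergLocal a z s + bergLocal a z (-s)

theorem analyticAt_bergLocal {a : Bool} {z : ℂ} (hz : z ≠ sg a) : AnalyticAt ℂ (bergLocal a z) 0 := by
  refine (analyticAt_const.mul analyticAt_cexp).div
    (((analyticAt_const.mul analyticAt_cexp).sub analyticAt_const).pow 2) (pow_ne_zero _ ?_)
  rw [Complex.exp_zero, mul_one]
  exact sub_ne_zero.mpr hz.symm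

theorem analyticAt_comp_neg {f : ℂ → ℂ} (hf : AnalyticAt ℂ f 0) : AnalyticAt ℂ (fun s => f (-s)) 0 :=
  AnalyticAt.fun_comp (by simpa using hf) analyticAt_id.neg

theorem taylorCoeff_comp_neg (f : ℂ → ℂ) (n : ℕ) :
    taylorCoeff (fun s => f (-s)) n = (-1) ^ n * taylorCoeff f n := by
  rw [taylorCoeff, iteratedDeriv_comp_neg, neg_zero, smul_eq_mul, taylorCoeff, mul_div_assoc]

/-- With `W = sg a * exp s` and `t = z / W` one has `d/ds = -t d/dt`, and the recursion of `phi` is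
`f ↦ (t f)'`. -/
theorem iteratedDeriv_bergLocal {a : Bool} {z : ℂ} (hz : z ≠ sg a) (n : ℕ) : ∀ᶠ s in 𝓝 (0 : ℂ),
    iteratedDeriv n (bergLocal a z) s = (-1) ^ n * ((sg a * Complex.exp s)⁻¹ *
      phi n (z * (sg a * Complex.exp s)⁻¹)) := by
  have hW (s : ℂ) : sg a * Complex.exp s ≠ 0 := mul_ne_zero (sg_ne_zero a) (Complex.exp_ne_zero s)
  have hne : ∀ᶠ s in 𝓝 (0 : ℂ), sg a * Complex.exp s ≠ z := by
    have hc : ContinuousAt (fun s => sg a * Complex.exp s) 0 := by fun_prop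
    refine hc.eventually_ne ?_
    rw [Complex.exp_zero, mul_one]; exact hz.symm
  induction n with
  | zero =>
    filter_upwards [hne] with s hs
    have h1 := hW s
    have h2 : sg a * Complex.exp s - z ≠ 0 := sub_ne_zero.mpr hs
    have h3 : z - sg a * Complex.exp s ≠ 0 := sub_ne_zero.mpr hs.symm
    rw [iteratedDeriv_zero, bergLocal, phi_zero, pow_zero, one_mul]
    generalize sg a * Complex.exp s = W at *
    have h4 : z * W⁻¹ - 1 = (z - W) * W⁻¹ := by field_simp
    rw [h4]
    field_simp
    ring
  | succ n ih =>
    filter_upwards [hne, ih.eventually_nhds] with s hs h1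
    rw [iteratedDeriv_succ, Filter.EventuallyEq.deriv_eq h1]
    have hd : HasDerivAt (fun s => sg a * Complex.exp s) (sg a * Complex.exp s) s :=
      (Complex.hasDerivAt_exp s).const_mul _
    have hd1 := hd.inv (hW s)
    have hd2 : HasDerivAt (fun s => z * (sg a * Complex.exp s)⁻¹) _ s := hd1.const_mul z
    have ht : z * (sg a * Complex.exp s)⁻¹ ≠ 1 := by
      intro h
      exact hs ((mul_inv_eq_one₀ (hW s)).mp h).symm
    have hp := (differentiableAt_phi n ht).hasDerivAt
    have hd3 : HasDerivAt (fun s => phi n (z * (sg a * Complex.exp s)⁻¹)) _ s :=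
      HasDerivAt.comp (h₂ := phi n) s hp hd2
    have hphi : phi (n + 1) (z * (sg a * Complex.exp s)⁻¹) = phi n (z * (sg a * Complex.exp s)⁻¹) +
        z * (sg a * Complex.exp s)⁻¹ * deriv (phi n) (z * (sg a * Complex.exp s)⁻¹) := by
      have := (hasDerivAt_mul_phi n ht).unique ((hasDerivAt_id _).mul hp)
      simpa using this
    have hd4 : HasDerivAt (fun s => (-1) ^ n * ((sg a * Complex.exp s)⁻¹ *
      phi n (z * (sg a * Complex.exp s)⁻¹))) _ s := (hd1.mul hd3).const_mul ((-1) ^ n)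
    rw [hd4.deriv, hphi]
    have hWs := hW s
    simp only [Pi.inv_apply]
    generalize sg a * Complex.exp s = W at *
    field_simp
    ring

/-- The basis differentials in `z` are the even Taylor coefficients of the Bergmann kernel in its
other argument. This is why multiplication by `X (a, m)` represents the insertion of `ω^0_2`. -/
theorem taylorCoeff_bergLocal {a : Bool} {z : ℂ} (hz : z ≠ sg a) (m : ℕ) :
    taylorCoeff (bergLocal a z) (2 * m) = ev z (a, m) := by
  rw [taylorCoeff, (iteratedDeriv_bergLocal hz _).self_of_nhds, Complex.exp_zero, mul_one,
    (even_two_mul m).neg_one_pow, inv_eq_of_mul_eq_one_left (sg_mul_self a), ev, basis, one_mul,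
    mul_comm z]

theorem analyticAt_bergEven {a : Bool} {z : ℂ} (hz : z ≠ sg a) : AnalyticAt ℂ (bergEven a z) 0 :=
  (analyticAt_bergLocal hz).add (analyticAt_comp_neg (analyticAt_bergLocal hz))

theorem taylorCoeff_bergEven {a : Bool} {z : ℂ} (hz : z ≠ sg a) (m : ℕ) :
    taylorCoeff (bergEven a z) (2 * m) = 2 * ev z (a, m) := by
  have h := taylorCoeff_add (analyticAt_bergLocal hz) (analyticAt_comp_neg (analyticAt_bergLocal hz))
    (2 * m)
  rw [taylorCoeff_comp_neg, (even_two_mul m).neg_one_pow, one_mul, taylorCoeff_bergLocal hz] at h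
  rw [two_mul (ev z (a, m)), ← h]
  rfl

/-- The basis differentials in terms of the Taylor coefficients of the kernel. -/
theorem ev_eq_sum_eta {a : Bool} {z : ℂ} (hz : z ≠ sg a) (l : ℕ) :
    ev z (a, l) = ∑ k ∈ Finset.range (l + 1), eta z (a, k) * dualCoeff (a, k) (a, l) := by
  have hP := analyticAt_kernelPsi hz
  have hS : AnalyticAt ℂ (fun s : ℂ => 8 * sg a * Complex.sinh s) 0 := by
    refine analyticAt_const.mul ?_
    exact (Complex.differentiable_sinh.analyticAt 0)
  have hne : ∀ᶠ s in 𝓝 (0 : ℂ), sg a * Complex.exp s ≠ z := by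
    have hc : ContinuousAt (fun s => sg a * Complex.exp s) 0 := by fun_prop
    refine hc.eventually_ne ?_
    rw [Complex.exp_zero, mul_one]; exact hz.symm
  have hne2 : ∀ᶠ s in 𝓝 (0 : ℂ), sg a * Complex.exp (-s) ≠ z := by
    have hc : ContinuousAt (fun s => sg a * Complex.exp (-s)) 0 := by fun_prop
    refine hc.eventually_ne ?_
    rw [neg_zero, Complex.exp_zero, mul_one]; exact hz.symm
  -- The right side is the integral of the Bergmann kernel from `ŵ` to `w`; its derivative in `s` is
  -- `bergEven`, with coefficients twice the basis differentials. The Taylor series of `sinh` then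
  -- produces the factorials of `dualCoeff`.
  have hF : (fun s => kernelPsi a z s * (8 * sg a * Complex.sinh s)) =ᶠ[𝓝 0]
      fun s => (z - sg a * Complex.exp s)⁻¹ - (z - sg a * Complex.exp (-s))⁻¹ := by
    filter_upwards [hne, hne2] with s h1 h2
    have h1' : z - sg a * Complex.exp s ≠ 0 := sub_ne_zero.mpr h1.symm
    have h2' : z - sg a * Complex.exp (-s) ≠ 0 := sub_ne_zero.mpr h2.symm
    rw [kernelPsi, Complex.sinh]
    field_simp
    ring
  have hD : deriv (fun s => kernelPsi a z s * (8 * sg a * Complex.sinh s)) =ᶠ[𝓝 0] bergEven a z := by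
    filter_upwards [hF.eventually_nhds, hne, hne2] with s h0 h1 h2
    have h1' : z - sg a * Complex.exp s ≠ 0 := sub_ne_zero.mpr h1.symm
    have h2' : z - sg a * Complex.exp (-s) ≠ 0 := sub_ne_zero.mpr h2.symm
    have h1'' : sg a * Complex.exp s - z ≠ 0 := sub_ne_zero.mpr h1
    have h2'' : sg a * Complex.exp (-s) - z ≠ 0 := sub_ne_zero.mpr h2
    rw [Filter.EventuallyEq.deriv_eq h0]
    have d1 := (((Complex.hasDerivAt_exp s).const_mul (sg a)).const_sub z).inv h1'
    have d2 := ((((hasDerivAt_neg s).cexp).const_mul (sg a)).const_sub z).inv h2'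
    have d3 : HasDerivAt (fun s => (z - sg a * Complex.exp s)⁻¹ - (z - sg a * Complex.exp (-s))⁻¹)
      _ s := d1.sub d2
    rw [d3.deriv, bergEven, bergLocal, bergLocal]
    rw [← neg_sub z (sg a * Complex.exp s), ← neg_sub z (sg a * Complex.exp (-s)), neg_sq, neg_sq]
    ring
  have h1 : taylorCoeff (bergEven a z) (2 * l) = (2 * l + 1) *
      taylorCoeff (fun s => kernelPsi a z s * (8 * sg a * Complex.sinh s)) (2 * l + 1) := by
    rw [← taylorCoeff_congr hD, taylorCoeff, taylorCoeff, ← iteratedDeriv_succ', Nat.factorial_succ]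
    have : ((2 * l).factorial : ℂ) ≠ 0 := Nat.cast_ne_zero.mpr (Nat.factorial_ne_zero _)
    have h2 : (2 * (l : ℂ) + 1) ≠ 0 := by exact_mod_cast Nat.succ_ne_zero (2 * l)
    generalize iteratedDeriv (2 * l + 1) (fun s => kernelPsi a z s * (8 * sg a * Complex.sinh s)) (0 : ℂ) = D
    push_cast
    field_simp
  have h2 (k : ℕ) : taylorCoeff (fun s => 8 * sg a * Complex.sinh s) (2 * k + 1) =
      8 * sg a / (2 * k + 1).factorial := by
    rw [taylorCoeff_const_mul _ (Complex.differentiable_sinh.analyticAt 0), taylorCoeff,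
      Complex.iteratedDeriv_odd_sinh, Complex.cosh_zero]
    ring
  rw [taylorCoeff_bergEven hz, taylorCoeff_even_mul hP hS
    (Filter.Eventually.of_forall (kernelPsi_even a z)), show (2 * l + 1) / 2 = l by omega] at h1
  rw [← mul_right_inj' (two_ne_zero' ℂ), h1, Finset.mul_sum, Finset.mul_sum]
  refine Finset.sum_congr rfl fun k hk => ?_
  have hk' : k ≤ l := Nat.lt_succ_iff.mp (Finset.mem_range.mp hk)
  rw [show 2 * l + 1 - 2 * k = 2 * (l - k) + 1 by omega, h2, dualCoeff, if_pos ⟨rfl, hk'⟩, eta, evenCoeff]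
  ring

/-! ### Residues of the recursion -/

theorem sum_range_ite_le (η f : ℕ → ℂ) {n M : ℕ} (h : n < M) :
    ∑ k ∈ Finset.range M, η k * (if k ≤ n then f (n - k) else 0) =
      ∑ k ∈ Finset.range (n + 1), η k * f (n - k) := by
  rw [← Finset.sum_subset (Finset.range_subset_range.mpr (Nat.succ_le_of_lt h))]
  · refine Finset.sum_congr rfl fun k hk => ?_
    rw [if_pos (Nat.lt_succ_iff.mp (Finset.mem_range.mp hk))]
  · intro k _ hk
    rw [if_neg fun h => hk (Finset.mem_range.mpr (Nat.lt_succ_of_le h)), mul_zero]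

theorem taylorCoeff_const (c : ℂ) (n : ℕ) : taylorCoeff (fun _ => c) n = if n = 0 then c else 0 := by
  rw [taylorCoeff, iteratedDeriv_const]
  split_ifs with h
  · simp [h]
  · simp

theorem hasRes_kernel_pow {a : Bool} {κ Ψ : ℂ → ℂ} (hκ : IsLocalKernel a κ Ψ) (c : ℂ) (n : ℕ) :
    HasRes (fun w => κ w * (c * (localCoord a w ^ (2 * n))⁻¹)) (sg a)
      (c * evenCoeff Ψ n) := by
  have h := hasRes_kernel hκ (analyticAt_const (v := c)) n
  rw [Finset.sum_eq_single_of_mem n (Finset.self_mem_range_succ n)] at h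
  · rw [Nat.sub_self, mul_zero, taylorCoeff_const, if_pos rfl, mul_comm (evenCoeff _ _)] at h
    refine h.congr (Filter.Eventually.of_forall fun w => ?_)
    rw [mul_comm c]
  · intro k hk hkn
    have := Finset.mem_range.mp hk
    rw [taylorCoeff_const, if_neg (by omega), mul_zero]

theorem hasRes_kernel_zero {a : Bool} {κ Ψ : ℂ → ℂ} (hκ : IsLocalKernel a κ Ψ) {Θ : ℂ → ℂ}
    (hΘ : AnalyticAt ℂ Θ 0) :
    HasRes (fun w => κ w * Θ (localCoord a w)) (sg a) (evenCoeff Ψ 0 * Θ 0) := by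
  have h := hasRes_kernel hκ hΘ 0
  rw [zero_add, Finset.sum_range_one, mul_zero, taylorCoeff_zero] at h
  refine h.congr (Filter.Eventually.of_forall fun w => ?_)
  rw [pow_zero, inv_one, one_mul]

theorem ite_and_le_eq (a : Bool) (j : Mode) (p : ℕ) (r : ℂ) :
    (if j.1 = a ∧ p ≤ j.2 + 1 then (2 * (j.2 : ℂ) + 1) * r else 0) =
      polarCoeff a j * (if p ≤ j.2 + 1 then r else 0) := by
  unfold polarCoeff
  by_cases h1 : j.1 = a <;> by_cases h2 : p ≤ j.2 + 1 <;> simp [h1, h2]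

theorem regBasis_zero (a : Bool) (j : Mode) : regBasis a j 0 = regCoeff (a, 0) j := by
  rw [regCoeff, mul_zero, taylorCoeff_zero]

/-- Both differentials are even in `s` as coefficients of `ds`. The products of polar and regular
parts give the four summands of `virForm`; two regular parts pair only with the constant term of the
kernel. -/
theorem hasRes_basis_basis {a : Bool} {κ Ψ : ℂ → ℂ} (hκ : IsLocalKernel a κ Ψ) (i j : Mode) {M : ℕ}
    (hM : i.2 + j.2 + 3 ≤ M) :
    HasRes (fun w => κ w * (basis i w * basis j (hat w))) (sg a)
      (∑ k ∈ Finset.range M, evenCoeff Ψ k * virForm regCoeff a k i j) := by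
  have h1 := hasRes_kernel_pow hκ (polarCoeff a i * polarCoeff a j) (i.2 + j.2 + 2)
  have h2 := (hasRes_kernel hκ (analyticAt_regBasis a j) (i.2 + 1)).const_mul (polarCoeff a i)
  have h3 := (hasRes_kernel hκ (analyticAt_regBasis a i) (j.2 + 1)).const_mul (polarCoeff a j)
  have h4 := hasRes_kernel_zero hκ ((analyticAt_regBasis a i).mul (analyticAt_regBasis a j))
  have h := ((h2.add h3).add h1).add h4
  have e : ∑ k ∈ Finset.range M, evenCoeff Ψ k * virForm regCoeff a k i j =
      polarCoeff a i * (∑ k ∈ Finset.range (i.2 + 1 + 1), evenCoeff Ψ k *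
        taylorCoeff (regBasis a j) (2 * (i.2 + 1 - k))) +
      polarCoeff a j * (∑ k ∈ Finset.range (j.2 + 1 + 1), evenCoeff Ψ k *
        taylorCoeff (regBasis a i) (2 * (j.2 + 1 - k))) +
      polarCoeff a i * polarCoeff a j * evenCoeff Ψ (i.2 + j.2 + 2) +
      evenCoeff Ψ 0 * (regBasis a i * regBasis a j) 0 := by
    unfold virForm
    simp_rw [mul_add, Finset.sum_add_distrib]
    congr 1
    · congr 1
      · congr 1
        · simp_rw [ite_and_le_eq, mul_left_comm _ (polarCoeff a i), ← Finset.mul_sum]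
          congr 1
          exact sum_range_ite_le (evenCoeff Ψ) (fun k => regCoeff (a, k) j) (by omega)
        · simp_rw [ite_and_le_eq, mul_left_comm _ (polarCoeff a j), ← Finset.mul_sum]
          congr 1
          exact sum_range_ite_le (evenCoeff Ψ) (fun k => regCoeff (a, k) i) (by omega)
      · rw [Finset.sum_eq_single_of_mem (i.2 + j.2 + 2) (Finset.mem_range.mpr (by omega))]
        · unfold polarCoeff
          by_cases h1 : i.1 = a <;> by_cases h2 : j.1 = a <;> simp [h1, h2]; ring
        · intro k _ hk
          rw [if_neg fun h => hk h.2.2.symm, mul_zero]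
    · rw [Finset.sum_eq_single_of_mem 0 (Finset.mem_range.mpr (by omega))]
      · rw [if_pos rfl, Pi.mul_apply, regBasis_zero, regBasis_zero]
      · intro k _ hk
        rw [if_neg hk, mul_zero]
  rw [e]
  refine h.congr ?_
  have hs : ∀ᶠ w in 𝓝[≠] (sg a), localCoord a w ≠ 0 :=
    (tendsto_localCoord a).eventually self_mem_nhdsWithin
  filter_upwards [mul_basis_eventually a i, mul_basis_eventually a j, eventually_ne_zero a, hs]
    with w hi hj hw hs
  have e2 : basis i w * basis j (hat w) = localBasis a i (localCoord a w) *
      localBasis a j (localCoord a w) := by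
    rw [← hi.1, ← hj.2, hat]
    field_simp
  rw [e2, localBasis, localBasis, Pi.mul_apply]
  field_simp
  ring

theorem mul_bergmann_eventually (a : Bool) (z : ℂ) : ∀ᶠ w in 𝓝[≠] (sg a),
    w * bergmann w z = bergLocal a z (localCoord a w) ∧
      w⁻¹ * bergmann w⁻¹ z = bergLocal a z (-localCoord a w) := by
  filter_upwards [eventually_ne_zero a] with w hw
  rw [bergLocal, bergLocal, sg_mul_exp_localCoord a hw, sg_mul_exp_neg_localCoord a hw, bergmann,
    bergmann, mul_one_div, mul_one_div]
  exact ⟨rfl, rfl⟩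

/-- The coefficients are those of the derivative of `virField` along `ev z`, as in
`dirDeriv_virField`. -/
theorem hasRes_bergmann_basis {a : Bool} {κ Ψ : ℂ → ℂ} (hκ : IsLocalKernel a κ Ψ) {z : ℂ} (hz : z ≠ sg a) (j : Mode)
    {M : ℕ} (hM : j.2 + 2 ≤ M) :
    HasRes (fun w => κ w *
        (bergmann w z * basis j (hat w) + basis j w * bergmann (hat w) z)) (sg a)
      (∑ k ∈ Finset.range M, evenCoeff Ψ k *
        ((if j.1 = a ∧ k ≤ j.2 + 1 then 2 * (2 * (j.2 : ℂ) + 1) * ev z (a, j.2 + 1 - k) else 0) +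
          if k = 0 then 2 * regCoeff (a, 0) j * ev z (a, 0) else 0)) := by
  have h1 := (hasRes_kernel hκ (analyticAt_bergEven hz) (j.2 + 1)).const_mul (polarCoeff a j)
  have h2 := hasRes_kernel_zero hκ ((analyticAt_bergEven hz).mul (analyticAt_regBasis a j))
  have h := h1.add h2
  have e : ∑ k ∈ Finset.range M, evenCoeff Ψ k *
        ((if j.1 = a ∧ k ≤ j.2 + 1 then 2 * (2 * (j.2 : ℂ) + 1) * ev z (a, j.2 + 1 - k) else 0) +
          if k = 0 then 2 * regCoeff (a, 0) j * ev z (a, 0) else 0) =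
      polarCoeff a j * (∑ k ∈ Finset.range (j.2 + 1 + 1), evenCoeff Ψ k *
        taylorCoeff (bergEven a z) (2 * (j.2 + 1 - k))) +
      evenCoeff Ψ 0 * (bergEven a z * regBasis a j) 0 := by
    simp_rw [mul_add (evenCoeff _ _), Finset.sum_add_distrib]
    congr 1
    · have h3 (k : ℕ) : (if j.1 = a ∧ k ≤ j.2 + 1 then
          2 * (2 * (j.2 : ℂ) + 1) * ev z (a, j.2 + 1 - k) else 0) =
          polarCoeff a j * (if k ≤ j.2 + 1 then 2 * ev z (a, j.2 + 1 - k) else 0) := by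
        rw [← ite_and_le_eq]
        split_ifs <;> ring
      simp_rw [h3, mul_left_comm _ (polarCoeff a j), ← Finset.mul_sum, taylorCoeff_bergEven hz]
      congr 1
      exact sum_range_ite_le (evenCoeff Ψ) (fun k => 2 * ev z (a, k)) (by omega)
    · rw [Finset.sum_eq_single_of_mem 0 (Finset.mem_range.mpr (by omega))]
      · have := taylorCoeff_bergEven hz 0
        rw [mul_zero, taylorCoeff_zero] at this
        rw [if_pos rfl, Pi.mul_apply, regBasis_zero, this]
        ring
      · intro k _ hk
        rw [if_neg hk, mul_zero]
  rw [e]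
  refine h.congr ?_
  filter_upwards [mul_basis_eventually a j, mul_bergmann_eventually a z, eventually_ne_zero a]
    with w hj hb hw
  have e2 : bergmann w z * basis j (hat w) + basis j w * bergmann (hat w) z =
      bergEven a z (localCoord a w) * localBasis a j (localCoord a w) := by
    rw [bergEven, ← hb.1, ← hb.2, add_mul]
    nth_rewrite 1 [← hj.2]
    rw [← hj.1, hat]
    field_simp
  rw [e2, localBasis, Pi.mul_apply]
  ring

theorem hasRes_bergmann_bergmann {a : Bool} {κ Ψ : ℂ → ℂ} (hκ : IsLocalKernel a κ Ψ) {z₁ z₂ : ℂ} (hz₁ : z₁ ≠ sg a)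
    (hz₂ : z₂ ≠ sg a) :
    HasRes (fun w => κ w *
        (bergmann w z₁ * bergmann (hat w) z₂ + bergmann w z₂ * bergmann (hat w) z₁)) (sg a)
      (evenCoeff Ψ 0 * (2 * ev z₁ (a, 0) * ev z₂ (a, 0))) := by
  have a1 := analyticAt_bergLocal hz₁
  have a2 := analyticAt_bergLocal hz₂
  have h := hasRes_kernel_zero hκ
    ((a1.mul (analyticAt_comp_neg a2)).add (a2.mul (analyticAt_comp_neg a1)))
  have b1 := taylorCoeff_bergLocal hz₁ 0
  have b2 := taylorCoeff_bergLocal hz₂ 0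
  rw [mul_zero, taylorCoeff_zero] at b1 b2
  simp only [Pi.add_apply, Pi.mul_apply, neg_zero, b1, b2] at h
  rw [show 2 * ev z₁ (a, 0) * ev z₂ (a, 0) =
    ev z₁ (a, 0) * ev z₂ (a, 0) + ev z₂ (a, 0) * ev z₁ (a, 0) by ring]
  refine h.congr ?_
  filter_upwards [mul_bergmann_eventually a z₁, mul_bergmann_eventually a z₂, eventually_ne_zero a]
    with w h1 h2 hw
  rw [← h1.1, ← h1.2, ← h2.1, ← h2.2, hat]
  field_simp

/-- In the coordinate `s` the points `w` and `ŵ` differ by `2s`, so the Bergmann kernel is `1 /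
(2s)²` plus `regularPart` at `2s`. The outcome is the constant term of `virConst`. -/
theorem hasRes_bergmann_hat {a : Bool} {κ Ψ : ℂ → ℂ} (hκ : IsLocalKernel a κ Ψ) :
    HasRes (fun w => κ w * bergmann w (hat w)) (sg a)
      (evenCoeff Ψ 0 * regCoeff (a, 0) (a, 0) + evenCoeff Ψ 1 * (1 / 4)) := by
  have hr : AnalyticAt ℂ (fun s => regularPart a a (2 * s)) 0 :=
    AnalyticAt.fun_comp (by simpa using analyticAt_regularPart a a) (analyticAt_const.mul analyticAt_id)
  have h := (hasRes_kernel_zero hκ hr).add (hasRes_kernel_pow hκ (1 / 4) 1)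
  have e : regCoeff (a, 0) (a, 0) = regularPart a a (2 * 0) := by
    rw [← regBasis_zero, regBasis]
    simp
  rw [e, mul_comm (evenCoeff Ψ 1)]
  refine h.congr ?_
  have h2 : Filter.Tendsto (fun s : ℂ => 2 * s) (𝓝[≠] 0) (𝓝[≠] 0) := by
    refine tendsto_nhdsWithin_iff.mpr ⟨?_, ?_⟩
    · have hc : ContinuousAt (fun s : ℂ => 2 * s) 0 := by fun_prop
      have := hc.tendsto
      rw [mul_zero] at this
      exact this.mono_left nhdsWithin_le_nhds
    · filter_upwards [self_mem_nhdsWithin] with s hs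
      exact mul_ne_zero two_ne_zero hs
  have hs : ∀ᶠ w in 𝓝[≠] (sg a), localCoord a w ≠ 0 :=
    (tendsto_localCoord a).eventually self_mem_nhdsWithin
  filter_upwards [(tendsto_localCoord a).eventually (h2.eventually (expPhi_zero_eventually a a)),
    eventually_ne_zero a, hs] with w h3 hw hs
  rw [if_pos rfl, expPhi, sg_mul_self, one_mul, phi_zero] at h3
  have hexp : Complex.exp (2 * localCoord a w) = w ^ 2 := by
    rw [two_mul, Complex.exp_add, ← sq, ← one_mul (Complex.exp _), ← sg_mul_self a, mul_assoc,
      sg_mul_exp_localCoord a hw, mul_pow, sq, sg_mul_self, one_mul]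
  rw [hexp] at h3
  have h4 : bergmann w (hat w) = ((2 * localCoord a w) ^ 2)⁻¹ +
      regularPart a a (2 * localCoord a w) := by
    rw [← h3, bergmann, hat, show w - w⁻¹ = (w ^ 2 - 1) * w⁻¹ by field_simp, mul_pow, one_div, mul_inv,
      inv_pow, inv_inv, mul_comm]
  rw [h4]
  field_simp
  ring

/-! ### The free energy computes the invariants -/

theorem corr_cons_eq_sum (l : Mode → ℂ) (T : Multiset (Mode → ℂ)) {f : Fock} {s : Finset Mode}
    (hs : f.vars ⊆ s) : corr (l ::ₘ T) f = ∑ i ∈ s, l i * corr T (pderiv i f) := by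
  rw [corr_cons, dirDeriv_eq_sum l f hs, corr_sum]
  exact Finset.sum_congr rfl fun i _ => corr_C_mul _ _ _

theorem hasRes_laplacian {a : Bool} {z₀ : ℂ} (hz₀ : z₀ ≠ sg a) (S : Multiset (Mode → ℂ)) {f : Fock}
    {N M : ℕ} (hf : f.vars ⊆ Finset.univ ×ˢ Finset.range N) (hM : 2 * N + 3 ≤ M) :
    HasRes (fun w => kernelForm z₀ w * corr (ev w ::ₘ ev (hat w) ::ₘ S) f) (sg a)
      (∑ k ∈ Finset.range M, eta z₀ (a, k) * corr S (laplacian (virForm regCoeff a k) f)) := by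
  set s : Finset Mode := Finset.univ ×ˢ Finset.range N with hs
  have hmem (i : Mode) (hi : i ∈ s) : i.2 < N := Finset.mem_range.mp (Finset.mem_product.mp hi).2
  have h : HasRes (fun w => ∑ i ∈ s, ∑ j ∈ s, corr S (pderiv i (pderiv j f)) *
      (kernelForm z₀ w * (basis i w * basis j (hat w)))) (sg a)
      (∑ i ∈ s, ∑ j ∈ s, corr S (pderiv i (pderiv j f)) *
        ∑ k ∈ Finset.range M, eta z₀ (a, k) * virForm regCoeff a k i j) :=
    HasRes.sum fun i hi => HasRes.sum fun j hj => (hasRes_basis_basis (isLocalKernel_kernelForm hz₀) i j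
      (by have := hmem i hi; have := hmem j hj; omega)).const_mul _
  have e : ∑ k ∈ Finset.range M, eta z₀ (a, k) * corr S (laplacian (virForm regCoeff a k) f) =
      ∑ i ∈ s, ∑ j ∈ s, corr S (pderiv i (pderiv j f)) *
        ∑ k ∈ Finset.range M, eta z₀ (a, k) * virForm regCoeff a k i j := by
    simp_rw [corr_laplacian S _ hf, Finset.mul_sum]
    rw [Finset.sum_comm]
    refine Finset.sum_congr rfl fun i _ => ?_
    rw [Finset.sum_comm]
    refine Finset.sum_congr rfl fun j _ => Finset.sum_congr rfl fun k _ => ?_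
    ring
  rw [e]
  refine h.congr (Filter.Eventually.of_forall fun w => ?_)
  rw [Multiset.cons_swap, corr_cons_eq_sum _ _ hf, Finset.sum_comm, Finset.mul_sum]
  refine Finset.sum_congr rfl fun j _ => ?_
  rw [corr_cons_eq_sum _ _ ((vars_pderiv_subset j f).trans hf), Finset.mul_sum, Finset.mul_sum]
  refine Finset.sum_congr rfl fun i _ => ?_
  simp only [ev]
  ring

theorem hasRes_gradForm {a : Bool} {z₀ : ℂ} (hz₀ : z₀ ≠ sg a) {n : ℕ} (L : Fin n → Mode → ℂ)
    {f g : Fock} {N M : ℕ} (hf : f.vars ⊆ Finset.univ ×ˢ Finset.range N)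
    (hg : g.vars ⊆ Finset.univ ×ˢ Finset.range N) (hM : 2 * N + 3 ≤ M) :
    HasRes (fun w => kernelForm z₀ w * ∑ I : Finset (Fin n),
        corr (ev w ::ₘ I.val.map L) f * corr (ev (hat w) ::ₘ Iᶜ.val.map L) g) (sg a)
      (∑ k ∈ Finset.range M, eta z₀ (a, k) *
        corr (Finset.univ.val.map L) (gradForm (virForm regCoeff a k) f g)) := by
  set s : Finset Mode := Finset.univ ×ˢ Finset.range N with hs
  have hmem (i : Mode) (hi : i ∈ s) : i.2 < N := Finset.mem_range.mp (Finset.mem_product.mp hi).2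
  have h : HasRes (fun w => ∑ I : Finset (Fin n), ∑ i ∈ s, ∑ j ∈ s,
      (corr (I.val.map L) (pderiv i f) * corr (Iᶜ.val.map L) (pderiv j g)) *
      (kernelForm z₀ w * (basis i w * basis j (hat w)))) (sg a)
      (∑ I : Finset (Fin n), ∑ i ∈ s, ∑ j ∈ s,
        (corr (I.val.map L) (pderiv i f) * corr (Iᶜ.val.map L) (pderiv j g)) *
        ∑ k ∈ Finset.range M, eta z₀ (a, k) * virForm regCoeff a k i j) :=
    HasRes.sum fun I _ => HasRes.sum fun i hi => HasRes.sum fun j hj =>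
      (hasRes_basis_basis (isLocalKernel_kernelForm hz₀) i j
        (by have := hmem i hi; have := hmem j hj; omega)).const_mul _
  have e : ∑ k ∈ Finset.range M, eta z₀ (a, k) *
        corr (Finset.univ.val.map L) (gradForm (virForm regCoeff a k) f g) =
      ∑ I : Finset (Fin n), ∑ i ∈ s, ∑ j ∈ s,
        (corr (I.val.map L) (pderiv i f) * corr (Iᶜ.val.map L) (pderiv j g)) *
        ∑ k ∈ Finset.range M, eta z₀ (a, k) * virForm regCoeff a k i j := by
    simp_rw [corr_gradForm L _ _ hf hg, Finset.powerset_univ, Finset.mul_sum,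
      ← Finset.compl_eq_univ_sdiff]
    rw [Finset.sum_comm]
    refine Finset.sum_congr rfl fun I _ => ?_
    rw [Finset.sum_comm]
    refine Finset.sum_congr rfl fun i _ => ?_
    rw [Finset.sum_comm]
    refine Finset.sum_congr rfl fun j _ => Finset.sum_congr rfl fun k _ => ?_
    ring
  rw [e]
  refine h.congr (Filter.Eventually.of_forall fun w => ?_)
  rw [Finset.mul_sum]
  refine Finset.sum_congr rfl fun I _ => ?_
  rw [corr_cons_eq_sum _ _ hf, corr_cons_eq_sum _ _ hg, Finset.sum_mul_sum, Finset.mul_sum]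
  refine Finset.sum_congr rfl fun i _ => ?_
  rw [Finset.mul_sum]
  refine Finset.sum_congr rfl fun j _ => ?_
  simp only [ev]
  ring

theorem hasRes_mkDerivation {a : Bool} {z₀ : ℂ} (hz₀ : z₀ ≠ sg a) {n : ℕ} {z : Fin n → ℂ}
    (hz : ∀ r, z r ≠ sg a) {f : Fock} {N M : ℕ} (hf : f.vars ⊆ Finset.univ ×ˢ Finset.range N)
    (hM : 2 * N + 3 ≤ M) :
    HasRes (fun w => kernelForm z₀ w * ∑ r, (bergmann w (z r) *
          corr (ev (hat w) ::ₘ (Finset.univ.erase r).val.map fun r => ev (z r)) f +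
        corr (ev w ::ₘ (Finset.univ.erase r).val.map fun r => ev (z r)) f *
          bergmann (hat w) (z r))) (sg a)
      (∑ k ∈ Finset.range M, eta z₀ (a, k) * corr (Finset.univ.val.map fun r => ev (z r))
        (mkDerivation ℂ (virField regCoeff a k) f)) := by
  set s : Finset Mode := Finset.univ ×ˢ Finset.range N with hs
  have hmem (i : Mode) (hi : i ∈ s) : i.2 < N := Finset.mem_range.mp (Finset.mem_product.mp hi).2
  set T : Fin n → Multiset (Mode → ℂ) := fun r => (Finset.univ.erase r).val.map fun r => ev (z r)
    with hT
  set μ : ℕ → Fin n → Mode → ℂ := fun k r j =>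
    (if j.1 = a ∧ k ≤ j.2 + 1 then 2 * (2 * (j.2 : ℂ) + 1) * ev (z r) (a, j.2 + 1 - k) else 0) +
          if k = 0 then 2 * regCoeff (a, 0) j * ev (z r) (a, 0) else 0 with hμ
  have h : HasRes (fun w => ∑ r, ∑ j ∈ s, corr (T r) (pderiv j f) * (kernelForm z₀ w *
      (bergmann w (z r) * basis j (hat w) + basis j w * bergmann (hat w) (z r)))) (sg a)
      (∑ r, ∑ j ∈ s, corr (T r) (pderiv j f) *
        ∑ k ∈ Finset.range M, eta z₀ (a, k) * μ k r j) :=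
    HasRes.sum fun r _ => HasRes.sum fun j hj =>
      (hasRes_bergmann_basis (isLocalKernel_kernelForm hz₀) (hz r) j (by have := hmem j hj; omega)).const_mul _
  have e : ∑ k ∈ Finset.range M, eta z₀ (a, k) * corr (Finset.univ.val.map fun r => ev (z r))
        (mkDerivation ℂ (virField regCoeff a k) f) =
      ∑ r, ∑ j ∈ s, corr (T r) (pderiv j f) *
        ∑ k ∈ Finset.range M, eta z₀ (a, k) * μ k r j := by
    have h1 (k : ℕ) : corr (Finset.univ.val.map fun r => ev (z r))
        (mkDerivation ℂ (virField regCoeff a k) f) =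
        ∑ r, ∑ j ∈ s, μ k r j * corr (T r) (pderiv j f) := by
      rw [corr_mkDerivation _ _ _ (μ k) (fun r j => dirDeriv_virField _ _ _ _ _)]
      · refine Finset.sum_congr rfl fun r _ => ?_
        rw [← corr_cons, corr_cons_eq_sum _ _ hf]
      · intro j
        unfold virField
        split_ifs <;> simp
    simp_rw [h1, Finset.mul_sum]
    rw [Finset.sum_comm]
    refine Finset.sum_congr rfl fun r _ => ?_
    rw [Finset.sum_comm]
    refine Finset.sum_congr rfl fun j _ => Finset.sum_congr rfl fun k _ => ?_
    ring
  rw [e]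
  refine h.congr (Filter.Eventually.of_forall fun w => ?_)
  rw [Finset.mul_sum]
  refine Finset.sum_congr rfl fun r _ => ?_
  rw [corr_cons_eq_sum _ _ hf, corr_cons_eq_sum _ _ hf, Finset.sum_mul, Finset.mul_sum,
    ← Finset.sum_add_distrib, Finset.mul_sum]
  refine Finset.sum_congr rfl fun j _ => ?_
  simp only [ev, hT]
  ring

/-- Converts a sum over splittings of the index `m` into one over splittings of the genus: a factor
of genus `h` with `α + 1` arguments belongs to the index `2h + α - 1`, and other parities contribute
nothing. In the unstable case `h = α = 0` the truncated index is `0`, where the terms vanish. -/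
theorem sum_antidiagonal_eq_sum_range {A B : ℕ → ℂ} {α β g m : ℕ} (hA0 : A 0 = 0) (hB0 : B 0 = 0)
    (hA : ∀ p, A p ≠ 0 → ∃ j, p + 1 = 2 * j + α) (hB : ∀ q, B q ≠ 0 → ∃ j, q + 1 = 2 * j + β)
    (hm : m + 2 = 2 * g + (α + β)) :
    ∑ x ∈ Finset.HasAntidiagonal.antidiagonal m, A x.1 * B x.2 =
      ∑ h ∈ Finset.range (g + 1), A (2 * h + α - 1) * B (2 * (g - h) + β - 1) := by
  symm
  have key (h : ℕ) (hne : A (2 * h + α - 1) * B (2 * (g - h) + β - 1) ≠ 0) :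
      2 * h + α ≠ 0 ∧ 2 * (g - h) + β ≠ 0 := by
    have h1 := left_ne_zero_of_mul hne
    have h2 := right_ne_zero_of_mul hne
    constructor
    · intro h0; rw [h0] at h1; exact h1 hA0
    · intro h0; rw [h0] at h2; exact h2 hB0
  refine Finset.sum_bij_ne_zero (fun h _ _ => (2 * h + α - 1, 2 * (g - h) + β - 1)) ?_ ?_ ?_ ?_
  · intro h hh hne
    have := key h hne
    have := Finset.mem_range.mp hh
    rw [Finset.HasAntidiagonal.mem_antidiagonal]
    omega
  · intro h hh hne h' hh' hne' heq
    have := key h hne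
    have := key h' hne'
    have := (Prod.mk.inj heq).1
    omega
  · rintro ⟨p, q⟩ hpq hne
    rw [Finset.HasAntidiagonal.mem_antidiagonal] at hpq
    obtain ⟨j, hj⟩ := hA p (left_ne_zero_of_mul hne)
    obtain ⟨j', hj'⟩ := hB q (right_ne_zero_of_mul hne)
    dsimp only at hpq
    have e1 : 2 * j + α - 1 = p := by omega
    have e2 : 2 * (g - j) + β - 1 = q := by omega
    refine ⟨j, Finset.mem_range.mpr (by omega), ?_, ?_⟩
    · rw [e1, e2]; exact hne
    · rw [e1, e2]
  · intro h _ _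
    rfl

theorem map_restrictVars {n : ℕ} (z : Fin n → ℂ) (I : Finset (Fin n)) :
    (Finset.univ.val.map fun j => ev (restrictVars z I j)) = I.val.map fun r => ev (z r) := by
  have h : (Finset.univ.val.map fun j => I.orderEmbOfFin rfl j) = I.val := by
    conv_rhs => rw [← Finset.map_orderEmbOfFin_univ I rfl]
    rfl
  conv_rhs => rw [← h, Multiset.map_map]
  rfl

theorem map_cons_ev {n : ℕ} (w : ℂ) (z : Fin n → ℂ) :
    (Finset.univ.val.map fun i => ev ((Fin.cons w z : Fin (n + 1) → ℂ) i)) =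
      ev w ::ₘ Finset.univ.val.map fun r => ev (z r) := by
  rw [univ_val_map_succ]
  rfl

theorem omega_eq {y : ℂ → ℂ} {g n : ℕ} (h : 2 < 2 * g + (n + 1)) (z : Fin (n + 1) → ℂ) :
    omega y g (n + 1) z =
    let integrand : ℂ → ℂ := fun w =>
      kernel y (z 0) w * deriv hat w *
        ((if 1 ≤ g then
            omega y (g - 1) (n + 2) (Fin.cons w (Fin.cons (hat w) (Fin.tail z)))
          else 0) +
        ∑ g₁ : Fin (g + 1), ∑ I : Finset (Fin n),
          if ¬((g₁ : ℕ) = 0 ∧ I = ∅) ∧ ¬(g - (g₁ : ℕ) = 0 ∧ Iᶜ = ∅) then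
            omega y g₁ (I.card + 1) (Fin.cons w (restrictVars (Fin.tail z) I)) *
            omega y (g - g₁) (Iᶜ.card + 1) (Fin.cons (hat w) (restrictVars (Fin.tail z) Iᶜ))
          else 0)
    residue integrand 1 + residue integrand (-1) := by
  rcases g with _ | g
  · rcases n with _ | _ | n
    · omega
    · omega
    · rw [omega]
      · rfl
      all_goals simp
  · rw [omega]
    · rfl
    all_goals simp

/-- The contribution to the recursion of the terms in which both factors are `ω^0_2`. -/
def unstableTerm (g : ℕ) {n : ℕ} (z : Fin n → ℂ) (w : ℂ) : ℂ :=
  (if g = 1 ∧ n = 0 then bergmann w (hat w) else 0) +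
    ∑ r, ∑ r', if g = 0 ∧ ({r} : Finset (Fin n))ᶜ = {r'} then
      bergmann w (z r) * bergmann (hat w) (z r') else 0

theorem hasRes_unstableTerm {a : Bool} {z₀ : ℂ} (hz₀ : z₀ ≠ sg a) (g : ℕ) {n : ℕ} {z : Fin n → ℂ}
    (hz : ∀ r, z r ≠ sg a) {m : ℕ} (hm : m + 2 = 2 * g + n) {M : ℕ} (hM : 2 ≤ M) :
    HasRes (fun w => kernelForm z₀ w * unstableTerm g z w) (sg a)
      (∑ k ∈ Finset.range M, eta z₀ (a, k) * corr (Finset.univ.val.map fun r => ev (z r))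
        (if m = 0 then virConst regCoeff a k else 0)) := by
  by_cases hm0 : m = 0
  · have hg : g = 0 ∨ g = 1 := by omega
    rcases hg with rfl | rfl
    · obtain rfl : n = 2 := by omega
      have e1 : (({0} : Finset (Fin 2))ᶜ = {0}) = False := by decide
      have e2 : (({0} : Finset (Fin 2))ᶜ = {1}) = True := by decide
      have e3 : (({1} : Finset (Fin 2))ᶜ = {0}) = True := by decide
      have e4 : (({1} : Finset (Fin 2))ᶜ = {1}) = False := by decide
      have e : ∑ k ∈ Finset.range M, eta z₀ (a, k) * corr (Finset.univ.val.map fun r => ev (z r))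
          (if m = 0 then virConst regCoeff a k else 0) =
          eta z₀ (a, 0) * (2 * ev (z 0) (a, 0) * ev (z 1) (a, 0)) := by
        rw [Finset.sum_eq_single_of_mem 0 (Finset.mem_range.mpr (by omega))]
        · rw [if_pos hm0, univ_val_map_succ, univ_val_map_succ, corr_cons, corr_cons,
            dirDeriv_virConst]
          simp [corr, iterDeriv_zero, Fin.tail, derivation_C]
        · intro k _ hk
          rw [if_pos hm0, univ_val_map_succ, corr_cons, dirDeriv_virConst, if_neg hk, corr_zero_right,
            mul_zero]
      rw [e]
      refine (hasRes_bergmann_bergmann (isLocalKernel_kernelForm hz₀) (hz 0) (hz 1)).congr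
        (Filter.Eventually.of_forall fun w => ?_)
      simp [unstableTerm, Fin.sum_univ_two, e1, e2, e3, e4]
    · obtain rfl : n = 0 := by omega
      have e : ∑ k ∈ Finset.range M, eta z₀ (a, k) * corr (Finset.univ.val.map fun r => ev (z r))
          (if m = 0 then virConst regCoeff a k else 0) =
          eta z₀ (a, 0) * regCoeff (a, 0) (a, 0) + eta z₀ (a, 1) * (1 / 4) := by
        have h (k : ℕ) : corr (Finset.univ.val.map fun r => ev (z r))
            (if m = 0 then virConst regCoeff a k else 0) =
            (if k = 0 then regCoeff (a, 0) (a, 0) else 0) + if k = 1 then 1 / 4 else 0 := by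
          rw [if_pos hm0, virConst]
          simp only [corr, Finset.univ_eq_empty, Finset.empty_val, Multiset.map_zero, iterDeriv_zero]
          split_ifs <;> simp
        simp_rw [h, mul_add, Finset.sum_add_distrib, mul_ite, mul_zero, Finset.sum_ite_eq',
          Finset.mem_range]
        rw [if_pos (by omega), if_pos (by omega)]
      rw [e]
      refine (hasRes_bergmann_hat (isLocalKernel_kernelForm hz₀)).congr (Filter.Eventually.of_forall fun w => ?_)
      simp [unstableTerm]
  · have e : ∑ k ∈ Finset.range M, eta z₀ (a, k) * corr (Finset.univ.val.map fun r => ev (z r))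
        (if m = 0 then virConst regCoeff a k else 0) = 0 :=
      Finset.sum_eq_zero fun k _ => by rw [if_neg hm0, corr_zero_right, mul_zero]
    rw [e]
    refine (hasRes_zero (sg a)).congr (Filter.Eventually.of_forall fun w => ?_)
    rw [unstableTerm, if_neg (by omega), zero_add, Finset.sum_eq_zero, mul_zero]
    intro r _
    refine Finset.sum_eq_zero fun r' _ => if_neg ?_
    rintro ⟨hg, hr⟩
    have := congrArg Finset.card hr
    rw [Finset.card_compl, Finset.card_singleton, Finset.card_singleton, Fintype.card_fin] at this
    omega

/-! ### The sum over splittings compared with the terms of the free energy recursion. -/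

section

variable {F : ℕ → Fock} {n : ℕ}

/-- The stable part of a factor of the recursion. -/
def stableFactor (F : ℕ → Fock) (z : Fin n → ℂ) (g : ℕ) (I : Finset (Fin n)) (w : ℂ) : ℂ :=
  corr (ev w ::ₘ I.val.map fun r => ev (z r)) (F (2 * g + I.card - 1))

/-- The contribution of `ω^0_2` to a factor of the recursion. -/
def unstableFactor (z : Fin n → ℂ) (g : ℕ) (I : Finset (Fin n)) (w : ℂ) : ℂ :=
  ∑ r, if g = 0 ∧ I = {r} then bergmann w (z r) else 0

theorem unstableFactor_eq_zero (z : Fin n → ℂ) {g : ℕ} {I : Finset (Fin n)} (h : 2 * g + I.card ≠ 1)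
    (w : ℂ) : unstableFactor z g I w = 0 := by
  refine Finset.sum_eq_zero fun r _ => if_neg ?_
  rintro ⟨rfl, rfl⟩
  simp at h

theorem stableFactor_eq_zero (hF0 : F 0 = 0) (z : Fin n → ℂ) {g : ℕ} {I : Finset (Fin n)}
    (h : 2 * g + I.card ≤ 1) (w : ℂ) : stableFactor F z g I w = 0 := by
  rw [stableFactor, show 2 * g + I.card - 1 = 0 by omega, hF0, corr_zero_right]

/-- At most one summand is nonzero. Writing every factor as a sum avoids separating the occurrences
of `ω^0_2` from the stable ones. -/
theorem omega_eq_factor (hF0 : F 0 = 0) (z : Fin n → ℂ) {g : ℕ} {I : Finset (Fin n)} (w : ℂ)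
    (hgI : ¬(g = 0 ∧ I = ∅))
    (ih : 2 < 2 * g + (I.card + 1) →
      omega lnBranch g (I.card + 1) (Fin.cons w (restrictVars z I)) =
        corr (Finset.univ.val.map fun i =>
          ev ((Fin.cons w (restrictVars z I) : Fin (I.card + 1) → ℂ) i))
          (F (2 * g + (I.card + 1) - 2))) :
    omega lnBranch g (I.card + 1) (Fin.cons w (restrictVars z I)) =
      stableFactor F z g I w + unstableFactor z g I w := by
  by_cases h : 2 < 2 * g + (I.card + 1)
  · rw [ih h, map_cons_ev, map_restrictVars, unstableFactor_eq_zero z (by omega), add_zero,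
      stableFactor]
    rfl
  · have hg : g = 0 := by omega
    subst hg
    have hI : I.card ≠ 0 := fun h0 => hgI ⟨rfl, Finset.card_eq_zero.mp h0⟩
    obtain ⟨r, rfl⟩ := Finset.card_eq_one.mp (show I.card = 1 by omega)
    rw [stableFactor_eq_zero hF0 z (by simp), zero_add, unstableFactor,
      Finset.sum_eq_single_of_mem r (Finset.mem_univ _), if_pos ⟨rfl, rfl⟩]
    · have hr : restrictVars z {r} ⟨0, by simp⟩ = z r := by
        rw [restrictVars]
        congr 1
        exact Finset.mem_singleton.mp (Finset.orderEmbOfFin_mem {r} rfl ⟨0, by simp⟩)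
      change omega lnBranch 0 2 _ = _
      rw [omega]
      change bergmann w (restrictVars z {r} ⟨0, by simp⟩) = _
      rw [hr]
    · intro r' _ hr'
      refine if_neg fun h => hr' ?_
      exact (Finset.singleton_inj.mp h.2).symm

/-- The product of two sums is expanded. Stable times stable matches `gradForm`, the mixed products
match the derivatives of `virField`, and `ω^0_2` times `ω^0_2`, together with `B(w, ŵ)`, matches
`virConst`. -/
theorem sum_factor_eq (hF : IsFreeEnergy regCoeff F) (z : Fin n → ℂ) {g m : ℕ}
    (hm : m + 2 = 2 * g + n) (w : ℂ) :
    (∑ g₁ ∈ Finset.range (g + 1), ∑ I : Finset (Fin n),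
      (stableFactor F z g₁ I w + unstableFactor z g₁ I w) *
        (stableFactor F z (g - g₁) Iᶜ (hat w) + unstableFactor z (g - g₁) Iᶜ (hat w))) +
      (if g = 1 ∧ n = 0 then bergmann w (hat w) else 0) =
    (∑ x ∈ Finset.HasAntidiagonal.antidiagonal m, ∑ I : Finset (Fin n),
      corr (ev w ::ₘ I.val.map fun r => ev (z r)) (F x.1) *
        corr (ev (hat w) ::ₘ Iᶜ.val.map fun r => ev (z r)) (F x.2)) +
    (∑ r, (bergmann w (z r) *
          corr (ev (hat w) ::ₘ (Finset.univ.erase r).val.map fun r => ev (z r)) (F m) +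
        corr (ev w ::ₘ (Finset.univ.erase r).val.map fun r => ev (z r)) (F m) *
          bergmann (hat w) (z r))) + unstableTerm g z w := by
  have hsplit (w : ℂ) (X : ℕ → Finset (Fin n) → ℂ) :
      ∑ g₁ ∈ Finset.range (g + 1), ∑ I : Finset (Fin n), unstableFactor z g₁ I w * X g₁ I =
        ∑ r, bergmann w (z r) * X 0 {r} := by
    rw [Finset.sum_eq_single_of_mem 0 (Finset.mem_range.mpr (Nat.succ_pos g))]
    · simp_rw [unstableFactor, Finset.sum_mul]
      rw [Finset.sum_comm]
      refine Finset.sum_congr rfl fun r _ => ?_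
      rw [Finset.sum_eq_single_of_mem {r} (Finset.mem_univ _)]
      · rw [if_pos ⟨trivial, rfl⟩]
      · intro I _ hI
        rw [if_neg fun h => hI h.2, zero_mul]
    · intro g₁ _ hg₁
      refine Finset.sum_eq_zero fun I _ => ?_
      rw [unstableFactor_eq_zero z (by omega), zero_mul]
  have hswap (X Y : ℕ → Finset (Fin n) → ℂ) :
      ∑ g₁ ∈ Finset.range (g + 1), ∑ I : Finset (Fin n), X g₁ I * Y (g - g₁) Iᶜ =
        ∑ g₁ ∈ Finset.range (g + 1), ∑ I : Finset (Fin n), Y g₁ I * X (g - g₁) Iᶜ := by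
    rw [← Finset.sum_range_reflect]
    refine Finset.sum_congr rfl fun g₁ hg₁ => ?_
    have hle : g₁ ≤ g := Nat.lt_succ_iff.mp (Finset.mem_range.mp hg₁)
    rw [← Equiv.sum_comp (Function.Involutive.toPerm compl compl_involutive)]
    refine Finset.sum_congr rfl fun I _ => ?_
    change X (g + 1 - 1 - g₁) Iᶜ * Y (g - (g + 1 - 1 - g₁)) Iᶜᶜ = _
    rw [compl_compl, Nat.add_sub_cancel, Nat.sub_sub_self hle, mul_comm]
  have hAA : ∑ g₁ ∈ Finset.range (g + 1), ∑ I : Finset (Fin n),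
      stableFactor F z g₁ I w * stableFactor F z (g - g₁) Iᶜ (hat w) =
      ∑ x ∈ Finset.HasAntidiagonal.antidiagonal m, ∑ I : Finset (Fin n),
      corr (ev w ::ₘ I.val.map fun r => ev (z r)) (F x.1) *
        corr (ev (hat w) ::ₘ Iᶜ.val.map fun r => ev (z r)) (F x.2) := by
    rw [Finset.sum_comm, Finset.sum_comm (t := Finset.univ)]
    refine Finset.sum_congr rfl fun I _ => ?_
    have hcard : I.card + Iᶜ.card = n := by
      rw [Finset.card_add_card_compl, Fintype.card_fin]
    have hpar (u : ℂ) (J : Finset (Fin n)) (p : ℕ)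
        (hp : corr (ev u ::ₘ J.val.map fun r => ev (z r)) (F p) ≠ 0) :
        ∃ j, p + 1 = 2 * j + J.card := by
      by_contra hno
      push Not at hno
      refine hp (hF.corr_eq_zero (Multiset.cons_ne_zero) fun j hj => hno j ?_)
      rw [Multiset.card_cons, Multiset.card_map, Finset.card_val] at hj
      omega
    exact (sum_antidiagonal_eq_sum_range
      (A := fun p => corr (ev w ::ₘ I.val.map fun r => ev (z r)) (F p))
      (B := fun p => corr (ev (hat w) ::ₘ Iᶜ.val.map fun r => ev (z r)) (F p))
      (by rw [hF.zero, corr_zero_right]) (by rw [hF.zero, corr_zero_right])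
      (hpar w I) (hpar (hat w) Iᶜ) (by rw [hcard, hm])).symm
  have hST (u : ℂ) (r : Fin n) : stableFactor F z (g - 0) {r}ᶜ u =
      corr (ev u ::ₘ (Finset.univ.erase r).val.map fun r => ev (z r)) (F m) := by
    rw [stableFactor, Nat.sub_zero, Finset.card_compl, Finset.card_singleton, Fintype.card_fin,
      Finset.compl_singleton]
    have := r.pos
    rw [show 2 * g + (n - 1) - 1 = m by omega]
  have hexpand : ∑ g₁ ∈ Finset.range (g + 1), ∑ I : Finset (Fin n),
      (stableFactor F z g₁ I w + unstableFactor z g₁ I w) *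
        (stableFactor F z (g - g₁) Iᶜ (hat w) + unstableFactor z (g - g₁) Iᶜ (hat w)) =
      (∑ g₁ ∈ Finset.range (g + 1), ∑ I : Finset (Fin n),
        stableFactor F z g₁ I w * stableFactor F z (g - g₁) Iᶜ (hat w)) +
      (∑ g₁ ∈ Finset.range (g + 1), ∑ I : Finset (Fin n),
        unstableFactor z g₁ I w * stableFactor F z (g - g₁) Iᶜ (hat w)) +
      (∑ g₁ ∈ Finset.range (g + 1), ∑ I : Finset (Fin n),
        stableFactor F z g₁ I w * unstableFactor z (g - g₁) Iᶜ (hat w)) +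
      ∑ g₁ ∈ Finset.range (g + 1), ∑ I : Finset (Fin n),
        unstableFactor z g₁ I w * unstableFactor z (g - g₁) Iᶜ (hat w) := by
    simp_rw [← Finset.sum_add_distrib]
    exact Finset.sum_congr rfl fun _ _ => Finset.sum_congr rfl fun _ _ => by ring
  rw [hexpand, hAA, hsplit w fun g₁ I => stableFactor F z (g - g₁) Iᶜ (hat w),
    hswap (fun g₁ I => stableFactor F z g₁ I w) fun g₁ I => unstableFactor z g₁ I (hat w),
    hsplit (hat w) fun g₁ I => stableFactor F z (g - g₁) Iᶜ w,
    hsplit w fun g₁ I => unstableFactor z (g - g₁) Iᶜ (hat w), unstableTerm]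
  simp_rw [hST, Finset.sum_add_distrib]
  have hU : ∑ r, bergmann w (z r) * unstableFactor z (g - 0) {r}ᶜ (hat w) =
      ∑ r, ∑ r', if g = 0 ∧ ({r} : Finset (Fin n))ᶜ = {r'} then
        bergmann w (z r) * bergmann (hat w) (z r') else 0 := by
    refine Finset.sum_congr rfl fun r _ => ?_
    rw [unstableFactor, Finset.mul_sum, Nat.sub_zero]
    refine Finset.sum_congr rfl fun r' _ => ?_
    rw [mul_ite, mul_zero]
  rw [hU]
  have hc (r : Fin n) := mul_comm (bergmann (hat w) (z r))
    (corr (ev w ::ₘ (Finset.univ.erase r).val.map fun r => ev (z r)) (F m))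
  simp_rw [hc]
  ring

end

/-- The stable Eynard-Orantin invariants are the derivatives of the free energy. -/
theorem omega_eq_corr {F : ℕ → Fock} (hF : IsFreeEnergy regCoeff F) (N : ℕ) :
    ∀ (g n : ℕ) (z : Fin n → ℂ), 2 * g + n = N → n ≠ 0 → 2 < 2 * g + n → (∀ i a, z i ≠ sg a) →
      omega lnBranch g n z = corr (Finset.univ.val.map fun i => ev (z i)) (F (2 * g + n - 2)) := by
  induction N using Nat.strong_induction_on with
  | _ N ih =>
  intro g n z hN hn hgn hz
  rcases n with _ | n
  · exact absurd rfl hn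
  obtain ⟨m, hm⟩ : ∃ m, m + 2 = 2 * g + n := ⟨2 * g + n - 2, by omega⟩
  rw [omega_eq hgn, show 2 * g + (n + 1) - 2 = m + 1 by omega]
  set L : Fin n → Mode → ℂ := fun r => ev (Fin.tail z r) with hL
  obtain ⟨N₀, hN₀⟩ := exists_box ((Finset.range (m + 2)).biUnion fun p => (F p).vars)
  have hvars (p : ℕ) (hp : p < m + 2) : (F p).vars ⊆ Finset.univ ×ˢ Finset.range N₀ :=
    (Finset.subset_biUnion_of_mem (fun p => (F p).vars) (Finset.mem_range.mpr hp)).trans hN₀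
  set M := 2 * N₀ + 3 with hM
  -- The residue at a branch point is the combination of the right sides of the free energy
  -- recursion with coefficients `eta (z 0)`, hence of its left sides. By `ev_eq_sum_eta` these add
  -- up to the derivative along `ev (z 0)`.
  have main (a : Bool) : residue (fun w => kernel lnBranch (z 0) w * deriv hat w *
        ((if 1 ≤ g then
            omega lnBranch (g - 1) (n + 2) (Fin.cons w (Fin.cons (hat w) (Fin.tail z)))
          else 0) +
        ∑ g₁ : Fin (g + 1), ∑ I : Finset (Fin n),
          if ¬((g₁ : ℕ) = 0 ∧ I = ∅) ∧ ¬(g - (g₁ : ℕ) = 0 ∧ Iᶜ = ∅) then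
            omega lnBranch g₁ (I.card + 1) (Fin.cons w (restrictVars (Fin.tail z) I)) *
            omega lnBranch (g - g₁) (Iᶜ.card + 1)
              (Fin.cons (hat w) (restrictVars (Fin.tail z) Iᶜ))
          else 0)) (sg a) = ∑ k ∈ Finset.range M, eta (z 0) (a, k) *
            corr (Finset.univ.val.map L) (dirDeriv (dualCoeff (a, k)) (F (m + 1))) := by
    refine HasRes.residue_eq ?_
    have h1 := hasRes_laplacian (hz 0 a) (Finset.univ.val.map L) (hvars m (by omega)) le_rfl
    have h2 := hasRes_mkDerivation (hz 0 a) (z := Fin.tail z) (fun r => hz r.succ a)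
      (hvars m (by omega)) le_rfl
    have h3 := hasRes_unstableTerm (hz 0 a) g (z := Fin.tail z) (fun r => hz r.succ a) hm
      (show 2 ≤ M by omega)
    have h4 := HasRes.sum fun x (hx : x ∈ Finset.HasAntidiagonal.antidiagonal m) =>
      hasRes_gradForm (hz 0 a) L
        (hvars x.1 (by have := Finset.HasAntidiagonal.mem_antidiagonal.mp hx; omega))
        (hvars x.2 (by have := Finset.HasAntidiagonal.mem_antidiagonal.mp hx; omega)) le_rfl
    have h := ((h3.add h2).add h1).add h4
    have e : ∑ k ∈ Finset.range M, eta (z 0) (a, k) *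
            corr (Finset.univ.val.map L) (dirDeriv (dualCoeff (a, k)) (F (m + 1))) =
        ∑ k ∈ Finset.range M, eta (z 0) (a, k) * corr (Finset.univ.val.map L)
          (if m = 0 then virConst regCoeff a k else 0) +
        ∑ k ∈ Finset.range M, eta (z 0) (a, k) * corr (Finset.univ.val.map L)
          (mkDerivation ℂ (virField regCoeff a k) (F m)) +
        ∑ k ∈ Finset.range M, eta (z 0) (a, k) * corr (Finset.univ.val.map L)
          (laplacian (virForm regCoeff a k) (F m)) +
        ∑ x ∈ Finset.HasAntidiagonal.antidiagonal m, ∑ k ∈ Finset.range M, eta (z 0) (a, k) *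
          corr (Finset.univ.val.map L) (gradForm (virForm regCoeff a k) (F x.1) (F x.2)) := by
      simp_rw [hF.succ, corr_add, corr_sum, mul_add, Finset.sum_add_distrib, Finset.mul_sum]
      rw [Finset.sum_comm (t := Finset.HasAntidiagonal.antidiagonal m)]
    rw [e]
    refine h.congr ?_
    have hw1 : ∀ᶠ w in 𝓝[≠] (sg a), ∀ b, w ≠ sg b ∧ hat w ≠ sg b := by
      have hb (b : Bool) : ∀ᶠ w in 𝓝[≠] (sg a), w ≠ sg b := by
        by_cases hab : sg a = sg b
        · rw [hab]; exact self_mem_nhdsWithin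
        · exact nhdsWithin_le_nhds (continuousAt_id.eventually_ne hab)
      filter_upwards [hb true, hb false] with w ht hf
      have hinv (b : Bool) (h : w ≠ sg b) : hat w ≠ sg b := by
        intro h'
        apply h
        rw [← inv_inv w, show w⁻¹ = sg b from h', inv_eq_of_mul_eq_one_left (sg_mul_self b)]
      rintro (_ | _)
      · exact ⟨hf, hinv _ hf⟩
      · exact ⟨ht, hinv _ ht⟩
    filter_upwards [hw1] with w hw
    have hfactor (u : ℂ) (hu : ∀ b, u ≠ sg b) (g₁ : ℕ) (I : Finset (Fin n))
        (hlt : 2 * g₁ + (I.card + 1) < N) (hne : ¬(g₁ = 0 ∧ I = ∅)) :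
        omega lnBranch g₁ (I.card + 1) (Fin.cons u (restrictVars (Fin.tail z) I)) =
          stableFactor F (Fin.tail z) g₁ I u + unstableFactor (Fin.tail z) g₁ I u := by
      refine omega_eq_factor hF.zero _ _ hne fun h => ?_
      refine ih _ hlt _ _ _ rfl (Nat.succ_ne_zero _) h fun i => ?_
      refine Fin.cases hu (fun j => ?_) i
      rw [Fin.cons_succ]
      exact fun b => hz _ b
    have hsum : (∑ g₁ : Fin (g + 1), ∑ I : Finset (Fin n),
          if ¬((g₁ : ℕ) = 0 ∧ I = ∅) ∧ ¬(g - (g₁ : ℕ) = 0 ∧ Iᶜ = ∅) then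
            omega lnBranch g₁ (I.card + 1) (Fin.cons w (restrictVars (Fin.tail z) I)) *
            omega lnBranch (g - g₁) (Iᶜ.card + 1)
              (Fin.cons (hat w) (restrictVars (Fin.tail z) Iᶜ))
          else 0) = ∑ g₁ ∈ Finset.range (g + 1), ∑ I : Finset (Fin n),
      (stableFactor F (Fin.tail z) g₁ I w + unstableFactor (Fin.tail z) g₁ I w) *
        (stableFactor F (Fin.tail z) (g - g₁) Iᶜ (hat w) +
          unstableFactor (Fin.tail z) (g - g₁) Iᶜ (hat w)) := by
      rw [← Fin.sum_univ_eq_sum_range fun g₁ => ∑ I : Finset (Fin n),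
        (stableFactor F (Fin.tail z) g₁ I w + unstableFactor (Fin.tail z) g₁ I w) *
        (stableFactor F (Fin.tail z) (g - g₁) Iᶜ (hat w) +
          unstableFactor (Fin.tail z) (g - g₁) Iᶜ (hat w))]
      refine Finset.sum_congr rfl fun g₁ _ => Finset.sum_congr rfl fun I _ => ?_
      have hcard : I.card + Iᶜ.card = n := by
        rw [Finset.card_add_card_compl, Fintype.card_fin]
      have hg₁ := g₁.isLt
      split_ifs with hc
      · have c1 : ¬((g₁ : ℕ) = 0 ∧ I.card = 0) := by rw [Finset.card_eq_zero]; exact hc.1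
        have c2 : ¬(g - (g₁ : ℕ) = 0 ∧ Iᶜ.card = 0) := by rw [Finset.card_eq_zero]; exact hc.2
        rw [hfactor w (fun b => (hw b).1) _ _ (by omega) hc.1,
          hfactor (hat w) (fun b => (hw b).2) _ _ (by omega) hc.2]
      -- The omitted terms with `ω^0_1` vanish on the right as well, because `F 0 = 0`.
      · rw [not_and_or, not_not, not_not] at hc
        rcases hc with ⟨h0, hI⟩ | ⟨h0, hI⟩
        · rw [stableFactor_eq_zero hF.zero _ (by simp [h0, hI]),
            unstableFactor_eq_zero _ (by simp [h0, hI]), add_zero, zero_mul]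
        · rw [stableFactor_eq_zero hF.zero (I := Iᶜ) _ (by simp [h0, hI]),
            unstableFactor_eq_zero (I := Iᶜ) _ (by simp [h0, hI]), add_zero, mul_zero]
    have hfirst : (if 1 ≤ g then
            omega lnBranch (g - 1) (n + 2) (Fin.cons w (Fin.cons (hat w) (Fin.tail z)))
          else 0) = corr (ev w ::ₘ ev (hat w) ::ₘ Finset.univ.val.map L) (F m) +
          if g = 1 ∧ n = 0 then bergmann w (hat w) else 0 := by
      by_cases hg : 1 ≤ g
      · rw [if_pos hg]
        by_cases hgn0 : g = 1 ∧ n = 0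
        · obtain ⟨rfl, rfl⟩ := hgn0
          obtain rfl : m = 0 := by omega
          rw [if_pos ⟨rfl, rfl⟩, hF.zero, corr_zero_right, zero_add (bergmann w (hat w))]
          change omega lnBranch 0 2 _ = _
          rw [omega]
          rfl
        · rw [if_neg hgn0, add_zero, ih (2 * (g - 1) + (n + 2)) (by omega) _ _ _ rfl (by omega)
            (by omega), map_cons_ev, map_cons_ev, show 2 * (g - 1) + (n + 2) - 2 = m by omega]
          intro i
          refine Fin.cases (fun b => (hw b).1) (fun j => ?_) i
          refine Fin.cases (fun b => (hw b).2) (fun j => ?_) j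
          exact fun b => hz _ b
      -- In genus zero `n = m + 2`, so `n + 2` derivatives exceed the degree `m + 2` of `F m`.
      · rw [if_neg hg, if_neg (by omega), add_zero, hF.corr_eq_zero Multiset.cons_ne_zero]
        intro j
        rw [Multiset.card_cons, Multiset.card_cons, Multiset.card_map, Finset.card_val,
          Finset.card_univ, Fintype.card_fin]
        omega
    have hfac := sum_factor_eq hF (Fin.tail z) hm w
    rw [hsum, hfirst, ← Finset.mul_sum]
    change _ = kernelForm (z 0) w * _
    rw [← mul_add, ← mul_add, ← mul_add]
    congr 1
    linear_combination -hfac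
  have h1 := main true
  have h2 := main false
  rw [show sg true = 1 by simp [sg]] at h1
  rw [show sg false = -1 by simp [sg]] at h2
  dsimp only
  rw [h1, h2, univ_val_map_succ, corr_cons]
  have hev : dirDeriv (ev (z 0)) (F (m + 1)) = ∑ a : Bool, ∑ k ∈ Finset.range M,
      C (eta (z 0) (a, k)) * dirDeriv (dualCoeff (a, k)) (F (m + 1)) := by
    simp_rw [← dirDeriv_smul, ← dirDeriv_sum]
    refine dirDeriv_congr fun j hj => ?_
    have hjN : j.2 < N₀ := Finset.mem_range.mp (Finset.mem_product.mp (hvars _ (by omega) hj)).2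
    rw [Finset.sum_eq_single_of_mem j.1 (Finset.mem_univ _)]
    · rw [show j = (j.1, j.2) from rfl, ev_eq_sum_eta (hz 0 j.1)]
      refine Finset.sum_subset (Finset.range_subset_range.mpr (by omega)) fun k _ hk => ?_
      rw [Finset.mem_range] at hk
      rw [dualCoeff, if_neg fun h => hk (Nat.lt_succ_of_le h.2), mul_zero]
    · intro b _ hb
      refine Finset.sum_eq_zero fun k _ => ?_
      rw [dualCoeff, if_neg fun h => hb h.1.symm, mul_zero]
  rw [hev, corr_sum, Fintype.sum_bool]
  simp_rw [corr_sum, corr_C_mul]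
  rfl

/-! ### Rational functions with poles at the branch points -/

/-- `f` is a rational function without poles outside the branch points, infinity included. -/
def IsRat (f : ℂ → ℂ) : Prop :=
  ∃ P : Bool → Polynomial ℂ, ∀ w, (∀ a, w ≠ sg a) → f w = ∑ a, (P a).eval (w - sg a)⁻¹

theorem IsRat.congr {f g : ℂ → ℂ} (hf : IsRat f) (h : ∀ w, (∀ a, w ≠ sg a) → g w = f w) : IsRat g :=
  let ⟨P, hP⟩ := hf
  ⟨P, fun w hw => by rw [h w hw, hP w hw]⟩

theorem IsRat.add {f g : ℂ → ℂ} (hf : IsRat f) (hg : IsRat g) : IsRat fun w => f w + g w := by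
  obtain ⟨P, hP⟩ := hf
  obtain ⟨Q, hQ⟩ := hg
  refine ⟨fun a => P a + Q a, fun w hw => ?_⟩
  simp only [hP w hw, hQ w hw, Polynomial.eval_add, Finset.sum_add_distrib]

theorem isRat_eval (a : Bool) (p : Polynomial ℂ) : IsRat fun w => p.eval (w - sg a)⁻¹ := by
  refine ⟨fun b => if b = a then p else 0, fun w _ => ?_⟩
  rw [Finset.sum_eq_single_of_mem a (Finset.mem_univ a)]
  · dsimp only
    rw [if_pos rfl]
  · intro b _ hb
    dsimp only
    rw [if_neg hb, Polynomial.eval_zero]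

theorem isRat_const (c : ℂ) : IsRat fun _ => c :=
  (isRat_eval true (Polynomial.C c)).congr fun w _ => by rw [Polynomial.eval_C]

theorem IsRat.const_mul {f : ℂ → ℂ} (hf : IsRat f) (c : ℂ) : IsRat fun w => c * f w := by
  obtain ⟨P, hP⟩ := hf
  refine ⟨fun a => Polynomial.C c * P a, fun w hw => ?_⟩
  simp only [hP w hw, Polynomial.eval_mul, Polynomial.eval_C, Finset.mul_sum]

theorem IsRat.sum {κ : Type*} {t : Finset κ} {f : κ → ℂ → ℂ} (h : ∀ k ∈ t, IsRat (f k)) :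
    IsRat fun w => ∑ k ∈ t, f k w := by
  classical
  induction t using Finset.induction_on with
  | empty => simpa using isRat_const 0
  | insert a t ha ih =>
    simp only [Finset.sum_insert ha]
    exact (h a (Finset.mem_insert_self _ _)).add (ih fun k hk => h k (Finset.mem_insert_of_mem hk))

theorem inv_mul_inv_of_ne {a b : Bool} (hab : a ≠ b) {w : ℂ} (hw : ∀ a, w ≠ sg a) :
    (w - sg a)⁻¹ * (w - sg b)⁻¹ = sg a / 2 * ((w - sg a)⁻¹ - (w - sg b)⁻¹) := by
  have h1 : w - sg a ≠ 0 := sub_ne_zero.mpr (hw a)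
  have h2 : w - sg b ≠ 0 := sub_ne_zero.mpr (hw b)
  have h3 := sg_mul_of_ne hab
  have h4 := sg_mul_self a
  field_simp
  linear_combination -h4 + h3

/-- Partial fractions: a product of simple poles at different branch points is a combination of the
two, which lowers the order of mixed terms. -/
theorem IsRat.inv_mul {f : ℂ → ℂ} (hf : IsRat f) (a : Bool) : IsRat fun w => (w - sg a)⁻¹ * f w := by
  have hp (b : Bool) (p : Polynomial ℂ) : IsRat fun w => (w - sg a)⁻¹ * p.eval (w - sg b)⁻¹ := by
    by_cases hab : a = b
    · subst hab
      exact (isRat_eval a (Polynomial.X * p)).congr fun w _ => by simp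
    · induction p using Polynomial.induction_on' with
      | add p q hp hq =>
        exact (hp.add hq).congr fun w _ => by rw [Polynomial.eval_add, mul_add]
      | monomial n c =>
        induction n with
        | zero =>
          exact (isRat_eval a (Polynomial.C c * Polynomial.X)).congr fun w _ => by
            rw [Polynomial.monomial_zero_left, Polynomial.eval_mul, Polynomial.eval_C,
              Polynomial.eval_X, Polynomial.eval_C, mul_comm]
        | succ n ih =>
          refine ((ih.const_mul (sg a / 2)).add
            ((isRat_eval b (Polynomial.monomial (n + 1) c)).const_mul (-sg a / 2))).congr fun w hw => ?_
          simp only [Polynomial.eval_monomial]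
          linear_combination c * (w - sg b)⁻¹ ^ n * inv_mul_inv_of_ne hab hw
  obtain ⟨P, hP⟩ := hf
  exact (IsRat.sum fun b (_ : b ∈ Finset.univ) => hp b (P b)).congr fun w hw => by
    rw [hP w hw, Finset.mul_sum]

theorem IsRat.eval_mul {f : ℂ → ℂ} (hf : IsRat f) (a : Bool) (p : Polynomial ℂ) :
    IsRat fun w => p.eval (w - sg a)⁻¹ * f w := by
  induction p using Polynomial.induction_on' with
  | add p q hp hq => exact (hp.add hq).congr fun w _ => by rw [Polynomial.eval_add, add_mul]
  | monomial n c =>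
    induction n with
    | zero => exact (hf.const_mul c).congr fun w _ => by simp
    | succ n ih =>
      exact (ih.inv_mul a).congr fun w _ => by
        simp only [Polynomial.eval_monomial]
        ring

theorem IsRat.mul {f g : ℂ → ℂ} (hf : IsRat f) (hg : IsRat g) : IsRat fun w => f w * g w := by
  obtain ⟨P, hP⟩ := hf
  exact (IsRat.sum fun b (_ : b ∈ Finset.univ) => hg.eval_mul b (P b)).congr fun w hw => by
    rw [hP w hw, Finset.sum_mul]

theorem eventually_cobounded_ne (c : ℂ) : ∀ᶠ w in Bornology.cobounded ℂ, w ≠ c := by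
  filter_upwards [Bornology.isBounded_def.mp (Bornology.isBounded_singleton (x := c))] with w hw
  exact hw

theorem tendsto_inv_sub (c : ℂ) :
    Filter.Tendsto (fun w : ℂ => (w - c)⁻¹) (Bornology.cobounded ℂ) (𝓝 0) :=
  Filter.tendsto_inv₀_cobounded.comp (tendsto_sub_const_cobounded c)

theorem tendsto_mul_inv_sub (c : ℂ) :
    Filter.Tendsto (fun w : ℂ => w * (w - c)⁻¹) (Bornology.cobounded ℂ) (𝓝 1) := by
  have h := ((tendsto_inv_sub c).const_mul c).const_add 1
  rw [mul_zero, add_zero] at h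
  refine h.congr' ?_
  filter_upwards [eventually_cobounded_ne c] with w hw
  have : w - c ≠ 0 := sub_ne_zero.mpr hw
  field_simp
  ring

theorem IsRat.tendsto {f : ℂ → ℂ} (hf : IsRat f) :
    ∃ c, Filter.Tendsto f (Bornology.cobounded ℂ) (𝓝 c) := by
  obtain ⟨P, hP⟩ := hf
  refine ⟨∑ a, (P a).eval 0, Filter.Tendsto.congr' ?_ (tendsto_finsetSum _ fun a _ =>
    ((P a).continuous.tendsto 0).comp (tendsto_inv_sub (sg a)))⟩
  filter_upwards [eventually_cobounded_ne (sg true), eventually_cobounded_ne (sg false)] with w h1 h2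
  rw [hP w (by rintro (_ | _) <;> assumption)]
  rfl

theorem hasRes_eval_self (a : Bool) (p : Polynomial ℂ) :
    HasRes (fun w => p.eval (w - sg a)⁻¹) (sg a) (p.coeff 1) := by
  have hs : AnalyticAt ℂ (fun w : ℂ => w - sg a) (sg a) := analyticAt_id.sub analyticAt_const
  have hd (w : ℂ) : deriv (fun w : ℂ => w - sg a) w = 1 := ((hasDerivAt_id w).sub_const _).deriv
  have h1 (n : ℕ) : HasRes (fun w => (w - sg a)⁻¹ ^ n) (sg a) (if n = 1 then 1 else 0) := by
    rcases n with _ | n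
    · simpa using hasRes_of_analyticAt (analyticAt_const (v := (1 : ℂ)))
    · have h := hasRes_local hs (sub_self _) (by rw [hd]; exact one_ne_zero)
        (analyticAt_const (v := (1 : ℂ))) n
      rw [taylorCoeff_const] at h
      have e : (if n + 1 = 1 then (1 : ℂ) else 0) = if n = 0 then 1 else 0 := by simp
      rw [e]
      refine h.congr (Filter.Eventually.of_forall fun w => ?_)
      rw [hd, mul_one, mul_one, inv_pow]
  have h2 := HasRes.sum fun n (_ : n ∈ p.support) => (h1 n).const_mul (p.coeff n)
  have e : p.coeff 1 = ∑ n ∈ p.support, p.coeff n * (if n = 1 then 1 else 0) := by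
    simp
  rw [e]
  refine h2.congr (Filter.Eventually.of_forall fun w => ?_)
  rw [Polynomial.eval_eq_sum]
  rfl

theorem hasRes_eval_of_ne {a : Bool} {c : ℂ} (h : c ≠ sg a) (p : Polynomial ℂ) :
    HasRes (fun w => p.eval (w - c)⁻¹) (sg a) 0 := by
  refine hasRes_of_analyticAt ?_
  have h1 : AnalyticAt ℂ (fun w : ℂ => (w - c)⁻¹) (sg a) :=
    (analyticAt_id.sub analyticAt_const).inv (sub_ne_zero.mpr h.symm)
  exact h1.aeval_polynomial p

theorem sg_injective : Function.Injective sg := by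
  intro a b h
  cases a <;> cases b <;> simp [sg] at h ⊢ <;> norm_num at h

theorem eventually_ne_sg (a : Bool) : ∀ᶠ w in 𝓝[≠] (sg a), ∀ b, w ≠ sg b := by
  have hb (b : Bool) : ∀ᶠ w in 𝓝[≠] (sg a), w ≠ sg b := by
    by_cases hab : sg a = sg b
    · rw [hab]; exact self_mem_nhdsWithin
    · exact nhdsWithin_le_nhds (continuousAt_id.eventually_ne hab)
  filter_upwards [hb true, hb false] with w ht hf
  rintro (_ | _) <;> assumption

/-- The residue theorem on the sphere: the residues are the coefficients of the simple poles in the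
partial fraction expansion, and their sum is the limit of `w * f w` at infinity. -/
theorem IsRat.hasRes {f : ℂ → ℂ} (hf : IsRat f) {c : ℂ}
    (hc : Filter.Tendsto (fun w => w * f w) (Bornology.cobounded ℂ) (𝓝 c)) :
    ∃ r : Bool → ℂ, (∀ a, HasRes f (sg a) (r a)) ∧ ∑ a, r a = c := by
  obtain ⟨P, hP⟩ := hf
  have hne : ∀ᶠ w in Bornology.cobounded ℂ, ∀ a, w ≠ sg a := by
    filter_upwards [eventually_cobounded_ne (sg true), eventually_cobounded_ne (sg false)] with w h1 h2
    rintro (_ | _) <;> assumption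
  refine ⟨fun a => (P a).coeff 1, fun a => ?_, ?_⟩
  · have h := HasRes.sum (t := Finset.univ) (α := sg a)
      (f := fun b w => (P b).eval (w - sg b)⁻¹) (c := fun b => if b = a then (P a).coeff 1 else 0) ?_
    · rw [Finset.sum_ite_eq' Finset.univ a, if_pos (Finset.mem_univ a)] at h
      refine h.congr ?_
      filter_upwards [eventually_ne_sg a] with w hw
      rw [hP w hw]
    · intro b _
      by_cases hb : b = a
      · subst hb
        rw [if_pos rfl]
        exact hasRes_eval_self b _
      · rw [if_neg hb]
        exact hasRes_eval_of_ne (fun h => hb (sg_injective h)) _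
  · have h0 : ∑ a, (P a).coeff 0 = 0 := by
      -- Since `f` tends to zero at infinity, the constant terms of the two polynomials cancel.
      have hf0 : Filter.Tendsto f (Bornology.cobounded ℂ) (𝓝 0) := by
        have h1 := hc.mul Filter.tendsto_inv₀_cobounded
        rw [mul_zero] at h1
        refine h1.congr' ?_
        filter_upwards [eventually_cobounded_ne 0] with w hw
        field_simp
      have hf1 : Filter.Tendsto f (Bornology.cobounded ℂ) (𝓝 (∑ a, (P a).eval 0)) := by
        refine Filter.Tendsto.congr' ?_ (tendsto_finsetSum _ fun a _ =>
          ((P a).continuous.tendsto 0).comp (tendsto_inv_sub (sg a)))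
        filter_upwards [hne] with w hw
        rw [hP w hw]
        rfl
      simp_rw [Polynomial.coeff_zero_eq_eval_zero]
      exact tendsto_nhds_unique hf1 hf0
    have h2 : Filter.Tendsto (fun w => w * f w) (Bornology.cobounded ℂ)
        (𝓝 (∑ a, 1 * (P a).divX.eval 0)) := by
      refine Filter.Tendsto.congr' ?_ (tendsto_finsetSum _ fun a _ =>
        (tendsto_mul_inv_sub (sg a)).mul
          (((P a).divX.continuous.tendsto 0).comp (tendsto_inv_sub (sg a))))
      filter_upwards [hne] with w hw
      have e (a : Bool) : (P a).eval (w - sg a)⁻¹ =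
          (P a).divX.eval (w - sg a)⁻¹ * (w - sg a)⁻¹ + (P a).coeff 0 := by
        conv_lhs => rw [← Polynomial.divX_mul_X_add (P a)]
        simp
      rw [hP w hw]
      simp_rw [e, Finset.sum_add_distrib, h0, add_zero, Finset.mul_sum]
      exact Finset.sum_congr rfl fun a _ => by rw [Function.comp_apply]; ring
    have h3 := tendsto_nhds_unique h2 hc
    rw [← h3]
    refine Finset.sum_congr rfl fun a _ => ?_
    rw [one_mul, ← Polynomial.coeff_zero_eq_eval_zero, Polynomial.coeff_divX]

theorem HasRes.unique {f : ℂ → ℂ} {α c d : ℂ} (h1 : HasRes f α c) (h2 : HasRes f α d) : c = d :=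
  h1.residue_eq.symm.trans h2.residue_eq

/-- The difference quotient at a point which is not a branch point. -/
theorem IsRat.exists_slope {f : ℂ → ℂ} (hf : IsRat f) {ζ : ℂ} (hζ : ∀ a, ζ ≠ sg a) :
    ∃ g, IsRat g ∧ ∀ w, (∀ a, w ≠ sg a) → f w = f ζ + (w - ζ) * g w := by
  obtain ⟨P, hP⟩ := hf
  have h (a : Bool) : ∃ Q : Polynomial ℂ, ∀ w, w ≠ sg a → (P a).eval (w - sg a)⁻¹ =
      (P a).eval (ζ - sg a)⁻¹ + (w - ζ) * Q.eval (w - sg a)⁻¹ := by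
    obtain ⟨Q, hQ⟩ := Polynomial.X_sub_C_dvd_sub_C_eval (a := (ζ - sg a)⁻¹) (p := P a)
    refine ⟨Polynomial.C (-(ζ - sg a)⁻¹) * Polynomial.X * Q, fun w hw => ?_⟩
    have h1 := congrArg (Polynomial.eval (w - sg a)⁻¹) hQ
    simp only [Polynomial.eval_sub, Polynomial.eval_C, Polynomial.eval_mul, Polynomial.eval_X] at h1 ⊢
    have h2 : w - sg a ≠ 0 := sub_ne_zero.mpr hw
    have h3 : ζ - sg a ≠ 0 := sub_ne_zero.mpr (hζ a)
    have h4 : (w - sg a)⁻¹ - (ζ - sg a)⁻¹ = (w - ζ) * (-(ζ - sg a)⁻¹ * (w - sg a)⁻¹) := by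
      field_simp
      ring
    linear_combination h1 + Q.eval (w - sg a)⁻¹ * h4
  choose Q hQ using h
  refine ⟨fun w => ∑ a, (Q a).eval (w - sg a)⁻¹, ⟨Q, fun _ _ => rfl⟩, fun w hw => ?_⟩
  rw [hP w hw, hP ζ hζ, Finset.mul_sum, ← Finset.sum_add_distrib]
  exact Finset.sum_congr rfl fun a _ => hQ a w (hw a)

theorem IsRat.differentiableAt {f : ℂ → ℂ} (hf : IsRat f) {ζ : ℂ} (hζ : ∀ a, ζ ≠ sg a) :
    DifferentiableAt ℂ f ζ := by
  obtain ⟨P, hP⟩ := hf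
  have h : DifferentiableAt ℂ (fun w => ∑ a, (P a).eval (w - sg a)⁻¹) ζ := by
    refine DifferentiableAt.fun_sum fun a _ => ?_
    exact DifferentiableAt.comp (g := fun u => (P a).eval u) ζ (P a).differentiableAt
      ((differentiableAt_id.sub_const _).inv (sub_ne_zero.mpr (hζ a)))
  refine h.congr_of_eventuallyEq ?_
  have h1 : ∀ᶠ w in 𝓝 ζ, w ≠ sg true := continuousAt_id.eventually_ne (hζ true)
  have h2 : ∀ᶠ w in 𝓝 ζ, w ≠ sg false := continuousAt_id.eventually_ne (hζ false)
  filter_upwards [h1, h2] with w h1 h2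
  exact hP w (by rintro (_ | _) <;> assumption)

/-- The sum of the residues of `f (w) / (w - ζ) ^ 2` at the branch points. -/
theorem IsRat.hasRes_div_sq {f : ℂ → ℂ} (hf : IsRat f) {ζ : ℂ} (hζ : ∀ a, ζ ≠ sg a) :
    ∃ r : Bool → ℂ, (∀ a, HasRes (fun w => f w / (w - ζ) ^ 2) (sg a) (r a)) ∧
      ∑ a, r a = -deriv f ζ := by
  obtain ⟨g, hg, hfg⟩ := hf.exists_slope hζ
  obtain ⟨h, hh, hgh⟩ := hg.exists_slope hζ
  have hne : ∀ᶠ w in Bornology.cobounded ℂ, ∀ a, w ≠ sg a := by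
    filter_upwards [eventually_cobounded_ne (sg true), eventually_cobounded_ne (sg false)] with w h1 h2
    rintro (_ | _) <;> assumption
  have hderiv : deriv f ζ = g ζ := by
    have h1 : ∀ᶠ w in 𝓝 ζ, w ≠ sg true := continuousAt_id.eventually_ne (hζ true)
    have h2 : ∀ᶠ w in 𝓝 ζ, w ≠ sg false := continuousAt_id.eventually_ne (hζ false)
    have h3 : f =ᶠ[𝓝 ζ] fun w => f ζ + (w - ζ) * g w := by
      filter_upwards [h1, h2] with w h1 h2
      exact hfg w (by rintro (_ | _) <;> assumption)
    rw [h3.deriv_eq]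
    have h4 := (((hasDerivAt_id ζ).sub_const ζ).mul (hg.differentiableAt hζ).hasDerivAt).const_add (f ζ)
    simp only [id, sub_self, zero_mul, add_zero, one_mul] at h4
    exact h4.deriv
  obtain ⟨c, hc⟩ := hf.tendsto
  have hlim : Filter.Tendsto (fun w => w * h w) (Bornology.cobounded ℂ) (𝓝 (-g ζ)) := by
    have h1 := ((tendsto_mul_inv_sub ζ).mul ((tendsto_inv_sub ζ).mul (hc.sub_const (f ζ)))).sub
      ((tendsto_mul_inv_sub ζ).mul_const (g ζ))
    rw [zero_mul, mul_zero, zero_sub, one_mul] at h1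
    refine h1.congr' ?_
    filter_upwards [hne, eventually_cobounded_ne ζ] with w hw hwζ
    have h2 : w - ζ ≠ 0 := sub_ne_zero.mpr hwζ
    rw [hfg w hw, hgh w hw]
    field_simp
    ring
  obtain ⟨r, hr, hsum⟩ := hh.hasRes hlim
  refine ⟨r, fun a => ?_, by rw [hsum, hderiv]⟩
  have h1 := hasRes_eval_of_ne (hζ a) (Polynomial.C (f ζ) * Polynomial.X ^ 2 +
    Polynomial.C (g ζ) * Polynomial.X)
  have h2 := (hr a).add h1
  rw [add_zero] at h2
  refine h2.congr ?_
  have h3 : ∀ᶠ w in 𝓝 (sg a), w ≠ ζ := continuousAt_id.eventually_ne (hζ a).symm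
  filter_upwards [eventually_ne_sg a, nhdsWithin_le_nhds h3] with w hw hwζ
  have h2 : w - ζ ≠ 0 := sub_ne_zero.mpr hwζ
  rw [hfg w hw, hgh w hw]
  simp only [Polynomial.eval_add, Polynomial.eval_mul, Polynomial.eval_C, Polynomial.eval_pow,
    Polynomial.eval_X]
  field_simp
  ring

/-! ### The basis differentials are rational -/

/-- Inversion reverses the sign of `t d/dt`, which takes `t * phi n t` to `t * phi (n + 1) t`. -/
theorem phi_inv (n : ℕ) {t : ℂ} (h0 : t ≠ 0) (h1 : t ≠ 1) :
    t⁻¹ * phi n t⁻¹ = (-1) ^ n * (t * phi n t) := by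
  induction n generalizing t with
  | zero =>
    have h2 : t - 1 ≠ 0 := sub_ne_zero.mpr h1
    have h3 : 1 - t ≠ 0 := sub_ne_zero.mpr h1.symm
    rw [phi_zero, phi_zero, show t⁻¹ - 1 = (1 - t) * t⁻¹ by field_simp]
    field_simp
    ring
  | succ n ih =>
    have hev : ∀ᶠ u in 𝓝 t, u⁻¹ * phi n u⁻¹ = (-1) ^ n * (u * phi n u) := by
      have e0 : ∀ᶠ u in 𝓝 t, u ≠ 0 := continuousAt_id.eventually_ne h0
      have e1 : ∀ᶠ u in 𝓝 t, u ≠ 1 := continuousAt_id.eventually_ne h1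
      filter_upwards [e0, e1] with u hu0 hu1
      exact ih hu0 hu1
    have hinv : t⁻¹ ≠ 1 := fun h => h1 (inv_eq_one.mp h)
    have d1 : HasDerivAt (fun u => u⁻¹ * phi n u⁻¹) (phi (n + 1) t⁻¹ * -(t ^ 2)⁻¹) t :=
      HasDerivAt.comp (h₂ := fun u => u * phi n u) t (hasDerivAt_mul_phi n hinv) (hasDerivAt_inv h0)
    have d2 := (hasDerivAt_mul_phi n h1).const_mul ((-1) ^ n)
    have h := d1.unique (d2.congr_of_eventuallyEq hev)
    have h2 : t⁻¹ * phi (n + 1) t⁻¹ = -(phi (n + 1) t⁻¹ * -(t ^ 2)⁻¹) * t := by field_simp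
    rw [h2, h]
    ring

theorem basis_inv (j : Mode) {z : ℂ} (h0 : z ≠ 0) (h1 : z ≠ sg j.1) :
    z⁻¹ * basis j z⁻¹ = z * basis j z := by
  have hs := sg_mul_self j.1
  have e : sg j.1 * z⁻¹ = (sg j.1 * z)⁻¹ := by
    rw [mul_inv, inv_eq_of_mul_eq_one_left hs]
  have h := phi_inv (2 * j.2) (t := sg j.1 * z) (mul_ne_zero (sg_ne_zero _) h0) fun h => h1 (by
    linear_combination sg j.1 * h - z * hs)
  rw [(even_two_mul _).neg_one_pow, one_mul, ← e] at h
  rw [basis, basis]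
  linear_combination h / (2 * j.2).factorial

/-- As a differential `basis j` changes its sign under the involution. -/
theorem basis_inv' (j : Mode) {z : ℂ} (h0 : z ≠ 0) (h1 : z ≠ sg j.1) :
    basis j z⁻¹ = z ^ 2 * basis j z := by
  have h : z * (z⁻¹ * basis j z⁻¹) = z * (z * basis j z) := by rw [basis_inv j h0 h1]
  rwa [mul_inv_cancel_left₀ h0, ← mul_assoc, ← sq] at h

theorem exists_phiPoly_eq (n : ℕ) : ∃ r : Polynomial ℂ, phiPoly n = Polynomial.X ^ 2 * r := by
  induction n with
  | zero => exact ⟨1, by rw [phiPoly, mul_one]⟩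
  | succ n ih =>
    obtain ⟨r, hr⟩ := ih
    refine ⟨r - (Polynomial.X + 1) * (2 * r + Polynomial.X * Polynomial.derivative r), ?_⟩
    rw [phiPoly, hr]
    simp only [Polynomial.derivative_mul, Polynomial.derivative_X_pow]
    rw [show Polynomial.C ((2 : ℕ) : ℂ) = 2 from rfl]
    ring

/-- The coefficient has a double zero at infinity, which leaves room for one factor `w` in the
divisor equation. -/
theorem basis_eq_mul (j : Mode) : ∃ h, IsRat h ∧ ∀ w, (∀ a, w ≠ sg a) →
    basis j w = (w - sg j.1)⁻¹ * ((w - sg j.1)⁻¹ * h w) := by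
  obtain ⟨r, hr⟩ := exists_phiPoly_eq (2 * j.2)
  have hs := sg_mul_self j.1
  refine ⟨fun w => sg j.1 / (2 * j.2).factorial *
    (r.comp (Polynomial.C (sg j.1) * Polynomial.X)).eval (w - sg j.1)⁻¹,
    (isRat_eval _ _).const_mul _, fun w hw => ?_⟩
  have h1 : w - sg j.1 ≠ 0 := sub_ne_zero.mpr (hw _)
  have e : (sg j.1 * w - 1)⁻¹ = sg j.1 * (w - sg j.1)⁻¹ := by
    rw [show sg j.1 * w - 1 = sg j.1 * (w - sg j.1) by linear_combination hs, mul_inv,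
      inv_eq_of_mul_eq_one_left hs]
  rw [basis, phi, hr, e]
  simp only [Polynomial.eval_mul, Polynomial.eval_pow, Polynomial.eval_X, Polynomial.eval_comp,
    Polynomial.eval_C]
  linear_combination sg j.1 / (2 * j.2).factorial * (w - sg j.1)⁻¹ ^ 2 *
    r.eval (sg j.1 * (w - sg j.1)⁻¹) * hs

theorem isRat_basis (j : Mode) : IsRat (basis j) := by
  obtain ⟨h, hh, he⟩ := basis_eq_mul j
  exact ((hh.inv_mul j.1).inv_mul j.1).congr he

theorem isRat_mul_basis (j : Mode) : IsRat fun w => w * basis j w := by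
  obtain ⟨h, hh, he⟩ := basis_eq_mul j
  refine ((hh.inv_mul j.1).add (((hh.inv_mul j.1).inv_mul j.1).const_mul (sg j.1))).congr
    fun w hw => ?_
  have h1 : w - sg j.1 ≠ 0 := sub_ne_zero.mpr (hw _)
  rw [he w hw]
  field_simp
  ring

theorem tendsto_mul_basis (j : Mode) :
    Filter.Tendsto (fun w => w * basis j w) (Bornology.cobounded ℂ) (𝓝 0) := by
  obtain ⟨h, hh, he⟩ := basis_eq_mul j
  obtain ⟨c, hc⟩ := hh.tendsto
  have h1 := (tendsto_mul_inv_sub (sg j.1)).mul ((tendsto_inv_sub (sg j.1)).mul hc)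
  rw [zero_mul, mul_zero] at h1
  refine h1.congr' ?_
  filter_upwards [eventually_cobounded_ne (sg true), eventually_cobounded_ne (sg false)] with w h1 h2
  rw [he w (by rintro (_ | _) <;> assumption)]
  ring

/-! ### The vector fields of the string and divisor equations -/

/-- The function `x ^ J / x'`. -/
def stringFactor (J : ℕ) (w : ℂ) : ℂ := w ^ (2 - J) * (w ^ 2 + 1) ^ J / (w ^ 2 - 1)

/-- Takes the place of `kernelForm`. The factor `1 / w ^ 2` compensates `basis j (hat w) = w ^ 2 *
basis j w`, so the integrand becomes half of `x ^ J / x'` times two basis differentials at the same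
point. -/
def stringKernel (J : ℕ) (w : ℂ) : ℂ := stringFactor J w / (2 * w ^ 2)

def stringPsi (J : ℕ) (a : Bool) (s : ℂ) : ℂ :=
  (2 * sg a * Complex.cosh s) ^ J / (4 * sg a * dslope Complex.sinh 0 s)

/-- The Taylor coefficients of `s * x ^ J / (4 * sg a * sinh s)`. -/
def stringVector (J : ℕ) (k : Mode) : ℂ := evenCoeff (stringPsi J k.1) k.2

theorem mul_dslope_sinh (s : ℂ) : s * dslope Complex.sinh 0 s = Complex.sinh s := by
  have := sub_smul_dslope Complex.sinh 0 s
  rwa [sub_zero, smul_eq_mul, Complex.sinh_zero, sub_zero] at this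

theorem analyticAt_stringPsi (J : ℕ) (a : Bool) : AnalyticAt ℂ (stringPsi J a) 0 := by
  have h1 : AnalyticAt ℂ Complex.cosh 0 := Complex.differentiable_cosh.analyticAt 0
  have h2 : AnalyticAt ℂ Complex.sinh 0 := Complex.differentiable_sinh.analyticAt 0
  refine ((analyticAt_const.mul h1).pow J).div (analyticAt_const.mul (analyticAt_dslope h2)) ?_
  rw [dslope_same, Complex.deriv_sinh, Complex.cosh_zero, mul_one]
  exact mul_ne_zero (by norm_num) (sg_ne_zero a)

theorem stringPsi_even (J : ℕ) (a : Bool) (s : ℂ) : stringPsi J a (-s) = stringPsi J a s := by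
  by_cases hs : s = 0
  · simp [hs]
  · have h1 := mul_dslope_sinh (-s)
    have h2 := mul_dslope_sinh s
    rw [Complex.sinh_neg, ← h2, neg_mul] at h1
    have h3 := mul_left_cancel₀ hs (neg_injective h1)
    rw [stringPsi, stringPsi, h3, Complex.cosh_neg]

theorem isLocalKernel_stringKernel {J : ℕ} (hJ : J ≤ 2) (a : Bool) :
    IsLocalKernel a (stringKernel J) (stringPsi J a) := by
  refine ⟨analyticAt_stringPsi J a, Filter.Eventually.of_forall (stringPsi_even J a), ?_⟩
  have hne : ∀ᶠ w in 𝓝[≠] (sg a), localCoord a w ≠ 0 :=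
    (tendsto_localCoord a).eventually self_mem_nhdsWithin
  filter_upwards [hne, eventually_ne_sg a, eventually_ne_zero a,
    nhdsWithin_le_nhds (eventually_slitPlane a)] with w h1 h2 h3 h4
  have hsq : w ^ 2 - 1 ≠ 0 := by
    have e : w ^ 2 - 1 = (w - sg true) * (w - sg false) := by simp [sg]; ring
    rw [e]
    exact mul_ne_zero (sub_ne_zero.mpr (h2 _)) (sub_ne_zero.mpr (h2 _))
  have hs := sg_mul_self a
  have c1 : 2 * sg a * Complex.cosh (localCoord a w) = w + w⁻¹ := by
    rw [Complex.cosh]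
    linear_combination sg_mul_exp_localCoord a h3 + sg_mul_exp_neg_localCoord a h3
  have c2 : 4 * sg a * Complex.sinh (localCoord a w) = 2 * (w - w⁻¹) := by
    rw [Complex.sinh]
    linear_combination 2 * sg_mul_exp_localCoord a h3 - 2 * sg_mul_exp_neg_localCoord a h3
  rw [← mul_dslope_sinh] at c2
  have c3 : (localCoord a w)⁻¹ * stringPsi J a (localCoord a w) =
      (w + w⁻¹) ^ J / (2 * (w - w⁻¹)) := by
    rw [stringPsi, c1, ← c2]
    field_simp
  rw [c3, (hasDerivAt_localCoord a h4).deriv, stringKernel, stringFactor]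
  have c4 : w + w⁻¹ = (w ^ 2 + 1) * w⁻¹ := by field_simp
  have c5 : w - w⁻¹ = (w ^ 2 - 1) * w⁻¹ := by field_simp
  have c6 : w ^ (2 - J) * w ^ J = w ^ 2 := by rw [← pow_add, Nat.sub_add_cancel hJ]
  rw [c4, c5, mul_pow, inv_pow]
  field_simp
  linear_combination (w ^ 2 + 1) ^ J * c6

theorem sq_sub_one_inv (w : ℂ) :
    (w ^ 2 - 1)⁻¹ = (w - sg true)⁻¹ * (w - sg false)⁻¹ := by
  rw [← mul_inv]
  congr 1
  simp [sg]
  ring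

theorem sq_sub_one_ne_zero {w : ℂ} (hw : ∀ a, w ≠ sg a) : w ^ 2 - 1 ≠ 0 := by
  have e : w ^ 2 - 1 = (w - sg true) * (w - sg false) := by simp [sg]; ring
  rw [e]
  exact mul_ne_zero (sub_ne_zero.mpr (hw _)) (sub_ne_zero.mpr (hw _))

theorem exists_stringFactor_eq {J : ℕ} (hJ : J ≤ 1) :
    ∃ f, IsRat f ∧ ∀ w, (∀ a, w ≠ sg a) → stringFactor J w = w ^ J * f w := by
  have hr : IsRat fun w => (w - sg true)⁻¹ * (w - sg false)⁻¹ :=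
    ((isRat_eval false Polynomial.X).inv_mul true).congr fun w _ => by rw [Polynomial.eval_X]
  refine ⟨fun w => 1 + (J + 1) * ((w - sg true)⁻¹ * (w - sg false)⁻¹),
    (isRat_const 1).add (hr.const_mul _), fun w hw => ?_⟩
  have h := sq_sub_one_ne_zero hw
  change stringFactor J w = w ^ J * (1 + (J + 1) * ((w - sg true)⁻¹ * (w - sg false)⁻¹))
  rw [← sq_sub_one_inv, stringFactor]
  interval_cases J
  · simp only [Nat.cast_zero]
    field_simp
    ring
  · simp only [Nat.cast_one]
    field_simp
    ring

theorem isRat_pow_mul_basis {J : ℕ} (hJ : J ≤ 1) (j : Mode) : IsRat fun w => w ^ J * basis j w := by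
  interval_cases J
  · exact (isRat_basis j).congr fun w _ => by ring
  · exact (isRat_mul_basis j).congr fun w _ => by ring

/-- The quotient of the differential `x ^ J * basis j dw` by `dx`. -/
def stringFun (J : ℕ) (j : Mode) (w : ℂ) : ℂ := stringFactor J w * basis j w

theorem isRat_stringFun {J : ℕ} (hJ : J ≤ 1) (j : Mode) : IsRat (stringFun J j) := by
  obtain ⟨f, hf, he⟩ := exists_stringFactor_eq hJ
  refine (hf.mul (isRat_pow_mul_basis hJ j)).congr fun w hw => ?_
  rw [stringFun, he w hw]
  ring

theorem sum_univ_product_range (M : ℕ) (f : Mode → ℂ) :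
    ∑ k ∈ (Finset.univ : Finset Bool) ×ˢ Finset.range M, f k =
      ∑ a, ∑ k ∈ Finset.range M, f (a, k) := Finset.sum_product _ _ _

theorem basis_hat_eventually (a : Bool) (j : Mode) :
    ∀ᶠ w in 𝓝[≠] (sg a), basis j (hat w) = w ^ 2 * basis j w := by
  filter_upwards [eventually_ne_sg a, eventually_ne_zero a] with w hw h0
  exact basis_inv' j h0 (hw _)

/-- The part of the sum at each branch point is the residue there of half of `x ^ J / x'` times the
product of the two basis functions. For `J ≤ 1` there is no residue at infinity, so the total
vanishes. This is the hypothesis of `IsFreeEnergy.string`. -/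
theorem sum_stringVector_mul_virForm {J : ℕ} (hJ : J ≤ 1) (i j : Mode) (M : ℕ)
    (hM : i.2 + j.2 + 3 ≤ M) : ∑ k ∈ (Finset.univ : Finset Bool) ×ˢ Finset.range M,
      stringVector J k * virForm regCoeff k.1 k.2 i j = 0 := by
  obtain ⟨f, hf, he⟩ := exists_stringFactor_eq hJ
  have hrat := (hf.mul ((isRat_pow_mul_basis hJ i).mul (isRat_basis j))).const_mul (1 / 2)
  have hlim : Filter.Tendsto (fun w => w * (1 / 2 * (f w * (w ^ J * basis i w * basis j w))))
      (Bornology.cobounded ℂ) (𝓝 0) := by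
    obtain ⟨c, hc⟩ := hf.tendsto
    obtain ⟨d, hd⟩ := (isRat_pow_mul_basis hJ i).tendsto
    have h := ((hc.mul hd).mul (tendsto_mul_basis j)).const_mul (1 / 2)
    rw [mul_zero, mul_zero] at h
    refine h.congr fun w => ?_
    ring
  obtain ⟨r, hr, hsum⟩ := hrat.hasRes hlim
  rw [sum_univ_product_range, ← hsum]
  refine Finset.sum_congr rfl fun a _ => ?_
  refine (hasRes_basis_basis (isLocalKernel_stringKernel (by omega) a) i j hM).unique ?_
  refine (hr a).congr ?_
  filter_upwards [eventually_ne_sg a, eventually_ne_zero a, basis_hat_eventually a j] with w hw h0 hj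
  rw [hj, stringKernel, he w hw]
  field_simp

theorem IsRat.eventually_deriv_inv {f : ℂ → ℂ} (hf : IsRat f)
    (hinv : ∀ w, w ≠ 0 → (∀ a, w ≠ sg a) → f w⁻¹ = -f w) {z : ℂ} (h0 : z ≠ 0)
    (hz : ∀ a, z ≠ sg a) : deriv f z⁻¹ * (z ^ 2)⁻¹ = deriv f z := by
  have hzi (a : Bool) : z⁻¹ ≠ sg a := fun h => hz a (by
    rw [← inv_inv z, h, inv_eq_of_mul_eq_one_left (sg_mul_self a)])
  have e0 : ∀ᶠ u in 𝓝 z, u ≠ 0 := continuousAt_id.eventually_ne h0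
  have e1 : ∀ᶠ u in 𝓝 z, u ≠ sg true := continuousAt_id.eventually_ne (hz true)
  have e2 : ∀ᶠ u in 𝓝 z, u ≠ sg false := continuousAt_id.eventually_ne (hz false)
  have hev : (fun u => f u⁻¹) =ᶠ[𝓝 z] fun u => -f u := by
    filter_upwards [e0, e1, e2] with u h0 h1 h2
    exact hinv u h0 (by rintro (_ | _) <;> assumption)
  have d1 : HasDerivAt (fun u => f u⁻¹) (deriv f z⁻¹ * -(z ^ 2)⁻¹) z :=
    HasDerivAt.comp (h₂ := f) z (hf.differentiableAt hzi).hasDerivAt (hasDerivAt_inv h0)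
  have d2 := (hf.differentiableAt hz).hasDerivAt.neg
  have := d1.unique (d2.congr_of_eventuallyEq hev)
  linear_combination -this

theorem stringFun_inv {J : ℕ} (hJ : J ≤ 1) (j : Mode) (w : ℂ) (h0 : w ≠ 0) (hw : ∀ a, w ≠ sg a) :
    stringFun J j w⁻¹ = -stringFun J j w := by
  have h1 := sq_sub_one_ne_zero hw
  have h2 : (w⁻¹) ^ 2 - 1 = -(w ^ 2 - 1) * (w ^ 2)⁻¹ := by
    field_simp
    ring
  rw [stringFun, stringFun, basis_inv' j h0 (hw _), stringFactor, stringFactor, h2]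
  interval_cases J
  · simp only [Nat.sub_zero, pow_zero, mul_one]
    field_simp
  · simp only [show 2 - 1 = 1 from rfl, pow_one]
    field_simp
    ring

/-- The action of the vector field of the string or divisor equation on the basis differentials. -/
theorem dirDeriv_stringField {J : ℕ} (hJ : J ≤ 1) (j : Mode) {z : ℂ} (h0 : z ≠ 0)
    (hz : ∀ a, z ≠ sg a) :
    dirDeriv (ev z) (stringField regCoeff (stringVector J) j) = C (-deriv (stringFun J j) z) := by
  have hzi (a : Bool) : z⁻¹ ≠ sg a := fun h => hz a (by
    rw [← inv_inv z, h, inv_eq_of_mul_eq_one_left (sg_mul_self a)])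
  have hrat := isRat_stringFun hJ j
  obtain ⟨r, hr, hrsum⟩ := hrat.hasRes_div_sq hz
  obtain ⟨r', hr', hrsum'⟩ := hrat.hasRes_div_sq hzi
  have hderiv := hrat.eventually_deriv_inv (stringFun_inv hJ j) h0 hz
  unfold stringField
  simp_rw [map_sum, derivation_C_mul', dirDeriv_virField, ← C_mul, ← map_sum]
  congr 1
  rw [sum_univ_product_range]
  -- The integrand has double poles at `z` and at `1/z`, from the two Bergmann kernels; as
  -- `stringFun J j` is odd under inversion, each accounts for half of the derivative.
  have e : -deriv (stringFun J j) z = ∑ a, (1 / 2 * r a + 1 / 2 * (z ^ 2)⁻¹ * r' a) := by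
    rw [Finset.sum_add_distrib, ← Finset.mul_sum, ← Finset.mul_sum, hrsum, hrsum', ← hderiv]
    ring
  rw [e]
  refine Finset.sum_congr rfl fun a _ => ?_
  refine (hasRes_bergmann_basis (isLocalKernel_stringKernel (by omega) a) (hz a) j le_rfl).unique ?_
  refine (((hr a).const_mul (1 / 2)).add ((hr' a).const_mul (1 / 2 * (z ^ 2)⁻¹))).congr ?_
  have h4 : ∀ᶠ w in 𝓝 (sg a), w ≠ z := continuousAt_id.eventually_ne (hz a).symm
  have h5 : ∀ᶠ w in 𝓝 (sg a), w ≠ z⁻¹ := continuousAt_id.eventually_ne (hzi a).symm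
  filter_upwards [eventually_ne_zero a, basis_hat_eventually a j, nhdsWithin_le_nhds h4,
    nhdsWithin_le_nhds h5] with w hw0 hj h4 h5
  have h4' : w - z ≠ 0 := sub_ne_zero.mpr h4
  have h5' : w - z⁻¹ ≠ 0 := sub_ne_zero.mpr h5
  have h6 : w⁻¹ - z = -(w - z⁻¹) * (z * w⁻¹) := by
    field_simp
    ring
  rw [hj, stringKernel, stringFun, bergmann, bergmann, hat, h6]
  generalize w - z⁻¹ = A at *
  field_simp

theorem taylorCoeff_id_mul {g : ℂ → ℂ} (hg : AnalyticAt ℂ g 0) (n : ℕ) :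
    taylorCoeff (fun s => s * g s) (n + 1) = taylorCoeff g n := by
  have h := taylorCoeff_dslope (f := fun s => s * g s) (analyticAt_id.mul hg) n
  rw [← h]
  refine taylorCoeff_congr (Filter.Eventually.of_forall fun s => ?_) n
  by_cases hs : s = 0
  · subst hs
    rw [dslope_same]
    have := (hasDerivAt_id (0 : ℂ)).mul hg.differentiableAt.hasDerivAt
    simp only [id, one_mul, zero_mul, add_zero] at this
    exact this.deriv
  · rw [dslope_of_ne _ hs, slope_def_field]
    field_simp
    ring

/-- `stringPsi` times `4 * sg a * sinh s` is `s * x ^ J` with `x = 2 * sg a * cosh s`, and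
`dualCoeff` consists of the Taylor coefficients of the hyperbolic sine. -/
theorem stringCoeff_stringVector (J : ℕ) (j : Mode) : stringCoeff (stringVector J) j =
    (2 * j.2 + 1) * taylorCoeff (fun s => (2 * sg j.1 * Complex.cosh s) ^ J) (2 * j.2) := by
  have hc : AnalyticAt ℂ (fun s => (2 * sg j.1 * Complex.cosh s) ^ J) 0 :=
    (analyticAt_const.mul (Complex.differentiable_cosh.analyticAt 0)).pow J
  have hS : AnalyticAt ℂ (fun s : ℂ => 4 * sg j.1 * Complex.sinh s) 0 :=
    analyticAt_const.mul (Complex.differentiable_sinh.analyticAt 0)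
  have hne : ∀ᶠ s in 𝓝 (0 : ℂ), dslope Complex.sinh 0 s ≠ 0 := by
    refine (analyticAt_dslope (Complex.differentiable_sinh.analyticAt 0)).continuousAt.eventually_ne ?_
    rw [dslope_same, Complex.deriv_sinh, Complex.cosh_zero]
    exact one_ne_zero
  have hF : (fun s => stringPsi J j.1 s * (4 * sg j.1 * Complex.sinh s)) =ᶠ[𝓝 0]
      fun s => s * (2 * sg j.1 * Complex.cosh s) ^ J := by
    filter_upwards [hne] with s hs
    have := sg_ne_zero j.1
    rw [← mul_dslope_sinh, stringPsi]
    field_simp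
  have h1 := taylorCoeff_congr hF (2 * j.2 + 1)
  rw [taylorCoeff_id_mul hc, taylorCoeff_even_mul (analyticAt_stringPsi J j.1) hS
    (Filter.Eventually.of_forall (stringPsi_even J j.1)), show (2 * j.2 + 1) / 2 = j.2 by omega] at h1
  rw [← h1, stringCoeff, sum_univ_product_range, Finset.sum_eq_single_of_mem j.1 (Finset.mem_univ _),
    Finset.mul_sum]
  · refine Finset.sum_congr rfl fun k hk => ?_
    have hk' : k ≤ j.2 := Nat.lt_succ_iff.mp (Finset.mem_range.mp hk)
    rw [show 2 * j.2 + 1 - 2 * k = 2 * (j.2 - k) + 1 by omega,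
      taylorCoeff_const_mul _ (Complex.differentiable_sinh.analyticAt 0)]
    rw [taylorCoeff, taylorCoeff, Complex.iteratedDeriv_odd_sinh, Complex.cosh_zero, stringVector,
      evenCoeff, taylorCoeff, dualCoeff, if_pos ⟨rfl, hk'⟩]
    ring
  · intro b _ hb
    refine Finset.sum_eq_zero fun k _ => ?_
    rw [dualCoeff, if_neg fun h => hb h.1.symm, mul_zero]

theorem stringCoeff_zero (j : Mode) : stringCoeff (stringVector 0) j = if j.2 = 0 then 1 else 0 := by
  rw [stringCoeff_stringVector]
  simp only [pow_zero, taylorCoeff_const]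
  by_cases h : j.2 = 0 <;> simp [h]

theorem stringCoeff_one (j : Mode) :
    stringCoeff (stringVector 1) j = (2 * j.2 + 1) * (2 * sg j.1 / (2 * j.2).factorial) := by
  rw [stringCoeff_stringVector]
  simp only [pow_one]
  rw [taylorCoeff_const_mul _ (Complex.differentiable_cosh.analyticAt 0), taylorCoeff,
    Complex.iteratedDeriv_even_cosh, Complex.cosh_zero]
  ring

/-! ### Laurent series at infinity -/

/-- `f (x) = ∑ c b / x ^ (b + 1)` for `2 < |x|`. -/
def HasX (c : ℕ → ℂ) (f : ℂ → ℂ) : Prop :=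
  ∀ x : ℂ, 2 < ‖x‖ → HasSum (fun b => c b * (x ^ (b + 1))⁻¹) (f x)

theorem HasX.add {c d : ℕ → ℂ} {f g : ℂ → ℂ} (hf : HasX c f) (hg : HasX d g) :
    HasX (fun b => c b + d b) fun x => f x + g x := fun x hx => by
  simpa only [add_mul] using (hf x hx).add (hg x hx)

theorem HasX.const_mul {c : ℕ → ℂ} {f : ℂ → ℂ} (hf : HasX c f) (a : ℂ) :
    HasX (fun b => a * c b) fun x => a * f x := fun x hx => by
  simpa only [mul_assoc] using (hf x hx).mul_left a

theorem HasX.sum {κ : Type*} {t : Finset κ} {c : κ → ℕ → ℂ} {f : κ → ℂ → ℂ}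
    (h : ∀ k ∈ t, HasX (c k) (f k)) : HasX (fun b => ∑ k ∈ t, c k b) fun x => ∑ k ∈ t, f k x :=
  fun x hx => by simpa only [Finset.sum_mul] using hasSum_sum fun k hk => h k hk x hx

theorem HasX.congr {c : ℕ → ℂ} {f g : ℂ → ℂ} (hf : HasX c f) (h : ∀ x, 2 < ‖x‖ → g x = f x) :
    HasX c g := fun x hx => by rw [h x hx]; exact hf x hx

theorem HasX.congr_coeff {c d : ℕ → ℂ} {f : ℂ → ℂ} (hf : HasX c f) (h : ∀ b, d b = c b) :
    HasX d f := by rwa [show d = c from funext h]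

theorem norm_pos_ne_zero {x : ℂ} (hx : 2 < ‖x‖) : x ≠ 0 := by
  rintro rfl
  rw [norm_zero] at hx
  linarith

theorem HasX.mul_x {c : ℕ → ℂ} {f : ℂ → ℂ} (hf : HasX c f) (h0 : c 0 = 0) :
    HasX (fun b => c (b + 1)) fun x => x * f x := fun x hx => by
  have h := (hasSum_nat_add_iff' 1).mpr (hf x hx)
  rw [Finset.sum_range_one, h0, zero_mul, sub_zero] at h
  have hx0 := norm_pos_ne_zero hx
  refine (h.mul_left x).congr_fun ?_
  intro b
  field_simp
  ring

theorem HasX.div_x {c : ℕ → ℂ} {f : ℂ → ℂ} (hf : HasX c f) :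
    HasX (fun b => if b = 0 then 0 else c (b - 1)) fun x => x⁻¹ * f x := fun x hx => by
  have hx0 := norm_pos_ne_zero hx
  rw [← hasSum_nat_add_iff' 1]
  dsimp only
  rw [Finset.sum_range_one, if_pos rfl, zero_mul, sub_zero]
  refine ((hf x hx).mul_left x⁻¹).congr_fun ?_
  intro b
  rw [if_neg (Nat.succ_ne_zero b), Nat.add_sub_cancel]
  field_simp
  ring

/-- Convergence at one point of modulus between `2` and `r` dominates the series on all of `r <
|w|`, so it may be differentiated termwise. -/
theorem HasX.hasDerivAt {c : ℕ → ℂ} {f : ℂ → ℂ} (hf : HasX c f) {x : ℂ} (hx : 2 < ‖x‖) :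
    HasDerivAt f (deriv f x) x ∧
      HasSum (fun b : ℕ => -((b : ℂ) + 1) * c b * (x ^ (b + 2))⁻¹) (deriv f x) := by
  obtain ⟨r, hr2, hrx⟩ := exists_between hx
  set U : Set ℂ := {w | r < ‖w‖} with hU
  have hUo : IsOpen U := isOpen_lt continuous_const continuous_norm
  have hr0 : 0 < r := by linarith
  have hsum : Summable fun b => ‖c b‖ * (r ^ (b + 1))⁻¹ := by
    have hm : 2 < ‖(((2 + r) / 2 : ℝ) : ℂ)‖ := by
      rw [Complex.norm_real, Real.norm_eq_abs, abs_of_pos (by linarith)]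
      linarith
    have h1 := (hf _ hm).summable.norm
    refine h1.of_nonneg_of_le (fun b => by positivity) fun b => ?_
    rw [norm_mul, norm_inv, norm_pow, Complex.norm_real, Real.norm_eq_abs, abs_of_pos (by linarith)]
    have : (2 + r) / 2 ≤ r := by linarith
    gcongr
  have hne (w : ℂ) (hw : w ∈ U) : w ≠ 0 := fun h => by
    have : r < ‖w‖ := hw
    rw [h, norm_zero] at this
    linarith
  have hdF (b : ℕ) (w : ℂ) (hw : w ∈ U) : HasDerivAt (fun w => c b * (w ^ (b + 1))⁻¹)
      (-((b : ℂ) + 1) * c b * (w ^ (b + 2))⁻¹) w := by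
    have hw0 := hne w hw
    have h := ((hasDerivAt_pow (b + 1) w).inv (pow_ne_zero _ hw0)).const_mul (c b)
    refine h.congr_deriv ?_
    rw [Nat.add_sub_cancel]
    push_cast
    field_simp
    ring
  have hdiff (b : ℕ) : DifferentiableOn ℂ (fun w => c b * (w ^ (b + 1))⁻¹) U := fun w hw =>
    (hdF b w hw).differentiableAt.differentiableWithinAt
  have hle (b : ℕ) (w : ℂ) (hw : w ∈ U) :
      ‖c b * (w ^ (b + 1))⁻¹‖ ≤ ‖c b‖ * (r ^ (b + 1))⁻¹ := by
    rw [norm_mul, norm_inv, norm_pow]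
    have : r ≤ ‖w‖ := le_of_lt hw
    gcongr
  have hxU : x ∈ U := hrx
  have hev : f =ᶠ[𝓝 x] fun w => ∑' b, c b * (w ^ (b + 1))⁻¹ := by
    filter_upwards [hUo.mem_nhds hxU] with w hw
    exact (hf w (hr2.trans hw)).tsum_eq.symm
  have h1 := Complex.hasSum_deriv_of_summable_norm hsum hdiff hUo hle hxU
  have h2 := Complex.differentiableOn_tsum_of_summable_norm hsum hdiff hUo hle
  rw [← hev.deriv_eq] at h1
  refine ⟨?_, h1.congr_fun fun b => ((hdF b x hxU).deriv).symm⟩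
  exact ((h2.differentiableAt (hUo.mem_nhds hxU)).congr_of_eventuallyEq hev).hasDerivAt

theorem HasX.hasX_deriv {c : ℕ → ℂ} {f : ℂ → ℂ} (hf : HasX c f) :
    HasX (fun b => -(b : ℂ) * c (b - 1)) (deriv f) := fun x hx => by
  rw [← hasSum_nat_add_iff' 1]
  dsimp only
  rw [Finset.sum_range_one, Nat.cast_zero, neg_zero, zero_mul, zero_mul, sub_zero]
  refine (hf.hasDerivAt hx).2.congr_fun fun b => ?_
  rw [Nat.add_sub_cancel]
  push_cast
  ring

theorem eq_zero_of_hasSum_pow {A : ℕ → ℂ} {δ : ℝ} (hδ : 0 < δ)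
    (h : ∀ t : ℂ, t ≠ 0 → ‖t‖ < δ → HasSum (fun b => A b * t ^ (b + 1)) 0) : A = 0 := by
  set p : FormalMultilinearSeries ℂ ℂ ℂ :=
    FormalMultilinearSeries.ofScalars ℂ fun b => if b = 0 then 0 else A (b - 1) with hp
  have hps : HasFPowerSeriesAt (0 : ℂ → ℂ) p 0 := by
    rw [hasFPowerSeriesAt_iff]
    filter_upwards [Metric.ball_mem_nhds (0 : ℂ) hδ] with t ht
    rw [← hasSum_nat_add_iff' 1]
    simp only [hp, FormalMultilinearSeries.coeff_ofScalars, Finset.sum_range_one, if_pos,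
      Nat.add_sub_cancel, Nat.add_eq_zero_iff, one_ne_zero, and_false, if_false, smul_zero, sub_zero]
    by_cases h0 : t = 0
    · subst h0
      simp [hasSum_zero]
    · refine (h t h0 (by simpa using ht)).congr_fun fun b => ?_
      rw [smul_eq_mul, mul_comm]
  have h0 := hps.eq_zero
  funext b
  have h1 : p.coeff (b + 1) = 0 := by rw [h0]; rfl
  simpa [hp, FormalMultilinearSeries.coeff_ofScalars] using h1

theorem HasX.unique {c d : ℕ → ℂ} {f g : ℂ → ℂ} (hf : HasX c f) (hg : HasX d g) {R : ℝ}
    (hfg : ∀ x, R < ‖x‖ → f x = g x) : c = d := by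
  have h : (fun b => c b - d b) = 0 := by
    refine eq_zero_of_hasSum_pow (δ := (max R 2 + 1)⁻¹) (by positivity) fun t ht0 ht => ?_
    have hx : max R 2 + 1 < ‖t⁻¹‖ := by
      rw [norm_inv]
      exact (lt_inv_comm₀ (norm_pos_iff.mpr ht0) (by positivity)).mp ht
    have h1 := (hf t⁻¹ (by linarith [le_max_right R 2])).sub (hg t⁻¹ (by linarith [le_max_right R 2]))
    rw [hfg _ (by linarith [le_max_left R 2]), sub_self] at h1
    refine h1.congr_fun fun b => ?_
    rw [inv_pow, inv_inv]
    ring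
  funext b
  exact sub_eq_zero.mp (congrFun h b)

/-! ### The curve near infinity -/

theorem two_lt_norm_curveX {z : ℂ} (hz : 3 < ‖z‖) : 2 < ‖curveX z‖ := by
  have h1 : ‖z⁻¹‖ ≤ 1 := by
    rw [norm_inv]
    exact inv_le_one_of_one_le₀ (by linarith)
  have h2 : ‖z‖ ≤ ‖curveX z‖ + ‖z⁻¹‖ := by
    have := norm_sub_le (curveX z) z⁻¹
    rwa [curveX, add_sub_cancel_right] at this
  linarith

theorem ne_zero_of_three_lt {z : ℂ} (hz : 3 < ‖z‖) : z ≠ 0 := norm_pos_ne_zero (by linarith)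

theorem ne_sg_of_three_lt {z : ℂ} (hz : 3 < ‖z‖) (a : Bool) : z ≠ sg a := by
  rintro rfl
  have : ‖sg a‖ = 1 := by cases a <;> simp [sg]
  linarith

theorem hasDerivAt_curveX {z : ℂ} (hz : z ≠ 0) : HasDerivAt curveX (1 - (z ^ 2)⁻¹) z := by
  have : HasDerivAt curveX (1 + -(z ^ 2)⁻¹) z := (hasDerivAt_id z).add (hasDerivAt_inv hz)
  rwa [← sub_eq_add_neg] at this

theorem mul_deriv_curveX {z : ℂ} (hz : z ≠ 0) : z * (1 - (z ^ 2)⁻¹) = z - z⁻¹ := by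
  field_simp

theorem hasDerivAt_sub_inv {z : ℂ} (hz : z ≠ 0) :
    HasDerivAt (fun z : ℂ => z - z⁻¹) (z⁻¹ * curveX z) z := by
  have h := (hasDerivAt_id z).sub (hasDerivAt_inv hz)
  refine h.congr_deriv ?_
  rw [curveX]
  field_simp
  ring

/-- The derivative of `(z - 1/z) h (x)`. -/
theorem hasDerivAt_sub_inv_mul {h : ℂ → ℂ} {h' z : ℂ} (hz : z ≠ 0)
    (hh : HasDerivAt h h' (curveX z)) :
    HasDerivAt (fun z => (z - z⁻¹) * h (curveX z))
      (z⁻¹ * (curveX z * h (curveX z) + (curveX z ^ 2 - 4) * h')) z := by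
  have h1 : HasDerivAt (fun z => h (curveX z)) (h' * (1 - (z ^ 2)⁻¹)) z :=
    HasDerivAt.comp z hh (hasDerivAt_curveX hz)
  refine ((hasDerivAt_sub_inv hz).mul h1).congr_deriv ?_
  have h2 : curveX z ^ 2 - 4 = (z - z⁻¹) ^ 2 := by
    rw [curveX]
    field_simp
    ring
  rw [h2]
  field_simp

/-- The coefficients of `d/dx (x h + (x ^ 2 - 4) h')`. -/
def stepCoeff (c : ℕ → ℂ) (b : ℕ) : ℂ :=
  (b : ℂ) ^ 2 * c b - 4 * (b : ℂ) * ((b : ℂ) - 1) * c (b - 2)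

theorem HasX.euler {c : ℕ → ℂ} {h : ℂ → ℂ} (hc : HasX c h) :
    HasX (fun b => -((b : ℂ) + 1) * c (b + 1) + 4 * (b : ℂ) * c (b - 1))
      fun x => x * h x + (x ^ 2 - 4) * deriv h x := by
  have h1 := hc.hasX_deriv
  have h2 := h1.mul_x (by simp)
  have h3 := (hc.add h2).mul_x (by simp)
  have h4 := h3.add (h1.const_mul (-4))
  refine (h4.congr fun x _ => ?_).congr_coeff fun b => ?_
  · ring
  · simp only [Nat.add_sub_cancel]
    push_cast
    ring

theorem HasX.step {c : ℕ → ℂ} {h : ℂ → ℂ} (hc : HasX c h) :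
    HasX (stepCoeff c) (deriv fun x => x * h x + (x ^ 2 - 4) * deriv h x) := by
  refine hc.euler.hasX_deriv.congr_coeff fun b => ?_
  rcases b with _ | b
  · simp [stepCoeff]
  · rw [stepCoeff, Nat.add_sub_cancel, show b + 1 - 2 = b - 1 by omega]
    push_cast
    ring

/-- If `E dz = h (x) dx`, then the second iterate of `f ↦ d(z f)/dz` maps `E` to the function
belonging to `stepCoeff`. -/
theorem exists_step {c : ℕ → ℂ} {h E E₁ E₂ : ℂ → ℂ} (hc : HasX c h)
    (hE : ∀ z, 3 < ‖z‖ → E z = h (curveX z) * (1 - (z ^ 2)⁻¹))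
    (hE₁ : ∀ z, 3 < ‖z‖ → HasDerivAt (fun z => z * E z) (E₁ z) z)
    (hE₂ : ∀ z, 3 < ‖z‖ → HasDerivAt (fun z => z * E₁ z) (E₂ z) z) :
    ∃ h₂, HasX (stepCoeff c) h₂ ∧ ∀ z, 3 < ‖z‖ → E₂ z = h₂ (curveX z) * (1 - (z ^ 2)⁻¹) := by
  refine ⟨_, hc.step, fun z hz => ?_⟩
  have hop (z : ℂ) (hz : 3 < ‖z‖) : ∀ᶠ w in 𝓝 z, 3 < ‖w‖ :=
    (isOpen_lt continuous_const continuous_norm).mem_nhds hz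
  -- After one application the factor `z - 1/z` has disappeared, its square being `x² - 4`; the
  -- second application differentiates a function of `x` alone.
  have h1 (z : ℂ) (hz : 3 < ‖z‖) : z * E₁ z =
      curveX z * h (curveX z) + (curveX z ^ 2 - 4) * deriv h (curveX z) := by
    have hz0 := ne_zero_of_three_lt hz
    have d := hasDerivAt_sub_inv_mul hz0 (hc.hasDerivAt (two_lt_norm_curveX hz)).1
    have hev : (fun z => z * E z) =ᶠ[𝓝 z] fun z => (z - z⁻¹) * h (curveX z) := by
      filter_upwards [hop z hz] with w hw
      rw [hE w hw, ← mul_deriv_curveX (ne_zero_of_three_lt hw)]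
      ring
    rw [(hE₁ z hz).unique (d.congr_of_eventuallyEq hev), mul_inv_cancel_left₀ hz0]
  have hev : (fun z => z * E₁ z) =ᶠ[𝓝 z]
      (fun x => x * h x + (x ^ 2 - 4) * deriv h x) ∘ curveX := by
    filter_upwards [hop z hz] with w hw
    exact h1 w hw
  have d := (hc.euler.hasDerivAt (two_lt_norm_curveX hz)).1.comp z
    (hasDerivAt_curveX (ne_zero_of_three_lt hz))
  exact (hE₂ z hz).unique (d.congr_of_eventuallyEq hev)

theorem HasX.tendsto_mul {c : ℕ → ℂ} {f : ℂ → ℂ} (hf : HasX c f) :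
    Filter.Tendsto (fun x => x * f x) (Bornology.cobounded ℂ) (𝓝 (c 0)) := by
  have h3 : (2 : ℝ) < ‖(3 : ℂ)‖ := by norm_num
  have hs : Summable fun b => ‖c (b + 1)‖ * (3 ^ (b + 1))⁻¹ := by
    refine (((summable_nat_add_iff 1).mpr (hf 3 h3).summable).norm.mul_right 3).congr fun b => ?_
    rw [norm_mul, norm_inv, norm_pow, Complex.norm_ofNat, pow_succ (3 : ℝ) (b + 1)]
    field_simp
  rw [tendsto_iff_norm_sub_tendsto_zero]
  have hlim : Filter.Tendsto
      (fun x : ℂ => 3 * (∑' b, ‖c (b + 1)‖ * (3 ^ (b + 1))⁻¹) * ‖x‖⁻¹) (Bornology.cobounded ℂ)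
      (𝓝 0) := by
    have := (tendsto_norm_cobounded_atTop (E := ℂ)).inv_tendsto_atTop.const_mul
      (3 * (∑' b, ‖c (b + 1)‖ * ((3 : ℝ) ^ (b + 1))⁻¹))
    rwa [mul_zero] at this
  refine squeeze_zero' (Filter.Eventually.of_forall fun _ => norm_nonneg _) ?_ hlim
  filter_upwards [(tendsto_norm_cobounded_atTop (E := ℂ)).eventually_ge_atTop 3] with x hx
  have hx0 : x ≠ 0 := norm_pos_ne_zero (by linarith)
  have h1 := ((hasSum_nat_add_iff' 1).mpr (hf x (by linarith))).mul_left x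
  rw [Finset.sum_range_one, mul_sub, zero_add, pow_one,
    show x * (c 0 * x⁻¹) = c 0 by field_simp] at h1
  rw [← h1.tsum_eq, mul_right_comm, ← tsum_mul_left]
  refine tsum_of_norm_bounded (hs.mul_left _).hasSum fun b => ?_
  rw [norm_mul, norm_mul, norm_inv, norm_pow]
  have h2 : ((‖x‖ : ℝ) ^ b)⁻¹ ≤ (3 ^ b)⁻¹ := by gcongr
  have h3 : ‖x‖ ≠ 0 := norm_ne_zero_iff.mpr hx0
  calc ‖x‖ * (‖c (b + 1)‖ * (‖x‖ ^ (b + 1 + 1))⁻¹)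
      = ‖c (b + 1)‖ * ‖x‖⁻¹ * (‖x‖ ^ b)⁻¹ := by
        field_simp
        ring
    _ ≤ ‖c (b + 1)‖ * ‖x‖⁻¹ * (3 ^ b)⁻¹ := by gcongr
    _ = _ := by
        rw [pow_succ]
        field_simp

/-! ### The expansion of the inverse square root of `x² - 4`. -/

/-- The coefficients of `1 / (z - 1 / z)`. -/
def rootCoeff (b : ℕ) : ℂ := if Even b then (b.choose (b / 2) : ℂ) else 0

theorem rootCoeff_even (m : ℕ) : rootCoeff (2 * m) = (m.centralBinom : ℂ) := by
  rw [rootCoeff, if_pos (even_two_mul m), Nat.mul_div_cancel_left _ two_pos,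
    Nat.centralBinom_eq_two_mul_choose]

theorem rootCoeff_odd (m : ℕ) : rootCoeff (2 * m + 1) = 0 :=
  if_neg (Nat.not_even_iff_odd.mpr (odd_two_mul_add_one m))

theorem succ_mul_centralBinom (m : ℕ) :
    ((m : ℂ) + 1) * ((m + 1).centralBinom : ℂ) = 2 * (2 * (m : ℂ) + 1) * (m.centralBinom : ℂ) := by
  exact_mod_cast Nat.succ_mul_centralBinom_succ m

theorem exists_hasX_rootCoeff : ∃ h, HasX rootCoeff h := by
  refine ⟨fun x => ∑' b, rootCoeff b * (x ^ (b + 1))⁻¹, fun x hx => Summable.hasSum ?_⟩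
  have hx0 : 0 < ‖x‖ := by linarith
  have hg : Summable fun b : ℕ => ‖x‖⁻¹ * (2 / ‖x‖) ^ b :=
    (summable_geometric_of_lt_one (by positivity) ((div_lt_one hx0).mpr hx)).mul_left _
  refine hg.of_norm_bounded fun b => ?_
  rw [norm_mul, norm_inv, norm_pow, pow_succ, mul_inv, div_pow]
  have h1 : ‖rootCoeff b‖ ≤ 2 ^ b := by
    rw [rootCoeff]
    split_ifs
    · rw [Complex.norm_natCast]
      exact_mod_cast Nat.choose_le_two_pow _ _
    · rw [norm_zero]
      positivity
  calc ‖rootCoeff b‖ * ((‖x‖ ^ b)⁻¹ * ‖x‖⁻¹) ≤ 2 ^ b * ((‖x‖ ^ b)⁻¹ * ‖x‖⁻¹) := by gcongr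
    _ = _ := by ring

/-- The differential equation of `(x² - 4)^(-1/2)`; on coefficients it is the recursion of the
central binomials. -/
theorem HasX.euler_rootCoeff {h : ℂ → ℂ} (hh : HasX rootCoeff h) {x : ℂ} (hx : 2 < ‖x‖) :
    x * h x + (x ^ 2 - 4) * deriv h x = 0 := by
  refine (hh.euler x hx).unique (hasSum_zero.congr_fun fun b => ?_)
  dsimp only
  obtain ⟨m, rfl | rfl⟩ := b.even_or_odd'
  · rcases m with _ | m
    · rw [rootCoeff_odd]
      simp
    · rw [rootCoeff_odd, show 2 * (m + 1) - 1 = 2 * m + 1 by omega, rootCoeff_odd]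
      simp
  · rw [show 2 * m + 1 + 1 = 2 * (m + 1) by ring, Nat.add_sub_cancel, rootCoeff_even, rootCoeff_even]
    have := succ_mul_centralBinom m
    push_cast
    linear_combination (-2 * (x ^ (2 * (m + 1)))⁻¹) * this

theorem three_lt_norm_real_mul {z : ℂ} (hz : 3 < ‖z‖) {t : ℝ} (ht : 1 ≤ t) : 3 < ‖(t : ℂ) * z‖ := by
  rw [norm_mul, Complex.norm_real, Real.norm_eq_abs, abs_of_pos (by linarith)]
  nlinarith

theorem tendsto_curveX : Filter.Tendsto curveX (Bornology.cobounded ℂ) (Bornology.cobounded ℂ) := by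
  rw [← tendsto_norm_atTop_iff_cobounded]
  have h := (tendsto_norm_cobounded_atTop (E := ℂ))
  refine Filter.tendsto_atTop_mono' _ ?_ (Filter.tendsto_atTop_add_const_right _ (-1) h)
  filter_upwards [h.eventually_ge_atTop 1] with z hz
  have h1 : ‖z⁻¹‖ ≤ 1 := by
    rw [norm_inv]
    exact inv_le_one_of_one_le₀ hz
  have := norm_sub_le (curveX z) z⁻¹
  rw [curveX, add_sub_cancel_right] at this
  rw [curveX]
  linarith

theorem tendsto_sub_inv_div_curveX :
    Filter.Tendsto (fun z => (z - z⁻¹) / curveX z) (Bornology.cobounded ℂ) (𝓝 1) := by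
  have h0 : Filter.Tendsto (fun z : ℂ => z⁻¹) (Bornology.cobounded ℂ) (𝓝 0) :=
    Filter.tendsto_inv₀_cobounded
  have h2 := h0.mul h0
  have h := (h2.const_sub 1).div (h2.const_add 1) (by norm_num)
  rw [show (1 - (0 : ℂ) * 0) / (1 + 0 * 0) = 1 by norm_num] at h
  refine h.congr' ?_
  filter_upwards [eventually_cobounded_ne 0] with z hz
  rw [Pi.div_apply, curveX, ← mul_div_mul_left _ _ hz]
  congr 1
  all_goals field_simp

/-- By the differential equation the left side has derivative zero. It is therefore constant on the
ray from `z` to infinity, where it tends to `1`. -/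
theorem HasX.rootCoeff_curveX {h : ℂ → ℂ} (hh : HasX rootCoeff h) {z : ℂ} (hz : 3 < ‖z‖) :
    (z - z⁻¹) * h (curveX z) = 1 := by
  set G : ℂ → ℂ := fun z => (z - z⁻¹) * h (curveX z) with hG
  have hz0 := ne_zero_of_three_lt hz
  have hd (w : ℂ) (hw : 3 < ‖w‖) : HasDerivAt G 0 w := by
    have h2 := two_lt_norm_curveX hw
    have h1 := hasDerivAt_sub_inv_mul (ne_zero_of_three_lt hw) (hh.hasDerivAt h2).1
    rwa [hh.euler_rootCoeff h2, mul_zero] at h1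
  have hdt (t : ℝ) (ht : 1 ≤ t) : HasDerivAt (fun t : ℝ => G (t * z)) 0 t := by
    have h1 : HasDerivAt (fun w : ℂ => G (w * z)) (0 * z) (t : ℂ) := by
      refine ((hd _ (three_lt_norm_real_mul hz ht)).comp (t : ℂ)
        ((hasDerivAt_id (t : ℂ)).mul_const z)).congr_deriv ?_
      rw [zero_mul, zero_mul]
    rw [zero_mul] at h1
    exact h1.comp_ofReal
  have hconst (T : ℝ) (hT : 1 ≤ T) : G (T * z) = G z := by
    have h1 := constant_of_has_deriv_right_zero (f := fun t : ℝ => G (t * z)) (a := 1) (b := T)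
      (fun t ht => (hdt t ht.1).continuousAt.continuousWithinAt)
      (fun t ht => (hdt t ht.1).hasDerivWithinAt) T ⟨hT, le_rfl⟩
    simpa using h1
  have hlimG : Filter.Tendsto G (Bornology.cobounded ℂ) (𝓝 1) := by
    have h1 := tendsto_sub_inv_div_curveX.mul (hh.tendsto_mul.comp tendsto_curveX)
    rw [show rootCoeff 0 = 1 by simp [rootCoeff], one_mul] at h1
    refine h1.congr' ?_
    filter_upwards [tendsto_curveX.eventually (eventually_cobounded_ne 0)] with w hw
    simp only [Function.comp_apply, hG]
    field_simp
  have hray : Filter.Tendsto (fun T : ℝ => (T : ℂ) * z) Filter.atTop (Bornology.cobounded ℂ) := by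
    rw [← tendsto_norm_atTop_iff_cobounded]
    simp only [norm_mul, Complex.norm_real]
    exact (tendsto_norm_atTop_atTop).atTop_mul_const (norm_pos_iff.mpr hz0)
  have h1 := hlimG.comp hray
  refine tendsto_nhds_unique (Filter.Tendsto.congr' ?_ tendsto_const_nhds) h1
  filter_upwards [Filter.eventually_ge_atTop 1] with T hT
  exact (hconst T hT).symm

/-! ### Weights -/

theorem weight_odd (m : ℕ) : weight (2 * m + 1) = (2 * (m : ℂ) + 1) * (m.centralBinom : ℂ) := by
  rw [weight, if_pos (odd_two_mul_add_one m), Nat.add_sub_cancel, Nat.mul_div_cancel_left _ two_pos,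
    Nat.centralBinom_eq_two_mul_choose]
  push_cast
  rfl

theorem weight_even (m : ℕ) : weight (2 * m) = (m : ℂ) * (m.centralBinom : ℂ) := by
  rw [weight, if_neg (Nat.not_odd_iff_even.mpr (even_two_mul m)),
    Nat.mul_div_cancel_left _ two_pos, Nat.centralBinom_eq_two_mul_choose]
  push_cast
  ring

theorem weight_zero : weight 0 = 0 := by simpa using weight_even 0

theorem weight_one : weight 1 = 1 := by simpa using weight_odd 0

theorem weight_ne_zero {b : ℕ} (hb : b ≠ 0) : weight b ≠ 0 := by
  obtain ⟨m, rfl | rfl⟩ := b.even_or_odd'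
  · rw [weight_even]
    exact mul_ne_zero (by exact_mod_cast fun h => hb (by omega))
      (by exact_mod_cast m.centralBinom_ne_zero)
  · rw [weight_odd]
    exact mul_ne_zero (by exact_mod_cast Nat.succ_ne_zero (2 * m))
      (by exact_mod_cast m.centralBinom_ne_zero)

/-- The two factors `(b - 1) ^ 2` and `b (b - 2)` for odd and even `b`. -/
def parityPoly (o : Bool) : Polynomial ℂ :=
  if o then (Polynomial.X - 1) ^ 2 else Polynomial.X * (Polynomial.X - 2)

/-- This lets `stepCoeff` act on the cofactor of the weight as a difference operator on polynomials;
the operator depends on the parity of `b`, and so does the final polynomial form. -/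
theorem weight_step (b : ℕ) : 4 * (b : ℂ) * ((b : ℂ) - 1) * weight (b - 2) =
    weight b * (parityPoly (decide (Odd b))).eval (b : ℂ) := by
  obtain ⟨m, rfl | rfl⟩ := b.even_or_odd'
  · have hp : ¬ Odd (2 * m) := Nat.not_odd_iff_even.mpr (even_two_mul m)
    rw [parityPoly, if_neg (by simp)]
    rcases m with _ | m
    · simp
    · rw [show 2 * (m + 1) - 2 = 2 * m by omega, weight_even, weight_even]
      have := succ_mul_centralBinom m
      simp only [Polynomial.eval_mul, Polynomial.eval_sub, Polynomial.eval_X,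
        Polynomial.eval_ofNat]
      push_cast
      linear_combination (-(2 * (m : ℂ) + 2) * (2 * m)) * this
  · rw [parityPoly, if_pos (by simp)]
    rcases m with _ | m
    · simp
    · rw [show 2 * (m + 1) + 1 - 2 = 2 * m + 1 by omega, weight_odd, weight_odd]
      have := succ_mul_centralBinom m
      simp only [Polynomial.eval_pow, Polynomial.eval_sub, Polynomial.eval_X, Polynomial.eval_one]
      push_cast
      linear_combination (-4 * (2 * (m : ℂ) + 3) * (m + 1)) * this

/-! ### Expansion coefficients of the basis differentials. -/

/-- The polynomials `p_l` with `xc a l b = ± weight b * p_l b` for `b` of a given parity. -/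
def modePoly (o : Bool) : ℕ → Polynomial ℂ
  | 0 => 1
  | l + 1 => Polynomial.X ^ 2 * modePoly o l -
      parityPoly o * (modePoly o l).comp (Polynomial.X - Polynomial.C 2)

theorem natDegree_sub_comp_lt (p : Polynomial ℂ) :
    (p - p.comp (Polynomial.X - Polynomial.C 2)).natDegree + 1 ≤ p.natDegree ∨
      p - p.comp (Polynomial.X - Polynomial.C 2) = 0 := by
  set q := p.comp (Polynomial.X - Polynomial.C 2) with hq
  by_cases h0 : p - q = 0
  · exact Or.inr h0
  left
  have hd : q.natDegree = p.natDegree := by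
    rw [hq, Polynomial.natDegree_comp, Polynomial.natDegree_X_sub_C, mul_one]
  have hl : q.leadingCoeff = p.leadingCoeff := by
    rw [hq, Polynomial.leadingCoeff_comp (by rw [Polynomial.natDegree_X_sub_C]; exact one_ne_zero),
      Polynomial.leadingCoeff_X_sub_C, one_pow, mul_one]
  have hp : p ≠ 0 := by
    rintro rfl
    exact h0 (by simp [hq])
  have hq0 : q ≠ 0 := by
    rw [← Polynomial.leadingCoeff_ne_zero, hl]
    exact Polynomial.leadingCoeff_ne_zero.mpr hp
  have hdeg : p.degree = q.degree := by
    rw [Polynomial.degree_eq_natDegree hp, Polynomial.degree_eq_natDegree hq0, hd]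
  exact Polynomial.natDegree_lt_natDegree h0 (Polynomial.degree_sub_lt_left hdeg hp hl.symm)

/-- Both `X ^ 2` and `parityPoly o` are monic of degree two, and a shift of the argument preserves
the leading coefficient, so a step raises the degree by one only. -/
theorem natDegree_modePoly_le (o : Bool) (l : ℕ) : (modePoly o l).natDegree ≤ l := by
  induction l with
  | zero => simp [modePoly]
  | succ l ih =>
    set p := modePoly o l
    set q := p.comp (Polynomial.X - Polynomial.C 2) with hq
    have hqd : q.natDegree ≤ l := by
      rwa [hq, Polynomial.natDegree_comp, Polynomial.natDegree_X_sub_C, mul_one]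
    obtain ⟨c, hc⟩ : ∃ c : ℂ, parityPoly o =
        Polynomial.X ^ 2 - (Polynomial.C 2 * Polynomial.X - Polynomial.C c) := by
      cases o
      · exact ⟨0, by simp only [parityPoly, map_zero, Polynomial.C_ofNat]; simp; ring⟩
      · exact ⟨1, by simp only [parityPoly, map_one, Polynomial.C_ofNat]; simp; ring⟩
    have h1 : modePoly o (l + 1) = Polynomial.X ^ 2 * (p - q) +
        (Polynomial.C 2 * Polynomial.X - Polynomial.C c) * q := by
      rw [modePoly, hc]
      ring
    rw [h1]
    refine Polynomial.natDegree_add_le_of_degree_le ?_ ?_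
    · rcases natDegree_sub_comp_lt p with h | h
      · rw [← hq] at h
        refine Polynomial.natDegree_mul_le.trans ?_
        rw [Polynomial.natDegree_X_pow]
        omega
      · rw [← hq] at h
        rw [h, mul_zero, Polynomial.natDegree_zero]
        omega
    · refine Polynomial.natDegree_mul_le.trans ?_
      have : (Polynomial.C (2 : ℂ) * Polynomial.X - Polynomial.C c).natDegree ≤ 1 := by
        rw [Polynomial.natDegree_sub_C]
        compute_degree
      omega

theorem eval_zero_modePoly (l : ℕ) : (modePoly false l).eval 0 = if l = 0 then 1 else 0 := by
  rcases l with _ | l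
  · simp [modePoly]
  · simp [modePoly, parityPoly]

/-- The coefficients of the expansion of the basic differentials. -/
def xc (a : Bool) : ℕ → ℕ → ℂ
  | 0 => fun b => (if Odd b then sg a else 1) * weight b
  | l + 1 => stepCoeff (xc a l)

theorem xc_eq (a : Bool) (l b : ℕ) : xc a l b =
    weight b * ((if Odd b then sg a else 1) * (modePoly (decide (Odd b)) l).eval (b : ℂ)) := by
  induction l generalizing b with
  | zero => simp [xc, modePoly, mul_comm]
  | succ l ih =>
    rw [xc, stepCoeff, ih, ih]
    -- For `b < 2` the subtraction in `b - 2` is truncated, but its term has the factor `b * (b - 1)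
    -- = 0`.
    rcases lt_or_ge b 2 with hb | hb
    · interval_cases b
      · simp [weight_zero]
      · simp [modePoly, parityPoly]
    · have hodd : Odd (b - 2) ↔ Odd b := by
        rw [Nat.odd_sub hb]
        simp
      have hw := weight_step b
      simp only [hodd, modePoly, Polynomial.eval_sub, Polynomial.eval_mul, Polynomial.eval_pow,
        Polynomial.eval_X, Polynomial.eval_comp, Polynomial.eval_C]
      rw [Nat.cast_sub hb]
      push_cast
      linear_combination (-(if Odd b then sg a else 1) *
        (modePoly (decide (Odd b)) l).eval ((b : ℂ) - 2)) * hw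

/-- With `α = sg a` the function is `(α x + 2) (x² - 4)^(-3/2)`, and the last factor is `-1/x` times
the derivative of `(x² - 4)^(-1/2) = 1 / (z - 1/z)`. -/
theorem exists_hasX_base (a : Bool) : ∃ h, HasX (xc a 0) h ∧
    ∀ z, 3 < ‖z‖ → sg a * phi 0 (sg a * z) = h (curveX z) * (1 - (z ^ 2)⁻¹) := by
  obtain ⟨h, hh⟩ := exists_hasX_rootCoeff
  have h1 := hh.hasX_deriv.div_x.const_mul (-1)
  have h2 := ((h1.mul_x (by simp)).const_mul (sg a)).add (h1.const_mul 2)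
  refine ⟨_, h2.congr_coeff fun b => ?_, fun z hz => ?_⟩
  · simp only [xc, Nat.add_one_ne_zero, if_false, Nat.add_sub_cancel]
    obtain ⟨m, rfl | rfl⟩ := b.even_or_odd'
    · rw [if_neg (Nat.not_odd_iff_even.mpr (even_two_mul m))]
      rcases m with _ | m
      · simp [weight_zero]
      · rw [if_neg (by omega), weight_even, show 2 * (m + 1) - 1 = 2 * m + 1 by omega,
          rootCoeff_odd, Nat.add_sub_cancel, rootCoeff_even]
        have := succ_mul_centralBinom m
        push_cast
        linear_combination this
    · rw [if_pos (odd_two_mul_add_one m), weight_odd, Nat.add_sub_cancel, rootCoeff_even,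
        if_neg (by omega)]
      rcases m with _ | m
      · simp
      · rw [show 2 * (m + 1) - 1 = 2 * m + 1 by omega, rootCoeff_odd]
        push_cast
        ring
  · have hz0 := ne_zero_of_three_lt hz
    have hx := two_lt_norm_curveX hz
    have hx0 := norm_pos_ne_zero hx
    have hY := hh.rootCoeff_curveX hz
    have hY0 : z - z⁻¹ ≠ 0 := left_ne_zero_of_mul_eq_one hY
    have he := hh.euler_rootCoeff hx
    have hh' : h (curveX z) = (z - z⁻¹)⁻¹ := eq_inv_of_mul_eq_one_right hY
    have h4 : curveX z ^ 2 - 4 = (z - z⁻¹) ^ 2 := by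
      rw [curveX]
      field_simp
      ring
    have hd : deriv h (curveX z) = -(curveX z * ((z - z⁻¹) ^ 3)⁻¹) := by
      rw [h4, hh'] at he
      generalize z - z⁻¹ = Y at he hY0
      field_simp at he ⊢
      linear_combination he
    have h5 : sg a * z - 1 ≠ 0 := by
      intro h6
      apply ne_sg_of_three_lt hz a
      linear_combination sg a * h6 - z * sg_mul_self a
    rw [hd, phi_zero]
    have h6 : z - z⁻¹ = (sg a * z - 1) * (sg a * z + 1) * z⁻¹ := by
      field_simp
      linear_combination -z ^ 2 * sg_mul_self a
    have h7 : sg a * z + 1 ≠ 0 := by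
      intro h8
      rw [h6, h8, mul_zero, zero_mul] at hY0
      exact hY0 rfl
    have h9 : 1 - (z ^ 2)⁻¹ = (z - z⁻¹) * z⁻¹ := by
      rw [← mul_deriv_curveX hz0]
      field_simp
    rw [h9, h6]
    have h10 : curveX z * z = z ^ 2 + 1 := by
      rw [curveX]
      field_simp
    field_simp
    linear_combination (sg a * z ^ 2 + 2 * z) * sg_mul_self a - sg a * h10

theorem exists_hasX_mode (a : Bool) (l : ℕ) : ∃ h, HasX (xc a l) h ∧
    ∀ z, 3 < ‖z‖ → sg a * phi (2 * l) (sg a * z) = h (curveX z) * (1 - (z ^ 2)⁻¹) := by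
  induction l with
  | zero => exact exists_hasX_base a
  | succ l ih =>
    obtain ⟨h, hh, hE⟩ := ih
    have hd (n : ℕ) (z : ℂ) (hz : 3 < ‖z‖) :
        HasDerivAt (fun z => z * (sg a * phi n (sg a * z))) (sg a * phi (n + 1) (sg a * z)) z := by
      have hne : sg a * z ≠ 1 := by
        intro h1
        apply ne_sg_of_three_lt hz a
        rw [← sg_mul_self a] at h1
        exact mul_left_cancel₀ (sg_ne_zero a) h1
      have h1 := (hasDerivAt_mul_phi n hne).comp z ((hasDerivAt_id z).const_mul (sg a))
      refine (h1.congr_deriv (by ring)).congr_of_eventuallyEq (Filter.Eventually.of_forall fun w => ?_)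
      simp only [Function.comp_apply]
      ring
    obtain ⟨h₂, hh₂, hE₂⟩ := exists_step hh hE (hd (2 * l)) (hd (2 * l + 1))
    exact ⟨h₂, hh₂, hE₂⟩

/-- The vector of the coefficients of `x ^ -(b + 1) dx` in the basic differentials. -/
def mvec (b : ℕ) : Mode → ℂ := fun j => xc j.1 j.2 b / ((2 * j.2).factorial : ℂ)

theorem exists_hasX_basis (j : Mode) : ∃ h, HasX (fun b => mvec b j) h ∧
    ∀ z, 3 < ‖z‖ → basis j z = h (curveX z) * (1 - (z ^ 2)⁻¹) := by
  obtain ⟨h, hh, hE⟩ := exists_hasX_mode j.1 j.2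
  refine ⟨_, (hh.const_mul ((2 * j.2).factorial : ℂ)⁻¹).congr_coeff fun b => ?_, fun z hz => ?_⟩
  · rw [mvec]
    ring
  · rw [basis, hE z hz]
    ring

/-! ### Multivariable expansions -/

theorem hasSum_prod_fin {n : ℕ} {u : Fin n → ℕ → ℂ} {U : Fin n → ℂ} (h : ∀ i, HasSum (u i) (U i)) :
    HasSum (fun b : Fin n → ℕ => ∏ i, u i (b i)) (∏ i, U i) := by
  induction n with
  | zero => simp
  | succ n ih =>
    have h1 := ih fun i => h i.succ
    have s1 : Summable fun b => ‖u 0 b‖ := (h 0).summable.norm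
    have s2 : Summable fun b : Fin n → ℕ => ‖∏ i, u (Fin.succ i) (b i)‖ := h1.summable.norm
    have s3 := summable_mul_of_summable_norm s1 s2
    have h2 := HasSum.mul (h 0) h1 s3
    rw [← (Fin.consEquiv fun _ : Fin (n + 1) => ℕ).hasSum_iff]
    rw [Fin.prod_univ_succ]
    refine h2.congr_fun fun b => ?_
    simp [Fin.consEquiv, Fin.prod_univ_succ]

theorem eq_zero_of_hasSum_prod_pow {n : ℕ} {A : (Fin n → ℕ) → ℂ} {δ : ℝ} (hδ : 0 < δ)
    (h : ∀ t : Fin n → ℂ, (∀ i, t i ≠ 0) → (∀ i, ‖t i‖ < δ) →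
      HasSum (fun b => A b * ∏ i, t i ^ (b i + 1)) 0) : A = 0 := by
  induction n with
  | zero =>
    have h1 := h 0 (fun i => i.elim0) (fun i => i.elim0)
    funext b
    have h2 := (hasSum_unique fun b : Fin 0 → ℕ => A b * ∏ i, (0 : Fin 0 → ℂ) i ^ (b i + 1)).unique h1
    rw [Finset.univ_eq_empty, Finset.prod_empty, mul_one] at h2
    exact (congrArg A (Subsingleton.elim _ _)).trans h2
  | succ n ih =>
    have hs (t₀ : ℂ) (t : Fin n → ℂ) (h0 : t₀ ≠ 0) (h0' : ‖t₀‖ < δ) (ht : ∀ i, t i ≠ 0)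
        (ht' : ∀ i, ‖t i‖ < δ) : HasSum (fun b : ℕ × (Fin n → ℕ) =>
          (A (Fin.cons b.1 b.2) * ∏ i, t i ^ (b.2 i + 1)) * t₀ ^ (b.1 + 1)) 0 := by
      have h1 := h (Fin.cons t₀ t) (Fin.cases h0 ht) (Fin.cases h0' ht')
      rw [← (Fin.consEquiv fun _ : Fin (n + 1) => ℕ).hasSum_iff] at h1
      refine h1.congr_fun fun b => ?_
      simp only [Fin.consEquiv, Function.comp_apply, Equiv.coe_fn_mk, Fin.prod_univ_succ,
        Fin.cons_zero, Fin.cons_succ]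
      ring
    have key (t : Fin n → ℂ) (ht : ∀ i, t i ≠ 0) (ht' : ∀ i, ‖t i‖ < δ) :
        ∀ b₀ : ℕ, HasSum (fun b => A (Fin.cons b₀ b) * ∏ i, t i ^ (b i + 1)) 0 := by
      have hsm (b₀ : ℕ) : Summable fun b : Fin n → ℕ => A (Fin.cons b₀ b) * ∏ i, t i ^ (b i + 1) := by
        have hδ2 : ((δ / 2 : ℝ) : ℂ) ≠ 0 := by exact_mod_cast (half_pos hδ).ne'
        have hn : ‖((δ / 2 : ℝ) : ℂ)‖ < δ := by
          rw [Complex.norm_real, Real.norm_eq_abs, abs_of_pos (half_pos hδ)]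
          linarith
        have h1 := (hs (δ / 2 : ℝ) t hδ2 hn ht ht').summable
        have h2 := h1.prod_factor b₀
        rw [← summable_mul_right_iff (pow_ne_zero (b₀ + 1) hδ2)]
        exact h2
      have h0 : (fun b₀ => ∑' b, A (Fin.cons b₀ b) * ∏ i, t i ^ (b i + 1)) = 0 := by
        refine eq_zero_of_hasSum_pow hδ fun t₀ h0 h0' => ?_
        have h1 (b₀ : ℕ) := HasSum.mul_right (t₀ ^ (b₀ + 1)) (hsm b₀).hasSum
        have h2 := hs t₀ t h0 h0' ht ht'
        exact HasSum.prod_fiberwise h2 h1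
      intro b₀
      have h1 := (hsm b₀).hasSum
      rwa [congrFun h0 b₀] at h1
    funext b
    have h1 := ih (A := fun b' => A (Fin.cons (b 0) b')) fun t ht ht' => key t ht ht' (b 0)
    have h2 := congrFun h1 (Fin.tail b)
    simpa using h2

/-- The two preimages have product `1` and sum `x`; the larger one has modulus at least `|x| / 2`.
-/
theorem exists_curveX_eq {R : ℝ} {x : ℂ} (hx : 2 * R < ‖x‖) : ∃ z, R < ‖z‖ ∧ curveX z = x := by
  obtain ⟨s, hs⟩ := IsAlgClosed.exists_pow_nat_eq (x ^ 2 - 4) (n := 2) two_pos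
  have hp : (x + s) / 2 * ((x - s) / 2) = 1 := by linear_combination (-1 / 4) * hs
  have hsum : x = (x + s) / 2 + (x - s) / 2 := by ring
  have hn : ‖x‖ ≤ ‖(x + s) / 2‖ + ‖(x - s) / 2‖ := by
    conv_lhs => rw [hsum]
    exact norm_add_le _ _
  rcases le_or_gt ‖(x - s) / 2‖ ‖(x + s) / 2‖ with h | h
  · refine ⟨(x + s) / 2, by linarith, ?_⟩
    rw [curveX, ← eq_inv_of_mul_eq_one_right hp, ← hsum]
  · refine ⟨(x - s) / 2, by linarith, ?_⟩
    rw [curveX, ← eq_inv_of_mul_eq_one_left hp, add_comm, ← hsum]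

theorem deriv_curveX {z : ℂ} (hz : z ≠ 0) : deriv curveX z = 1 - (z ^ 2)⁻¹ :=
  (hasDerivAt_curveX hz).deriv

theorem deriv_curveX_ne_zero {z : ℂ} (hz : 3 < ‖z‖) : deriv curveX z ≠ 0 := by
  rw [deriv_curveX (ne_zero_of_three_lt hz)]
  intro h
  have h1 : z ^ 2 = 1 := by
    have := sub_eq_zero.mp h
    rw [← inv_inj, ← this, inv_one]
  have h2 : ‖z‖ ^ 2 = 1 := by rw [← norm_pow, h1, norm_one]
  nlinarith

theorem IsExpansionAtInfinity.unique {n : ℕ} {f : (Fin n → ℂ) → ℂ} {M M' : (Fin n → ℕ) → ℂ}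
    (h : IsExpansionAtInfinity f M) (h' : IsExpansionAtInfinity f M') : M = M' := by
  obtain ⟨R, hR⟩ := h
  obtain ⟨R', hR'⟩ := h'
  set T := max (max R R') 3 with hT
  have hT3 : 3 ≤ T := le_max_right _ _
  have hz : (fun b => M b - M' b) = 0 := by
    refine eq_zero_of_hasSum_prod_pow (δ := (2 * T)⁻¹) (by positivity) fun t ht ht' => ?_
    have hex (i : Fin n) : ∃ z, T < ‖z‖ ∧ curveX z = (t i)⁻¹ := by
      refine exists_curveX_eq ?_
      rw [norm_inv]
      exact (lt_inv_comm₀ (norm_pos_iff.mpr (ht i)) (by positivity)).mp (ht' i)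
    choose z hzT hzx using hex
    have h1 := (hR z fun i => ((le_max_left _ _).trans (le_max_left _ _)).trans_lt (hzT i)).sub
      (hR' z fun i => ((le_max_right _ _).trans (le_max_left _ _)).trans_lt (hzT i))
    rw [sub_self] at h1
    have hne : ∏ i, deriv curveX (z i) ≠ 0 :=
      Finset.prod_ne_zero_iff.mpr fun i _ => deriv_curveX_ne_zero (hT3.trans_lt (hzT i))
    have h2 := h1.mul_left (∏ i, deriv curveX (z i))⁻¹
    rw [mul_zero] at h2
    refine h2.congr_fun fun b => ?_
    simp only [hzx, inv_pow, div_inv_eq_mul, Finset.prod_mul_distrib]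
    field_simp
  funext b
  exact sub_eq_zero.mp (congrFun hz b)

/-! ### The expansion of the invariants -/

theorem hasSum_basis (j : Mode) {z : ℂ} (hz : 3 < ‖z‖) :
    HasSum (fun b => mvec b j * (deriv curveX z / curveX z ^ (b + 1))) (basis j z) := by
  obtain ⟨h, hh, hE⟩ := exists_hasX_basis j
  rw [hE z hz, ← deriv_curveX (ne_zero_of_three_lt hz)]
  refine ((hh _ (two_lt_norm_curveX hz)).mul_right _).congr_fun fun b => ?_
  ring

theorem hasSum_corr {n : ℕ} (f : Fock) {z : Fin n → ℂ} (hz : ∀ i, 3 < ‖z i‖) :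
    HasSum (fun b : Fin n → ℕ => corr (Finset.univ.val.map fun i => mvec (b i)) f *
      ∏ i, (deriv curveX (z i) / curveX (z i) ^ (b i + 1)))
      (corr (Finset.univ.val.map fun i => ev (z i)) f) := by
  classical
  rw [corr_eq_sum_polar _ f subset_rfl]
  have h1 (t : Fin n → Mode) : HasSum (fun b : Fin n → ℕ => (∏ i, mvec (b i) (t i) *
      (deriv curveX (z i) / curveX (z i) ^ (b i + 1))) * polar f t)
      ((∏ i, basis (t i) (z i)) * polar f t) := by
    have h2 := hasSum_prod_fin fun i => hasSum_basis (t i) (hz i)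
    exact HasSum.mul_right (polar f t) h2
  have h3 := hasSum_sum (s := Fintype.piFinset fun _ : Fin n => f.vars) fun t _ => h1 t
  refine h3.congr_fun fun b => ?_
  rw [corr_eq_sum_polar _ f subset_rfl, Finset.sum_mul]
  refine Finset.sum_congr rfl fun t _ => ?_
  rw [Finset.prod_mul_distrib]
  ring

/-- A free energy of the curve. -/
def freeEnergy : ℕ → Fock := (exists_isFreeEnergy regCoeff regCoeff_symm).choose

theorem isFreeEnergy_freeEnergy : IsFreeEnergy regCoeff freeEnergy :=
  (exists_isFreeEnergy regCoeff regCoeff_symm).choose_spec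

theorem isExpansionAtInfinity_omega {g n : ℕ} (hn : 1 ≤ n) (hgn : 2 < 2 * g + n) :
    IsExpansionAtInfinity (omega lnBranch g n)
      fun b => corr (Finset.univ.val.map fun i => mvec (b i)) (freeEnergy (2 * g + n - 2)) := by
  refine ⟨3, fun z hz => ?_⟩
  rw [omega_eq_corr isFreeEnergy_freeEnergy _ g n z rfl (by omega) hgn
    fun i a => ne_sg_of_three_lt (hz i) a]
  exact hasSum_corr _ hz

theorem isExpansionAtInfinity_coeffM {g n : ℕ} (hn : 1 ≤ n) (hgn : 2 < 2 * g + n) :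
    IsExpansionAtInfinity (omega lnBranch g n) (coeffM g n) := by
  have h : ∃ M, IsExpansionAtInfinity (omega lnBranch g n) M := ⟨_, isExpansionAtInfinity_omega hn hgn⟩
  rw [coeffM, expansionCoeff, dif_pos h]
  exact h.choose_spec

theorem coeffM_eq {g n : ℕ} (hn : 1 ≤ n) (hgn : 2 < 2 * g + n) (b : Fin n → ℕ) :
    coeffM g n b = corr (Finset.univ.val.map fun i => mvec (b i)) (freeEnergy (2 * g + n - 2)) :=
  congrFun ((isExpansionAtInfinity_coeffM hn hgn).unique (isExpansionAtInfinity_omega hn hgn)) b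

/-! ### The shift of expansion coefficients and the divisor equation. -/

theorem constantCoeff_stringField (reg : Mode → Mode → ℂ) (v : Mode → ℂ) (j : Mode) :
    constantCoeff (stringField reg v j) = 0 := by
  have h (k : Mode) : constantCoeff (virField reg k.1 k.2 j) = 0 := by
    unfold virField
    split_ifs <;> simp
  rw [stringField, map_sum]
  exact Finset.sum_eq_zero fun k _ => by rw [map_mul, h, mul_zero]

theorem stringFactor_eq {J : ℕ} (hJ : J ≤ 1) {w : ℂ} (hw : 3 < ‖w‖) :
    stringFactor J w * (1 - (w ^ 2)⁻¹) = curveX w ^ J := by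
  have h0 := ne_zero_of_three_lt hw
  have h1 : w ^ 2 - 1 ≠ 0 := sq_sub_one_ne_zero fun a => ne_sg_of_three_lt hw a
  have h2 : 1 - (w ^ 2)⁻¹ = (w ^ 2 - 1) / w ^ 2 := by field_simp
  rw [stringFactor, h2, curveX]
  interval_cases J
  · simp only [Nat.sub_zero, pow_zero, mul_one]
    field_simp
  · simp only [Nat.add_one_sub_one, pow_one]
    field_simp

theorem mvec_zero (j : Mode) : mvec 0 j = 0 := by
  rw [mvec, xc_eq, weight_zero, zero_mul, zero_div]

/-- Writing `basis j dz = h dx`, the function is `x ^ J * h`. Differentiating `x ^ (-b)` produces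
the factor `b`, and the power of `x` lowers the exponent for `J = 0` or restores it for `J = 1`. -/
theorem exists_hasX_deriv_stringFun {J : ℕ} (hJ : J ≤ 1) (j : Mode) :
    ∃ k, HasX (fun b => (b : ℂ) * mvec (b - 1 + J) j) k ∧
      ∀ z, 3 < ‖z‖ → -deriv (stringFun J j) z = k (curveX z) * (1 - (z ^ 2)⁻¹) := by
  obtain ⟨h, hh, hE⟩ := exists_hasX_basis j
  have hpow : HasX (fun b => mvec (b + J) j) fun x => x ^ J * h x := by
    interval_cases J
    · simpa using hh
    · simpa using hh.mul_x (mvec_zero j)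
  refine ⟨_, (hpow.hasX_deriv.const_mul (-1)).congr_coeff fun b => ?_, fun z hz => ?_⟩
  · ring
  · have hev : stringFun J j =ᶠ[𝓝 z] (fun x => x ^ J * h x) ∘ curveX := by
      filter_upwards [(isOpen_lt continuous_const continuous_norm).mem_nhds hz] with w hw
      rw [stringFun, hE w hw, Function.comp_apply, ← stringFactor_eq hJ hw]
      ring
    have hd := (hpow.hasDerivAt (two_lt_norm_curveX hz)).1.comp z
      (hasDerivAt_curveX (ne_zero_of_three_lt hz))
    rw [hev.deriv_eq, hd.deriv]
    ring

theorem coeff_dirDeriv_eq_sum (l : Mode → ℂ) (f : Fock) (d : Mode →₀ ℕ) :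
    coeff d (dirDeriv l f) = ∑ i ∈ f.vars, coeff d (pderiv i f) * l i := by
  rw [dirDeriv_eq_sum l f subset_rfl, coeff_sum]
  exact Finset.sum_congr rfl fun i _ => by rw [coeff_C_mul, mul_comm]

/-- The vector fields of the string and divisor equations shift the expansion coefficients. -/
theorem dirDeriv_mvec_stringField {J : ℕ} (hJ : J ≤ 1) (j : Mode) (b : ℕ) :
    dirDeriv (mvec b) (stringField regCoeff (stringVector J) j) =
      C ((b : ℂ) * mvec (b - 1 + J) j) := by
  set f := stringField regCoeff (stringVector J) j with hf
  ext d
  obtain ⟨k, hk, hkz⟩ := exists_hasX_deriv_stringFun hJ j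
  choose h hh hE using exists_hasX_basis
  have hsum := HasX.sum (t := f.vars) (c := fun i b => coeff d (pderiv i f) * mvec b i)
    fun i _ => (hh i).const_mul _
  have hR : HasX (fun b => coeff d (C ((b : ℂ) * mvec (b - 1 + J) j) : Fock))
      fun x => coeff d (C (k x) : Fock) := by
    simp only [coeff_C]
    split_ifs
    · exact hk
    · intro x _
      simp [hasSum_zero]
  rw [coeff_dirDeriv_eq_sum]
  -- Both sides are linear in the covector, and the identity for `ev z` holds for all large `z`.
  -- Comparing coefficients of `x ^ (-b-1) dx` replaces `ev z` by `mvec b`.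
  refine congrFun (hsum.unique hR (R := 2 * 3) fun x hx => ?_) b
  obtain ⟨z, hz, rfl⟩ := exists_curveX_eq hx
  have h1 := congrArg (coeff d) (dirDeriv_stringField hJ j (ne_zero_of_three_lt hz)
    fun a => ne_sg_of_three_lt hz a)
  have hne : 1 - (z ^ 2)⁻¹ ≠ 0 := by
    rw [← deriv_curveX (ne_zero_of_three_lt hz)]
    exact deriv_curveX_ne_zero hz
  rw [← hf, coeff_dirDeriv_eq_sum, hkz z hz] at h1
  refine mul_right_cancel₀ hne ?_
  rw [Finset.sum_mul]
  refine (Finset.sum_congr rfl fun i _ => ?_).trans (h1.trans ?_)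
  · rw [ev, hE i z hz]
    ring
  · simp only [coeff_C]
    split_ifs
    · rfl
    · rw [zero_mul]

theorem eval_one_modePoly (l : ℕ) : (modePoly true l).eval 1 = 1 := by
  induction l with
  | zero => simp [modePoly]
  | succ l ih => simp [modePoly, parityPoly, ih]

theorem mvec_one (j : Mode) : mvec 1 j = sg j.1 / ((2 * j.2).factorial : ℂ) := by
  rw [mvec, xc_eq, weight_one, if_pos odd_one, decide_eq_true odd_one, Nat.cast_one,
    eval_one_modePoly, one_mul, mul_one]

/-- The direction of the equation with `J = 1` splits into an additional argument `1` and the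
dilaton direction; the latter supplies the term `2 - 2g - n` of the divisor equation. -/
theorem stringCoeff_one_eq (j : Mode) :
    stringCoeff (stringVector 1) j = 2 * mvec 1 j + dilatonCoeff j := by
  rw [stringCoeff_one, mvec_one, dilatonCoeff]
  rcases Nat.eq_zero_or_pos j.2 with h | h
  · simp [h]
  · rw [if_neg h.ne']
    have h1 : ((2 * j.2).factorial : ℂ) = 2 * j.2 * ((2 * j.2 - 1).factorial : ℂ) := by
      rw [← Nat.mul_factorial_pred (by omega : 2 * j.2 ≠ 0)]
      push_cast
      rfl
    have h2 : ((2 * j.2 - 1).factorial : ℂ) ≠ 0 := by exact_mod_cast Nat.factorial_ne_zero _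
    have h3 : (j.2 : ℂ) ≠ 0 := by exact_mod_cast h.ne'
    rw [h1]
    field_simp
    ring

theorem univ_val_map_snoc {n : ℕ} {κ : Type*} (l : Fin (n + 1) → κ) :
    (Finset.univ : Finset (Fin (n + 1))).val.map l =
      l (Fin.last n) ::ₘ (Finset.univ : Finset (Fin n)).val.map fun i => l i.castSucc := by
  rw [Fin.univ_castSuccEmb, Finset.cons_val, Multiset.map_cons, Finset.map_val, Multiset.map_map]
  rfl

theorem univ_val_map_eq_cons {n : ℕ} {κ : Type*} (l : Fin n → κ) (r : Fin n) :
    (Finset.univ : Finset (Fin n)).val.map l = l r ::ₘ (Finset.univ.erase r).val.map l := by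
  rw [← Multiset.map_cons, Finset.erase_val, Multiset.cons_erase (Finset.mem_univ_val r)]

theorem univ_val_map_update {n : ℕ} (b : Fin n → ℕ) (r : Fin n) (c : ℕ) :
    ((Finset.univ : Finset (Fin n)).val.map fun i => mvec (Function.update b r c i)) =
      mvec c ::ₘ (Finset.univ.erase r).val.map fun i => mvec (b i) := by
  rw [univ_val_map_eq_cons _ r, Function.update_self]
  congr 1
  refine Multiset.map_congr rfl fun i hi => ?_
  rw [Function.update_of_ne (Finset.ne_of_mem_erase (Finset.mem_val.mp hi))]

theorem corr_string {J : ℕ} (hJ : J ≤ 1) {n m : ℕ} (hm : m ≠ 0) (b : Fin n → ℕ) :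
    corr (Finset.univ.val.map fun i => mvec (b i))
        (dirDeriv (stringCoeff (stringVector J)) (freeEnergy (m + 1))) =
      ∑ r, (b r : ℂ) * corr (Finset.univ.val.map fun i => mvec (Function.update b r (b r - 1 + J) i))
        (freeEnergy m) := by
  rw [isFreeEnergy_freeEnergy.string (sum_stringVector_mul_virForm hJ) hm,
    corr_mkDerivation _ _ _ (fun r j => (b r : ℂ) * mvec (b r - 1 + J) j)
      (fun r j => dirDeriv_mvec_stringField hJ j (b r))
      (fun j => constantCoeff_stringField _ _ j)]
  refine Finset.sum_congr rfl fun r _ => ?_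
  rw [univ_val_map_update, corr_cons, dirDeriv_smul, corr_C_mul]

theorem coeffM_divisor {g n : ℕ} (hn : 1 ≤ n) (hgn : 2 < 2 * g + n) :
    DivisorEquation g (coeffM g n) (coeffM g (n + 1)) := by
  intro b d hd
  obtain ⟨m, hm⟩ : ∃ m, m + 2 = 2 * g + n := ⟨2 * g + n - 2, by omega⟩
  rw [coeffM_eq (by omega) (by omega), coeffM_eq hn hgn, show 2 * g + (n + 1) - 2 = m + 1 by omega,
    show 2 * g + n - 2 = m by omega, univ_val_map_snoc, corr_cons]
  simp only [Fin.snoc_last, Fin.snoc_castSucc]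
  set S : Multiset (Mode → ℂ) := Finset.univ.val.map fun i => mvec (b i) with hS
  have h1 := corr_string le_rfl (by omega : m ≠ 0) b
  have h2 : stringCoeff (stringVector 1) = fun j => 2 * mvec 1 j + dilatonCoeff j :=
    funext stringCoeff_one_eq
  obtain ⟨c, hc⟩ := isFreeEnergy_freeEnergy.dilaton m
  have hC : corr S (C c) = 0 := by
    obtain ⟨n, rfl⟩ : ∃ k, n = k + 1 := ⟨n - 1, by omega⟩
    rw [hS, univ_val_map_snoc, corr_C]
  rw [h2, dirDeriv_add, dirDeriv_smul, hc, corr_add, corr_add, corr_C_mul, corr_C_mul, ← hS, hC]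
    at h1
  -- The index `b r - 1 + 1` differs from `b r` only if `b r = 0`, and then the term has the factor
  -- zero.
  have h3 (r : Fin n) : (b r : ℂ) * corr (Finset.univ.val.map fun i =>
      mvec (Function.update b r (b r - 1 + 1) i)) (freeEnergy m) = b r * corr S (freeEnergy m) := by
    rcases Nat.eq_zero_or_pos (b r) with h0 | h0
    · rw [h0, Nat.cast_zero, zero_mul, zero_mul]
    · rw [Nat.sub_add_cancel h0, Function.update_eq_self]
  rw [Finset.sum_congr rfl fun r _ => h3 r, ← Finset.sum_mul] at h1
  have hm' : (m : ℂ) + 2 = 2 * g + n := by exact_mod_cast hm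
  linear_combination (1 / 2) * h1 - (1 / 2) * corr S (freeEnergy m) * hd -
    (1 / 2) * corr S (freeEnergy m) * hm'

/-! ### Polynomial form of the coefficients -/

/-- The polynomial `p` with `mvec b j = weight b * p b` when `b` has the given parity. -/
def mPoly (o : Bool) (j : Mode) : Polynomial ℂ :=
  Polynomial.C ((if o then sg j.1 else 1) / ((2 * j.2).factorial : ℂ)) * modePoly o j.2

theorem mvec_eq (b : ℕ) (j : Mode) :
    mvec b j = weight b * (mPoly (decide (Odd b)) j).eval (b : ℂ) := by
  rw [mvec, xc_eq, mPoly, Polynomial.eval_C_mul]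
  simp only [decide_eq_true_eq]
  ring

theorem natDegree_mPoly_le (o : Bool) (j : Mode) : (mPoly o j).natDegree ≤ j.2 :=
  (Polynomial.natDegree_C_mul_le _ _).trans (natDegree_modePoly_le o j.2)

/-- The vector `mvec 0` vanishes with the weight of `0`. Its cofactor is the direction of the
equation with `J = 0`, so the string equation concerns the polynomial part at `0` and not a
coefficient. -/
theorem eval_zero_mPoly (j : Mode) :
    (mPoly false j).eval 0 = stringCoeff (stringVector 0) j := by
  rw [mPoly, Polynomial.eval_C_mul, eval_zero_modePoly, stringCoeff_zero, if_neg Bool.false_ne_true]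
  by_cases h : j.2 = 0
  · simp [h]
  · simp [h]

/-- The polynomial part of `corr` at expansion coefficients of the given parities. -/
def corrPoly {n : ℕ} (o : Fin n → Bool) (f : Fock) : MvPolynomial (Fin n) ℂ :=
  ∑ t ∈ Fintype.piFinset fun _ : Fin n => f.vars,
    C (polar f t) * ∏ i, (mPoly (o i) (t i)).toMvPolynomial i

theorem eval_corrPoly {n : ℕ} (o : Fin n → Bool) (f : Fock) (x : Fin n → ℂ) :
    eval x (corrPoly o f) =
      corr (Finset.univ.val.map fun i j => (mPoly (o i) j).eval (x i)) f := by
  rw [corr_eq_sum_polar _ f subset_rfl, corrPoly, map_sum]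
  refine Finset.sum_congr rfl fun t _ => ?_
  rw [map_mul, eval_C, map_prod, mul_comm]
  simp only [eval_toMvPolynomial]

theorem corr_smul {n : ℕ} (c : Fin n → ℂ) (l : Fin n → Mode → ℂ) (f : Fock) :
    corr (Finset.univ.val.map fun i j => c i * l i j) f =
      (∏ i, c i) * corr (Finset.univ.val.map l) f := by
  rw [corr_eq_sum_polar _ f subset_rfl, corr_eq_sum_polar _ f subset_rfl, Finset.mul_sum]
  refine Finset.sum_congr rfl fun t _ => ?_
  rw [Finset.prod_mul_distrib, mul_assoc]

theorem totalDegree_toMvPolynomial_le {n : ℕ} (p : Polynomial ℂ) (i : Fin n) :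
    (p.toMvPolynomial i).totalDegree ≤ p.natDegree := by
  conv_lhs => rw [p.as_sum_range_C_mul_X_pow]
  rw [map_sum]
  refine totalDegree_finsetSum_le fun k hk => ?_
  rw [map_mul, map_pow, Polynomial.toMvPolynomial_C, Polynomial.toMvPolynomial_X]
  refine (totalDegree_mul _ _).trans ?_
  rw [totalDegree_C, totalDegree_X_pow, zero_add]
  exact Nat.lt_succ_iff.mp (Finset.mem_range.mp hk)

/-- A level `l` contributes degree at most `l`, and the weight bound reads `2 * ∑ l_i + n ≤ 3 * (2g
- 2 + n)`. -/
theorem totalDegree_corrPoly_le {g n : ℕ} (hn : 1 ≤ n) (hgn : 2 < 2 * g + n) (o : Fin n → Bool) :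
    (corrPoly o (freeEnergy (2 * g + n - 2))).totalDegree ≤ 3 * g + n - 3 := by
  refine totalDegree_finsetSum_le fun t _ => ?_
  by_cases h : polar (freeEnergy (2 * g + n - 2)) t = 0
  · rw [h, C_0, zero_mul, totalDegree_zero]
    exact Nat.zero_le _
  have h1 := isFreeEnergy_freeEnergy.weight_le (by omega) h
  rw [Finset.sum_add_distrib, ← Finset.mul_sum, Finset.sum_const, Finset.card_univ,
    Fintype.card_fin, smul_eq_mul, mul_one] at h1
  refine (totalDegree_mul _ _).trans ?_
  rw [totalDegree_C, zero_add]
  refine (totalDegree_finsetProd _ _).trans ?_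
  have h2 : ∑ i, ((mPoly (o i) (t i)).toMvPolynomial i).totalDegree ≤ ∑ i, (t i).2 :=
    Finset.sum_le_sum fun i _ =>
      (totalDegree_toMvPolynomial_le _ _).trans (natDegree_mPoly_le _ _)
  omega

/-- The parities of a vector whose first `k` entries are odd. -/
def firstParity (n k : ℕ) (i : Fin n) : Bool := decide ((i : ℕ) < k)

theorem FirstOdd.decide_eq {n k : ℕ} {b : Fin n → ℕ} (h : FirstOdd k b) (i : Fin n) :
    decide (Odd (b i)) = firstParity n k i := by
  rw [firstParity, decide_eq_decide]
  exact h i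

theorem corr_mvec {n k : ℕ} {b : Fin n → ℕ} (h : FirstOdd k b) (f : Fock) :
    corr (Finset.univ.val.map fun i => mvec (b i)) f =
      (∏ i, weight (b i)) * corr (Finset.univ.val.map fun i j =>
        (mPoly (firstParity n k i) j).eval (b i : ℂ)) f := by
  rw [← corr_smul]
  congr 2
  funext i j
  rw [mvec_eq, h.decide_eq]

theorem isPolynomialPart_coeffM {g n : ℕ} (hn : 1 ≤ n) (hgn : 2 < 2 * g + n) (k : ℕ) :
    IsPolynomialPart (coeffM g n) k
      (corrPoly (firstParity n k) (freeEnergy (2 * g + n - 2))) := by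
  intro b hb
  rw [coeffM_eq hn hgn, corr_mvec hb, eval_corrPoly]

theorem univ_val_map_comp {n : ℕ} {κ : Type*} (l : Fin n → κ) (σ : Equiv.Perm (Fin n)) :
    ((Finset.univ : Finset (Fin n)).val.map fun i => l (σ i)) = Finset.univ.val.map l := by
  conv_rhs => rw [← Multiset.map_univ_val_equiv σ, Multiset.map_map]
  rfl

theorem hasPolynomialForm_coeffM {g n : ℕ} (hn : 1 ≤ n) (hgn : 2 < 2 * g + n) :
    HasPolynomialForm g (coeffM g n) := by
  refine ⟨fun σ b => ?_, fun k _ => ⟨_, isPolynomialPart_coeffM hn hgn k,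
    totalDegree_corrPoly_le hn hgn _, fun σ hσ => MvPolynomial.funext fun x => ?_⟩⟩
  · rw [coeffM_eq hn hgn, coeffM_eq hn hgn]
    exact congrArg (fun s => corr s _) (univ_val_map_comp (fun i => mvec (b i)) σ)
  · rw [eval_rename, eval_corrPoly, eval_corrPoly,
      ← univ_val_map_comp (fun i j => (mPoly (firstParity n k i) j).eval (x i)) σ]
    have h (i : Fin n) : firstParity n k (σ i) = firstParity n k i := by
      rw [firstParity, firstParity, decide_eq_decide]
      exact hσ i
    simp only [h, Function.comp_apply]

/-! ### Uniqueness of polynomial parts -/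

/-- The positive numbers of a given parity. -/
def parityGrid (o : Prop) : Set ℂ := (fun b : ℕ => (b : ℂ)) '' {b | b ≠ 0 ∧ (Odd b ↔ o)}

theorem infinite_parityGrid (o : Prop) : (parityGrid o).Infinite := by
  refine Set.Infinite.image (Nat.cast_injective.injOn) ?_
  by_cases h : o
  · refine Set.infinite_of_injective_forall_mem (f := fun m : ℕ => 2 * m + 1)
      (fun a b h => by simpa using h) fun m => ⟨by omega, ?_⟩
    simp [h]
  · refine Set.infinite_of_injective_forall_mem (f := fun m : ℕ => 2 * (m + 1))
      (fun a b h => by simpa using h) fun m => ⟨by omega, ?_⟩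
    simp [h]

/-- Polynomials are determined by their values at positive numbers with given parities. -/
theorem eq_of_eval_firstOdd {n : ℕ} (k : ℕ) {p q : MvPolynomial (Fin n) ℂ}
    (h : ∀ b : Fin n → ℕ, (∀ i, b i ≠ 0) → FirstOdd k b →
      eval (fun i => (b i : ℂ)) p = eval (fun i => (b i : ℂ)) q) : p = q := by
  refine funext_set (fun i : Fin n => parityGrid ((i : ℕ) < k)) (fun i => infinite_parityGrid _)
    fun x hx => ?_
  have hx' (i : Fin n) : ∃ b : ℕ, (b ≠ 0 ∧ (Odd b ↔ (i : ℕ) < k)) ∧ (b : ℂ) = x i :=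
    hx i (Set.mem_univ i)
  choose b hb hbx using hx'
  have := h b (fun i => (hb i).1) fun i => (hb i).2
  simpa only [hbx] using this

theorem prod_weight_ne_zero {n : ℕ} {b : Fin n → ℕ} (hb : ∀ i, b i ≠ 0) :
    ∏ i, weight (b i) ≠ 0 := Finset.prod_ne_zero_iff.mpr fun i _ => weight_ne_zero (hb i)

theorem IsPolynomialPart.unique {n k : ℕ} {M : (Fin n → ℕ) → ℂ} {p q : MvPolynomial (Fin n) ℂ}
    (hp : IsPolynomialPart M k p) (hq : IsPolynomialPart M k q) : p = q :=
  eq_of_eval_firstOdd k fun b hb hk =>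
    mul_left_cancel₀ (prod_weight_ne_zero hb) ((hp b hk).symm.trans (hq b hk))

theorem IsPolynomialPart.polynomialPart_eq {n k : ℕ} {M : (Fin n → ℕ) → ℂ}
    {p : MvPolynomial (Fin n) ℂ} (hp : IsPolynomialPart M k p) : polynomialPart M k = p := by
  have h : ∃ p, IsPolynomialPart M k p := ⟨p, hp⟩
  rw [polynomialPart, dif_pos h]
  exact h.choose_spec.unique hp

theorem coeffM_string {g n : ℕ} (hn : 1 ≤ n) (hgn : 2 < 2 * g + n) :
    StringEquation (coeffM g n) (coeffM g (n + 1)) := by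
  intro k hk b hb
  obtain ⟨m, hm⟩ : ∃ m, m + 2 = 2 * g + n := ⟨2 * g + n - 2, by omega⟩
  have h1 := corr_string (J := 0) zero_le_one (by omega : m ≠ 0) b
  rw [valueAtZero, (isPolynomialPart_coeffM (by omega) (by omega) k).polynomialPart_eq,
    eval_corrPoly, univ_val_map_snoc, corr_cons, show 2 * g + (n + 1) - 2 = m + 1 by omega]
  have h2 : (fun j => (mPoly (firstParity (n + 1) k (Fin.last n)) j).eval
      ((Fin.snoc (fun i => (b i : ℂ)) 0 : Fin (n + 1) → ℂ) (Fin.last n))) =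
      stringCoeff (stringVector 0) := by
    funext j
    rw [Fin.snoc_last, firstParity, Fin.val_last, decide_eq_false (by omega), eval_zero_mPoly]
  have h3 (i : Fin n) (j : Mode) : (mPoly (firstParity (n + 1) k i.castSucc) j).eval
      ((Fin.snoc (fun i => (b i : ℂ)) 0 : Fin (n + 1) → ℂ) i.castSucc) =
      (mPoly (firstParity n k i) j).eval (b i : ℂ) := by
    rw [Fin.snoc_castSucc, firstParity, Fin.val_castSucc, firstParity]
  rw [h2]
  simp only [h3]
  rw [← corr_mvec hb, h1]
  refine Finset.sum_congr rfl fun i _ => ?_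
  rw [coeffM_eq hn hgn, Nat.add_zero, show 2 * g + n - 2 = m by omega]

/-! ### Determination by the divisor and string equations -/

/-- The remainder of `q` modulo `X j` does not involve this variable and agrees with `q` where it is
zero; so it vanishes, and `X j` divides every monomial of `q`. -/
theorem ne_zero_of_mem_support {n : ℕ} {q : MvPolynomial (Fin n) ℂ} {j : Fin n}
    (h : ∀ x, eval (Function.update x j 0) q = 0) {d : Fin n →₀ ℕ} (hd : d ∈ q.support) :
    d j ≠ 0 := by
  classical
  set r := q.modMonomial (Finsupp.single j 1) with hr
  have hrd (e : Fin n →₀ ℕ) (he : e ∈ r.support) : e j = 0 := by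
    by_contra hne
    rw [mem_support_iff] at he
    refine he (coeff_modMonomial_of_le q ?_)
    rw [Finsupp.single_le_iff]
    omega
  have hr0 : r = 0 := by
    refine MvPolynomial.funext fun x => ?_
    rw [map_zero]
    have h1 : eval x r = eval (Function.update x j 0) r := by
      rw [eval_eq', eval_eq']
      refine Finset.sum_congr rfl fun e he => ?_
      congr 1
      refine Finset.prod_congr rfl fun i _ => ?_
      by_cases hi : i = j
      · rw [hi, hrd e he, pow_zero, pow_zero]
      · rw [Function.update_of_ne hi]
    have h2 := congrArg (eval (Function.update x j 0)) (divMonomial_add_modMonomial_single q j)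
    rw [map_add, map_mul, eval_X, Function.update_self, zero_mul, zero_add, h] at h2
    rw [h1, h2]
  intro h0
  rw [mem_support_iff] at hd
  apply hd
  rw [← coeff_modMonomial_of_not_le q (s := Finsupp.single j 1)
    (by rw [Finsupp.single_le_iff]; omega), ← hr, hr0, coeff_zero]

theorem totalDegree_aeval_X_add_C_le {n : ℕ} (c : Fin n → ℂ) (p : MvPolynomial (Fin n) ℂ) :
    (aeval (fun i => X i + C (c i) : Fin n → MvPolynomial (Fin n) ℂ) p).totalDegree ≤
      p.totalDegree := by
  rw [aeval_def, eval₂_eq']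
  refine totalDegree_finsetSum_le fun d hd => ?_
  refine (totalDegree_mul _ _).trans ?_
  rw [algebraMap_eq, totalDegree_C, zero_add]
  refine (totalDegree_finsetProd _ _).trans ((Finset.sum_le_sum fun i _ => ?_).trans
    ((Finsupp.sum_fintype d (fun _ e => e) fun _ => rfl).symm.trans_le (le_totalDegree hd)))
  refine (totalDegree_pow _ _).trans ?_
  have : (X i + C (c i) : MvPolynomial (Fin n) ℂ).totalDegree ≤ 1 :=
    (totalDegree_add _ _).trans (by rw [totalDegree_X, totalDegree_C, max_eq_left zero_le_one])
  nlinarith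

/-- A polynomial of degree less than the number of variables which vanishes on a hyperplane
`x_j = c_j` for each `j` is zero. -/
theorem eq_zero_of_eval_update {n : ℕ} {p : MvPolynomial (Fin n) ℂ} (c : Fin n → ℂ)
    (hdeg : p.totalDegree < n) (h : ∀ j x, eval (Function.update x j (c j)) p = 0) : p = 0 := by
  -- The translation moves the hyperplanes to the coordinate hyperplanes. A monomial of `q` is then
  -- divisible by every variable and has degree at least `n`.
  set q := aeval (fun i => X i + C (c i) : Fin n → MvPolynomial (Fin n) ℂ) p with hq
  have heval (x : Fin n → ℂ) : eval x q = eval (fun i => x i + c i) p := by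
    rw [hq, aeval_def, algebraMap_eq, eval₂_eq', map_sum, eval_eq']
    refine Finset.sum_congr rfl fun d _ => ?_
    simp
  have hq0 : q = 0 := by
    by_contra hne
    obtain ⟨d, hd⟩ := Finset.nonempty_iff_ne_empty.mpr fun h0 => hne (support_eq_empty.mp h0)
    have h1 (j : Fin n) : d j ≠ 0 := by
      refine ne_zero_of_mem_support (fun x => ?_) hd
      have h2 : (fun i => Function.update x j 0 i + c i) =
          Function.update (fun i => x i + c i) j (c j) := by
        funext i
        by_cases hi : i = j
        · subst hi
          simp
        · simp [hi]
      rw [heval, h2, h]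
    have h2 := (le_totalDegree hd).trans (totalDegree_aeval_X_add_C_le c p)
    rw [Finsupp.sum_fintype d (fun _ e => e) fun _ => rfl] at h2
    have h3 : ∑ _i : Fin n, 1 ≤ ∑ i, d i :=
      Finset.sum_le_sum fun i _ => Nat.one_le_iff_ne_zero.mpr (h1 i)
    simp only [Finset.sum_const, Finset.card_univ, Fintype.card_fin, smul_eq_mul, mul_one] at h3
    omega
  refine MvPolynomial.funext fun x => ?_
  have h1 := heval fun i => x i - c i
  simp only [hq0, sub_add_cancel] at h1
  exact h1.symm

theorem exists_perm_firstOdd {n : ℕ} (b : Fin n → ℕ) :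
    ∃ (k : ℕ) (σ : Equiv.Perm (Fin n)), k ≤ n ∧ FirstOdd k (b ∘ σ) := by
  classical
  set k := Fintype.card {i // Odd (b i)} with hk
  have hkn : k ≤ n := by simpa using Fintype.card_subtype_le fun i => Odd (b i)
  have e : {i : Fin n // (i : ℕ) < k} ≃ {i // Odd (b i)} :=
    Fintype.equivOfCardEq (by rw [Fintype.card_fin_lt_of_le hkn])
  refine ⟨k, e.extendSubtype, hkn, fun i => ⟨fun h => ?_, fun h => e.extendSubtype_mem i h⟩⟩
  by_contra hi
  exact e.extendSubtype_not_mem i hi h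

theorem HasPolynomialForm.isPolynomialPart {g n k : ℕ} {M : (Fin n → ℕ) → ℂ}
    (h : HasPolynomialForm g M) (hk : k ≤ n) : IsPolynomialPart M k (polynomialPart M k) := by
  obtain ⟨p, hp, -⟩ := h.2 k hk
  rwa [hp.polynomialPart_eq]

theorem HasPolynomialForm.totalDegree_le {g n k : ℕ} {M : (Fin n → ℕ) → ℂ}
    (h : HasPolynomialForm g M) (hk : k ≤ n) : (polynomialPart M k).totalDegree ≤ 3 * g + n - 3 := by
  obtain ⟨p, hp, hd, -⟩ := h.2 k hk
  rwa [hp.polynomialPart_eq]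

theorem HasPolynomialForm.eval_comp {g n k : ℕ} {M : (Fin n → ℕ) → ℂ}
    (h : HasPolynomialForm g M) (hk : k ≤ n) (σ : Equiv.Perm (Fin n))
    (hσ : ∀ i, (σ i : ℕ) < k ↔ (i : ℕ) < k) (x : Fin n → ℂ) :
    eval (x ∘ σ) (polynomialPart M k) = eval x (polynomialPart M k) := by
  obtain ⟨p, hp, -, hs⟩ := h.2 k hk
  rw [hp.polynomialPart_eq, ← eval_rename, hs σ hσ]

theorem HasPolynomialForm.ext {g n : ℕ} {M N : (Fin n → ℕ) → ℂ} (hM : HasPolynomialForm g M)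
    (hN : HasPolynomialForm g N) (h : ∀ k ≤ n, polynomialPart M k = polynomialPart N k) :
    M = N := by
  funext b
  obtain ⟨k, σ, hk, hb⟩ := exists_perm_firstOdd b
  rw [← hM.1 σ b, ← hN.1 σ b, hM.isPolynomialPart hk _ hb, hN.isPolynomialPart hk _ hb, h k hk]

theorem comp_swap_last {n : ℕ} {κ : Type*} (b : Fin (n + 1) → κ) (j : Fin (n + 1)) :
    b ∘ Equiv.swap j (Fin.last n) =
      Fin.snoc (fun i : Fin n => b (Equiv.swap j (Fin.last n) i.castSucc)) (b j) := by
  funext i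
  refine Fin.lastCases ?_ (fun i => ?_) i
  · simp
  · simp

/-- Functions of polynomial form are determined by the divisor and string equations if their
polynomial parts are known up to terms of degree less than the number of variables. -/
theorem HasPolynomialForm.eq_of_equations {g n : ℕ} {M : (Fin n → ℕ) → ℂ}
    {N N' : (Fin (n + 1) → ℕ) → ℂ} (hN : HasPolynomialForm g N) (hN' : HasPolynomialForm g N')
    (hd : DivisorEquation g M N) (hd' : DivisorEquation g M N') (hs : StringEquation M N)
    (hs' : StringEquation M N')
    (hdeg : ∀ k ≤ n + 1, (polynomialPart N k - polynomialPart N' k).totalDegree < n + 1) :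
    N = N' := by
  classical
  refine hN.ext hN' fun k hk => sub_eq_zero.mp ?_
  -- The divisor equation prescribes values at `1` for an odd variable, the string equation at `0`
  -- for an even one.
  set c : Fin (n + 1) → ℂ := fun j => if (j : ℕ) < k then 1 else 0 with hc
  refine eq_zero_of_eval_update c (hdeg k hk) fun j x => ?_
  rw [map_sub, sub_eq_zero]
  -- Restriction to the hyperplane is written as a substitution of polynomials, so that it suffices
  -- to compare values at positive integers of the given parities, where the weights do not vanish.
  have hred (p : MvPolynomial (Fin (n + 1)) ℂ) (x : Fin (n + 1) → ℂ) :
      eval (Function.update x j (c j)) p = eval x (aeval (Function.update X j (C (c j))) p) := by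
    rw [aeval_def, algebraMap_eq, eval₂_eq', map_sum, eval_eq']
    refine Finset.sum_congr rfl fun d _ => ?_
    rw [map_mul, eval_C, map_prod]
    congr 1
    refine Finset.prod_congr rfl fun i _ => ?_
    rw [map_pow]
    by_cases hi : i = j
    · subst hi
      simp
    · simp [hi]
  rw [hred, hred]
  congr 1
  refine eq_of_eval_firstOdd k fun b hb0 hb => ?_
  rw [← hred, ← hred]
  by_cases hj : (j : ℕ) < k
  · -- an odd variable is set to `1`
    have hcj : c j = ((1 : ℕ) : ℂ) := by rw [hc, Nat.cast_one]; exact if_pos hj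
    set b' := Function.update b j 1 with hb'
    have hb1 : (Function.update (fun i => (b i : ℂ)) j (c j)) = fun i => (b' i : ℂ) := by
      funext i
      by_cases hi : i = j
      · subst hi
        rw [hb', Function.update_self, Function.update_self, hcj]
      · rw [hb', Function.update_of_ne hi, Function.update_of_ne hi]
    have hbk : FirstOdd k b' := fun i => by
      by_cases hi : i = j
      · subst hi
        simp [hb', hj]
      · rw [hb', Function.update_of_ne hi]
        exact hb i
    have hbne (i : Fin (n + 1)) : b' i ≠ 0 := by
      by_cases hi : i = j
      · subst hi
        simp [hb']
      · rw [hb', Function.update_of_ne hi]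
        exact hb0 i
    rw [hb1]
    refine mul_left_cancel₀ (prod_weight_ne_zero hbne) ?_
    rw [← hN.isPolynomialPart hk _ hbk, ← hN'.isPolynomialPart hk _ hbk,
      ← hN.1 (Equiv.swap j (Fin.last n)), ← hN'.1 (Equiv.swap j (Fin.last n)), comp_swap_last,
      show b' j = 1 by rw [hb', Function.update_self]]
    set b₁ : Fin n → ℕ := fun i => b' (Equiv.swap j (Fin.last n) i.castSucc)
    have h2 : 2 * ((2 - 2 * (g : ℂ) - (n : ℂ) + ∑ i, (b₁ i : ℂ)) / 2) =
      2 - 2 * (g : ℂ) - (n : ℂ) + ∑ i, (b₁ i : ℂ) := by ring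
    rw [hd b₁ _ h2, hd' b₁ _ h2]
  · -- an even variable is set to `0`
    have hkn : k ≤ n := by have := j.isLt; omega
    have hcj : c j = 0 := if_neg hj
    set σ := Equiv.swap j (Fin.last n) with hσ
    have hσk (i : Fin (n + 1)) : (σ i : ℕ) < k ↔ (i : ℕ) < k := by
      rw [hσ, Equiv.swap_apply_def]
      split_ifs with h1 h2
      · subst h1
        simp only [Fin.val_last]
        omega
      · subst h2
        simp only [Fin.val_last]
        omega
      · rfl
    set b₁ : Fin n → ℕ := fun i => b (σ i.castSucc) with hb₁
    have hb₁k : FirstOdd k b₁ := fun i => by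
      rw [hb₁, hb]
      exact hσk _
    have hsnoc : (Function.update (fun i => (b i : ℂ)) j (c j)) ∘ σ =
        (Fin.snoc (fun i => (b₁ i : ℂ)) 0 : Fin (n + 1) → ℂ) := by
      rw [hσ, comp_swap_last, Function.update_self, hcj]
      congr 1
      funext i
      rw [Function.update_of_ne]
      intro h
      rw [Equiv.swap_apply_eq_iff, Equiv.swap_apply_left] at h
      exact (Fin.castSucc_lt_last i).ne h
    -- The places `j` and `Fin.last n` both belong to even variables, so the symmetry of the
    -- polynomial parts moves the argument `0` to the end.
    rw [← hN.eval_comp hk σ hσk, ← hN'.eval_comp hk σ hσk, hsnoc]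
    refine mul_left_cancel₀ (prod_weight_ne_zero (b := b₁) fun i => hb0 _) ?_
    exact (hs k hkn b₁ hb₁k).trans (hs' k hkn b₁ hb₁k).symm

theorem totalDegree_lt_of_coeff_eq_zero {n d : ℕ} (hd : 0 < d) {p : MvPolynomial (Fin n) ℂ}
    (hp : p.totalDegree ≤ d) (h : ∀ β : Fin n →₀ ℕ, β.degree = d → coeff β p = 0) :
    p.totalDegree < d := by
  rw [totalDegree, Finset.sup_lt_iff (by simpa using hd)]
  intro β hβ
  refine lt_of_le_of_ne ((le_totalDegree hβ).trans hp) fun h0 => ?_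
  exact mem_support_iff.mp hβ (h β h0)

end EynardOrantin

end

/-! ### The four statements put together. -/

theorem mainTheorem5 :
    -- The expansion about `x = ∞` exists, and its coefficients have the polynomial form.
    (∀ g n : ℕ, 1 ≤ n → 2 < 2 * g + n →
      EynardOrantin.IsExpansionAtInfinity (EynardOrantin.omega EynardOrantin.lnBranch g n)
        (EynardOrantin.coeffM g n) ∧
      EynardOrantin.HasPolynomialForm g (EynardOrantin.coeffM g n)) ∧
    -- Divisor and string equations in all genera.
    (∀ g n : ℕ, 1 ≤ n → 2 < 2 * g + n →
      EynardOrantin.DivisorEquation g (EynardOrantin.coeffM g n)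
        (EynardOrantin.coeffM g (n + 1)) ∧
      EynardOrantin.StringEquation (EynardOrantin.coeffM g n)
        (EynardOrantin.coeffM g (n + 1))) ∧
    -- In genus zero, the equations and the initial case `n = 3` determine all the coefficients.
    (∀ M : (n : ℕ) → (Fin n → ℕ) → ℂ,
      (∀ n, 3 ≤ n → EynardOrantin.HasPolynomialForm 0 (M n)) →
      (∀ n, 3 ≤ n → EynardOrantin.DivisorEquation 0 (M n) (M (n + 1))) →
      (∀ n, 3 ≤ n → EynardOrantin.StringEquation (M n) (M (n + 1))) →
      M 3 = EynardOrantin.coeffM 0 3 →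
      ∀ n, 3 ≤ n → M n = EynardOrantin.coeffM 0 n) ∧
    -- In genus one, the equations, the initial case `n = 1` and the coefficients of the terms of
    -- top degree `3g - 3 + n = n` determine all the coefficients.
    (∀ M : (n : ℕ) → (Fin n → ℕ) → ℂ,
      (∀ n, 1 ≤ n → EynardOrantin.HasPolynomialForm 1 (M n)) →
      (∀ n, 1 ≤ n → EynardOrantin.DivisorEquation 1 (M n) (M (n + 1))) →
      (∀ n, 1 ≤ n → EynardOrantin.StringEquation (M n) (M (n + 1))) →
      M 1 = EynardOrantin.coeffM 1 1 →
      (∀ n, 1 ≤ n → ∀ k ≤ n, ∀ β : Fin n →₀ ℕ, β.degree = n →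
        (EynardOrantin.polynomialPart (M n) k).coeff β =
          (EynardOrantin.polynomialPart (EynardOrantin.coeffM 1 n) k).coeff β) →
      ∀ n, 1 ≤ n → M n = EynardOrantin.coeffM 1 n) := by
  refine ⟨fun g n hn hgn => ⟨EynardOrantin.isExpansionAtInfinity_coeffM hn hgn,
      EynardOrantin.hasPolynomialForm_coeffM hn hgn⟩,
    fun g n hn hgn => ⟨EynardOrantin.coeffM_divisor hn hgn, EynardOrantin.coeffM_string hn hgn⟩,
    fun M hM hd hs h3 n hn => ?_, fun M hM hd hs h1 htop n hn => ?_⟩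
  · induction n, hn using Nat.le_induction with
    | base => exact h3
    | succ n hn ih =>
      have hN := EynardOrantin.hasPolynomialForm_coeffM (g := 0) (n := n + 1) (by omega) (by omega)
      refine (hM (n + 1) (by omega)).eq_of_equations hN (hd n hn)
        (ih ▸ EynardOrantin.coeffM_divisor (by omega) (by omega)) (hs n hn)
        (ih ▸ EynardOrantin.coeffM_string (by omega) (by omega)) fun k hk => ?_
      -- In genus zero with `n + 1` variables the degree is at most `n - 2`, less than the number of
      -- variables.
      refine (MvPolynomial.totalDegree_sub _ _).trans_lt (max_lt ?_ ?_)
      · exact ((hM (n + 1) (by omega)).totalDegree_le hk).trans_lt (by omega)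
      · exact (hN.totalDegree_le hk).trans_lt (by omega)
  · induction n, hn using Nat.le_induction with
    | base => exact h1
    | succ n hn ih =>
      have hN := EynardOrantin.hasPolynomialForm_coeffM (g := 1) (n := n + 1) (by omega) (by omega)
      refine (hM (n + 1) (by omega)).eq_of_equations hN (hd n hn)
        (ih ▸ EynardOrantin.coeffM_divisor (by omega) (by omega)) (hs n hn)
        (ih ▸ EynardOrantin.coeffM_string (by omega) (by omega)) fun k hk => ?_
      -- In genus one the degree bound equals the number of variables, and agreement of the top
      -- degree terms makes the inequality strict.
      refine EynardOrantin.totalDegree_lt_of_coeff_eq_zero n.succ_pos ?_ fun β hβ => ?_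
      · refine (MvPolynomial.totalDegree_sub _ _).trans (max_le ?_ ?_)
        · exact ((hM (n + 1) (by omega)).totalDegree_le hk).trans (by omega)
        · exact (hN.totalDegree_le hk).trans (by omega)
      · rw [MvPolynomial.coeff_sub, htop (n + 1) (by omega) k hk β hβ, sub_self]
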